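/- Let $K$ be a field of characteristic $0$ which is complete with respect to a nontrivial nonarchimedean absolute value. *Manifold* means: paracompact Hausdorff finite dimensional locally $K$-analytic manifold. Let $V$ be a separated locally convex $K$-vector space, let $G$ be a locally $K$-analytic Lie group, and let $\rho\colon G\to \mathrm{Aut}(V)$ be a locally analytic representation, i.e. $G$ acts by continuous linear automorphisms and all orbit maps $g\mapsto gv$ are analytic in the following sense. A BH-space of $V$ is a $K$-Banach space $W$ with a continuous linear injection $W\hookrightarrow V$. A map $f\colon X\to V$ from a manifold is *analytic* if locally on $X$ it factors through a locally analytic map into some BH-space of $V$; it is *admissible* if both $f$ and $\hat f\colon G\times X\to V$, $(g,x)\mapsto g f(x)$, are analytic. For manifolds $X,Y$, a *$V$-valued relative $k$-form* $\omega$ on $X\times Y/X$ is a family of alternating $K$-multilinear maps $\omega_{(x,y)}\colon (T_yY)^k\to V$, $(x,y)\in X\times Y$. It is *analytic* if for every open $U\subseteq X\times Y$ and all analytic sections $\xi_1,\dots,\xi_k$ over $U$ of the vertical tangent bundle $T(X\times Y/X)$ the function $\omega(\xi_1,\dots,\xi_k)\colon U\to V$ is analytic. It is *admissible* if it is analytic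 and the relative form $\hat\omega_{(g,x,y)}=g\,\omega_{(x,y)}$ on $G\times X\times Y/G\times X$ is analytic as well. Let $\Omega^k_{ad}(X\times Y/X,V)$ be the group of admissible relative $k$-forms and $d$ the exterior derivative along $Y$; it preserves admissibility. Consider the category of manifolds and locally analytic maps as a site with the topology of open coverings. For a manifold $Y$ let $\Omega^k_{ad}(Y,V)$ be the abelian sheaf $X\mapsto\Omega^k_{ad}(X\times Y/X,V)$ on this site, so that $(\Omega^*_{ad}(Y,V),d)$ is a complex of abelian sheaves in degrees $\ge 0$, and let $C^{lc}_{ad}(Y,V)$ be the abelian sheaf which sends $X$ to the group of admissible functions $f\colon X\times Y\to V$ that are locally constant along $Y$, i.e. such that each point of $X\times Y$ has a neighbourhood $X'\times Y'$ on which $f$ factors through the projection $X'\times Y'\to X'$. Then for every manifold $Y$ the inclusion $$C^{lc}_{ad}(Y,V)\longrightarrow \Omega^*_{ad}(Y,V),$$ where the left hand side is placed in degree $0$, is a quasi-isomorphism of complexes of abelian sheaves on the site of manifolds. -/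

import Mathlib

open CategoryTheory
open scoped Manifold ContDiff Topology

universe u


noncomputable section

/-! ### Analytic functions with values in a locally convex space -/

/-- A BH-space for the topological vector space `V`: a (nonarchimedean) Banach space `W` together
with a continuous linear injection `W → V`. -/
structure BHSpace (K : Type u) [NontriviallyNormedField K] (V : Type u) [AddCommGroup V]
    [Module K V] [TopologicalSpace V] where
  carrier : Type u
  [normedAddCommGroup : NormedAddCommGroup carrier]
  [normedSpace : NormedSpace K carrier]
  [isUltrametricDist : IsUltrametricDist carrier]
  [completeSpace : CompleteSpace carrier]
  incl : carrier →L[K] V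
  injective : Function.Injective incl

attribute [instance] BHSpace.normedAddCommGroup BHSpace.normedSpace BHSpace.isUltrametricDist
  BHSpace.completeSpace

section AnalyticFunctions

variable {K : Type u} [NontriviallyNormedField K]
  {V : Type u} [AddCommGroup V] [Module K V] [TopologicalSpace V]
  {E : Type*} [NormedAddCommGroup E] [NormedSpace K E] {H : Type*} [TopologicalSpace H]
  (I : ModelWithCorners K E H) {M : Type*} [TopologicalSpace M] [ChartedSpace H M]
  {E' : Type*} [NormedAddCommGroup E'] [NormedSpace K E'] {H' : Type*} [TopologicalSpace H']
  {I' : ModelWithCorners K E' H'} {M' : Type*} [TopologicalSpace M'] [ChartedSpace H' M']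

variable (K) in
/-- `f : M → V` is analytic near `x`: on some neighbourhood of `x` it factors through an analytic
map into a BH-space for `V`. -/
def VAnalyticAt (f : M → V) (x : M) : Prop :=
  ∃ U ∈ 𝓝 x, ∃ (W : BHSpace K V) (h : M → W.carrier),
    ContMDiffOn I 𝓘(K, W.carrier) ω h U ∧ ∀ z ∈ U, f z = W.incl (h z)

variable (K) in
/-- Analytic functions from the manifold `M` to `V`. -/
def VAnalytic (f : M → V) : Prop :=
  ∀ x, VAnalyticAt K I f x

variable {I}

theorem vAnalyticAt_iff [IsManifold I ω M] {f : M → V} {x : M} :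
    VAnalyticAt K I f x ↔ ∃ (W : BHSpace K V) (h : M → W.carrier),
      ContMDiffAt I 𝓘(K, W.carrier) ω h x ∧ ∀ᶠ z in 𝓝 x, f z = W.incl (h z) := by
  constructor
  · rintro ⟨U, hU, W, h, hh, he⟩
    exact ⟨W, h, hh.contMDiffAt hU, Filter.mem_of_superset hU he⟩
  · rintro ⟨W, h, hh, he⟩
    obtain ⟨U, hU, hUh⟩ := (contMDiffAt_iff_contMDiffOn_nhds (by simp)).1 hh
    exact ⟨U ∩ {z | f z = W.incl (h z)}, Filter.inter_mem hU he, W, h,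
      hUh.mono Set.inter_subset_left, fun z hz => hz.2⟩

theorem VAnalyticAt.comp [IsManifold I ω M] [IsManifold I' ω M'] {f : M → V} {φ : M' → M} {x : M'}
    (hf : VAnalyticAt K I f (φ x)) (hφ : ContMDiffAt I' I ω φ x) :
    VAnalyticAt K I' (fun z => f (φ z)) x := by
  rw [vAnalyticAt_iff] at hf ⊢
  obtain ⟨W, h, hh, he⟩ := hf
  exact ⟨W, fun z => h (φ z), hh.comp x hφ, hφ.continuousAt.eventually he⟩

theorem VAnalyticAt.congr [IsManifold I ω M] {f g : M → V} {x : M}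
    (hf : VAnalyticAt K I f x) (h : ∀ᶠ z in 𝓝 x, g z = f z) : VAnalyticAt K I g x := by
  rw [vAnalyticAt_iff] at hf ⊢
  obtain ⟨W, k, hk, he⟩ := hf
  exact ⟨W, k, hk, by filter_upwards [h, he] with z h1 h2 using h1.trans h2⟩

theorem VAnalyticAt.const_smul [IsManifold I ω M] {f : M → V} {x : M} (c : K)
    (hf : VAnalyticAt K I f x) : VAnalyticAt K I (fun z => c • f z) x := by
  rw [vAnalyticAt_iff] at hf ⊢
  obtain ⟨W, h, hh, he⟩ := hf
  refine ⟨W, fun z => c • h z,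
    (c • ContinuousLinearMap.id K W.carrier).contMDiff.contMDiffAt.comp x hh, ?_⟩
  filter_upwards [he] with z hz
  rw [hz, map_smul]

theorem vAnalyticAt_zero {x : M} : VAnalyticAt K I (fun _ => (0 : V)) x :=
  ⟨Set.univ, Filter.univ_mem,
    { carrier := PUnit, isUltrametricDist := ⟨fun _ _ _ => by simp⟩, incl := 0, injective := Function.injective_of_subsingleton _ },
    fun _ => 0, contMDiffOn_const, fun _ _ => rfl⟩

theorem isUltrametricDist_quotient {W : Type*} [NormedAddCommGroup W] [NormedSpace K W]
    [IsUltrametricDist W] (S : Submodule K W) [IsClosed (S : Set W)] :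
    IsUltrametricDist (W ⧸ S) := by
  refine IsUltrametricDist.isUltrametricDist_of_forall_norm_add_le_max_norm fun x y => ?_
  refine le_of_forall_pos_lt_add fun ε hε => ?_
  obtain ⟨a, rfl, ha⟩ := Submodule.Quotient.norm_mk_lt x hε
  obtain ⟨b, rfl, hb⟩ := Submodule.Quotient.norm_mk_lt y hε
  rw [← Submodule.Quotient.mk_add]
  calc _ ≤ ‖a + b‖ := Submodule.Quotient.norm_mk_le S (a + b)
    _ ≤ max ‖a‖ ‖b‖ := IsUltrametricDist.norm_add_le_max a b
    _ < _ := by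
      rw [← max_add_add_right]
      exact max_lt_max ha hb

variable [IsTopologicalAddGroup V] [T2Space V]

/-- The sum, inside `V`, of finitely many BH-spaces. -/
theorem exists_bhSpace_sum {ι : Type} [Fintype ι] (W : ι → BHSpace K V) :
    ∃ (W' : BHSpace K V) (j : ∀ i, (W i).carrier →L[K] W'.carrier),
      ∀ i w, W'.incl (j i w) = (W i).incl w := by
  classical
  let T : (∀ i, (W i).carrier) →L[K] V := ∑ i, (W i).incl ∘L ContinuousLinearMap.proj i
  have : IsClosed ((LinearMap.ker T.toLinearMap : Submodule K _) : Set (∀ i, (W i).carrier)) :=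
    T.isClosed_ker
  let S : Submodule K (∀ i, (W i).carrier) := LinearMap.ker T.toLinearMap
  have hS : IsClosed (S : Set (∀ i, (W i).carrier)) := T.isClosed_ker
  have hu : IsUltrametricDist ((∀ i, (W i).carrier) ⧸ S) := isUltrametricDist_quotient S
  let T' : ((∀ i, (W i).carrier) ⧸ S) →L[K] V :=
    ⟨S.liftQ T.toLinearMap le_rfl, T.continuous.quotient_lift _⟩
  have hinj : Function.Injective T' := by
    have h : LinearMap.ker T'.toLinearMap = ⊥ := Submodule.ker_liftQ_eq_bot _ _ _ le_rfl
    exact LinearMap.ker_eq_bot.1 h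
  refine ⟨⟨(∀ i, (W i).carrier) ⧸ S, T', hinj⟩,
    fun i => S.mkQL ∘L ContinuousLinearMap.single K (fun i => (W i).carrier) i,
    fun i w => ?_⟩
  change T (Pi.single i w) = _
  simp only [T, _root_.sum_apply, ContinuousLinearMap.comp_apply,
    ContinuousLinearMap.proj_apply]
  rw [Finset.sum_eq_single i]
  · simp
  · intro k _ hk
    simp [Pi.single_eq_of_ne hk]
  · simp

theorem VAnalyticAt.common [IsManifold I ω M] {ι : Type} [Fintype ι] {f : ι → M → V} {x : M}
    (hf : ∀ i, VAnalyticAt K I (f i) x) :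
    ∃ (W : BHSpace K V) (h : ι → M → W.carrier),
      (∀ i, ContMDiffAt I 𝓘(K, W.carrier) ω (h i) x) ∧
        ∀ᶠ z in 𝓝 x, ∀ i, f i z = W.incl (h i z) := by
  simp only [vAnalyticAt_iff] at hf
  choose W h hh he using hf
  obtain ⟨W', j, hj⟩ := exists_bhSpace_sum W
  refine ⟨W', fun i z => j i (h i z), fun i => ?_, ?_⟩
  · exact (j i).contMDiff.contMDiffAt.comp x (hh i)
  · rw [Filter.eventually_all]
    intro i
    filter_upwards [he i] with z hz
    rw [hj, hz]

theorem VAnalyticAt.add [IsManifold I ω M] {f g : M → V} {x : M}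
    (hf : VAnalyticAt K I f x) (hg : VAnalyticAt K I g x) :
    VAnalyticAt K I (fun z => f z + g z) x := by
  obtain ⟨W, h, hh, he⟩ := VAnalyticAt.common (ι := Bool) (f := fun b => if b then f else g)
    (x := x) (I := I) (K := K) (by simp [hf, hg])
  rw [vAnalyticAt_iff]
  refine ⟨W, fun z => h true z + h false z, (hh true).add (hh false), ?_⟩
  filter_upwards [he] with z hz
  have h1 := hz true
  have h2 := hz false
  simp only [if_true, Bool.false_eq_true, if_false] at h1 h2
  rw [h1, h2, map_add]

end AnalyticFunctions

/-! ### Relative differential forms on `B × Y / B` -/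

section Forms

variable {K : Type u} [NontriviallyNormedField K]
  {V : Type u} [AddCommGroup V] [Module K V] [TopologicalSpace V]
  {EB : Type*} [NormedAddCommGroup EB] [NormedSpace K EB] {HB : Type*} [TopologicalSpace HB]
  (I : ModelWithCorners K EB HB) {B : Type*} [TopologicalSpace B] [ChartedSpace HB B]
  {F : Type*} [NormedAddCommGroup F] [NormedSpace K F]
  {Y : Type*} [TopologicalSpace Y] [ChartedSpace F Y] {k : ℕ}

variable (K F Y V k) in
/-- Not necessarily continuous families, indexed by the points `y` of `Y`, of alternating `k`-forms
on the tangent space of `Y` at `y` with values in `V`. -/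
abbrev VForm : Type _ :=
  ∀ y : Y, (TangentSpace 𝓘(K, F) y) [⋀^Fin k]→ₗ[K] V

/-- A relative `k`-form `η` on `B × Y / B`, i.e. a family of alternating maps `η b y` on
`T_{(b, y)}(B × Y / B) = T_y Y`, is analytic if evaluating it on local analytic sections of the
vertical tangent bundle gives analytic functions. Such a section over `U` is an analytic map
`U → T Y` lying over the projection `U → Y`. -/
def IsAnalyticForm [IsManifold 𝓘(K, F) ω Y] (η : B → VForm K V F Y k) : Prop :=
  ∀ (U : Set (B × Y)), IsOpen U →
    ∀ φ : Fin k → ∀ p : B × Y, TangentSpace 𝓘(K, F) p.2,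
      (∀ i, ContMDiffOn (I.prod 𝓘(K, F)) 𝓘(K, F).tangent ω
        (fun p => (⟨p.2, φ i p⟩ : TangentBundle 𝓘(K, F) Y)) U) →
      ∀ p ∈ U, VAnalyticAt K (I.prod 𝓘(K, F)) (fun p : B × Y => η p.1 p.2 fun i => φ i p) p

/-- The pullback of a form on `Y` along the inverse of the preferred chart at `y₀`. -/
def chartForm (η : VForm K V F Y k) (y₀ : Y) (x : F) : F [⋀^Fin k]→ₗ[K] V :=
  (η ((extChartAt 𝓘(K, F) y₀).symm x)).compLinearMap
    (mfderiv 𝓘(K, F) 𝓘(K, F) (extChartAt 𝓘(K, F) y₀).symm x).toLinearMap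

/-- `D v w` is the derivative in direction `v` at `x` of the coefficient function
`x' ↦ η x' w`, for all `w`. -/
def IsFormFDeriv (η : F → F [⋀^Fin k]→ₗ[K] V) (x : F) (D : F →ₗ[K] F [⋀^Fin k]→ₗ[K] V) : Prop :=
  ∀ w, ∃ A : F →L[K] V, HasFDerivAt (fun x' => η x' w) A x ∧ ∀ v, A v = D v w

open Classical in
/-- The derivative of a form on `F`; by convention zero where some coefficient function is not
differentiable. -/
def formFDeriv (η : F → F [⋀^Fin k]→ₗ[K] V) (x : F) : F →ₗ[K] F [⋀^Fin k]→ₗ[K] V :=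
  if h : ∃ D, IsFormFDeriv η x D then h.choose else 0

/-- The exterior derivative of a form on `F`:
`(dη)(x)(v₀, …, v_k) = ∑ i, (-1)^i (∂_{v_i} η)(x)(v₀, …, v_{i-1}, v_{i+1}, …, v_k)`. -/
def vExtDeriv (η : F → F [⋀^Fin k]→ₗ[K] V) (x : F) : F [⋀^Fin (k + 1)]→ₗ[K] V :=
  AlternatingMap.alternatizeUncurryFin (formFDeriv η x)

/-- The exterior derivative of a form on `Y`. At `y` it is computed in the preferred chart at `y`,
whose derivative at `y` is the identification of `T_y Y` with the model space `F`. -/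
def formD (η : VForm K V F Y k) : VForm K V F Y (k + 1) :=
  fun y => (vExtDeriv (chartForm η y) (extChartAt 𝓘(K, F) y y) : F [⋀^Fin (k + 1)]→ₗ[K] V)

end Forms

section FormLemmas

variable {K : Type u} [NontriviallyNormedField K]
  {V : Type u} [AddCommGroup V] [Module K V] [TopologicalSpace V]
  {F : Type*} [NormedAddCommGroup F] [NormedSpace K F] {k : ℕ}

theorem HasFDerivAt.clm_comp_tvs {W : Type*} [NormedAddCommGroup W] [NormedSpace K W]
    {h : F → W} {h' : F →L[K] W} {x : F} (hh : HasFDerivAt h h' x) (A : W →L[K] V) :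
    HasFDerivAt (fun z => A (h z)) (A ∘L h') x := by
  rw [hasFDerivAt_iff_isLittleOTVS] at hh ⊢
  have := (A.isBigOTVS_comp (f := fun x' => h x' - h x - h' (x' - x)) (l := 𝓝 x)).trans_isLittleOTVS
    hh
  simpa [Function.comp_def] using this

theorem HasFDerivAt.clm_comp_tvs' {h : F → V} {h' : F →L[K] V} {x : F} (hh : HasFDerivAt h h' x)
    (A : V →L[K] V) : HasFDerivAt (fun z => A (h z)) (A ∘L h') x := by
  rw [hasFDerivAt_iff_isLittleOTVS] at hh ⊢
  have := (A.isBigOTVS_comp (f := fun x' => h x' - h x - h' (x' - x)) (l := 𝓝 x)).trans_isLittleOTVS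
    hh
  simpa [Function.comp_def] using this

theorem IsFormFDeriv.clm_comp {η : F → F [⋀^Fin k]→ₗ[K] V} {x : F}
    {D : F →ₗ[K] F [⋀^Fin k]→ₗ[K] V} (h : IsFormFDeriv η x D) (A : V →L[K] V) :
    IsFormFDeriv (fun z => A.toLinearMap.compAlternatingMap (η z)) x
      (A.toLinearMap.compAlternatingMapₗ K ∘ₗ D) := fun w => by
  obtain ⟨B, hB, hB'⟩ := h w
  exact ⟨A ∘L B, hB.clm_comp_tvs' A, fun v => by simp [hB']⟩

variable [IsTopologicalAddGroup V] [ContinuousSMul K V]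

theorem HasFDerivAt.add_tvs {f g : F → V} {f' g' : F →L[K] V} {x : F} (hf : HasFDerivAt f f' x)
    (hg : HasFDerivAt g g' x) : HasFDerivAt (fun z => f z + g z) (f' + g') x := by
  rw [hasFDerivAt_iff_isLittleOTVS] at hf hg ⊢
  refine (hf.add hg).congr_left fun z => ?_
  simp only [Pi.add_apply, _root_.add_apply]
  abel

theorem IsFormFDeriv.add {η θ : F → F [⋀^Fin k]→ₗ[K] V} {x : F}
    {D D' : F →ₗ[K] F [⋀^Fin k]→ₗ[K] V} (h : IsFormFDeriv η x D) (h' : IsFormFDeriv θ x D') :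
    IsFormFDeriv (fun z => η z + θ z) x (D + D') := fun w => by
  obtain ⟨A, hA, hA'⟩ := h w
  obtain ⟨A₂, hA₂, hA₂'⟩ := h' w
  exact ⟨A + A₂, hA.add_tvs hA₂, fun v => by simp [hA', hA₂']⟩

variable [T2Space V]

theorem IsFormFDeriv.formFDeriv_eq {η : F → F [⋀^Fin k]→ₗ[K] V} {x : F}
    {D : F →ₗ[K] F [⋀^Fin k]→ₗ[K] V} (h : IsFormFDeriv η x D) : formFDeriv η x = D := by
  have hex : ∃ D, IsFormFDeriv η x D := ⟨D, h⟩
  rw [formFDeriv, dif_pos hex]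
  ext v w
  obtain ⟨A, hA, hA'⟩ := h w
  obtain ⟨A₂, hA₂, hA₂'⟩ := hex.choose_spec w
  rw [← hA' v, ← hA₂' v, hA.unique hA₂]

end FormLemmas

section Coefficients

variable {K : Type u} [NontriviallyNormedField K] [CompleteSpace K]
  {F : Type*} [NormedAddCommGroup F] [NormedSpace K F] [FiniteDimensional K F]
  {W : Type*} [NormedAddCommGroup W] [NormedSpace K W] {k : ℕ}

variable (K F) in
/-- The normalized alternatization of the product of the coordinate functions with indices `r`. -/
def elemForm (r : Fin k → Fin (Module.finrank K F)) : F [⋀^Fin k]→L[K] K :=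
  ((k.factorial : K)⁻¹) • ContinuousMultilinearMap.alternatization
    ((ContinuousMultilinearMap.mkPiAlgebra K (Fin k) K).compContinuousLinearMap
      fun i => LinearMap.toContinuousLinearMap ((Module.finBasis K F).coord (r i)))

variable (K F) in
def elemCLM (r : Fin k → Fin (Module.finrank K F)) : W →L[K] (F [⋀^Fin k]→L[K] W) :=
  ((ContinuousLinearMap.compContinuousAlternatingMapCLM K F K W (Fin k)).flip (elemForm K F r)) ∘L
    (ContinuousLinearMap.smulRightL K K W 1)

theorem alternating_eq_of_basis [CharZero K] {V : Type*} [AddCommGroup V] [Module K V]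
    (A : F [⋀^Fin k]→ₗ[K] V) (ι : W →ₗ[K] V) (h : (Fin k → Fin (Module.finrank K F)) → W)
    (hA : ∀ r, A (fun i => Module.finBasis K F (r i)) = ι (h r)) (w : Fin k → F) :
    A w = ι ((∑ r, elemCLM K F r (h r)) w) := by
  have key : ∀ w : Fin k → F, A w =
      ∑ r : Fin k → Fin (Module.finrank K F),
        (∏ i, (Module.finBasis K F).coord (r i) (w i)) • ι (h r) := by
    intro w
    have hw : w = fun i => ∑ j, (Module.finBasis K F).coord j (w i) • Module.finBasis K F j := by
      funext i
      exact ((Module.finBasis K F).sum_repr (w i)).symm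
    conv_lhs => rw [hw]
    have := A.toMultilinearMap.map_sum
      (fun i j => (Module.finBasis K F).coord j (w i) • Module.finBasis K F j)
    refine this.trans (Finset.sum_congr rfl fun r _ => ?_)
    rw [MultilinearMap.map_smul_univ]
    congr 1
    exact hA r
  have h1 : (k.factorial : K) • A w = ∑ σ : Equiv.Perm (Fin k), Equiv.Perm.sign σ • A (w ∘ σ) := by
    have := congrArg (fun B : F [⋀^Fin k]→ₗ[K] V => B w) (AlternatingMap.coe_alternatization A)
    simp only [MultilinearMap.alternatization_apply, Fintype.card_fin] at this
    rw [AlternatingMap.smul_apply] at this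
    rw [Nat.cast_smul_eq_nsmul, ← this]
    rfl
  have hk : (k.factorial : K) ≠ 0 := by exact_mod_cast k.factorial_ne_zero
  have h2 : A w = (k.factorial : K)⁻¹ •
      ∑ σ : Equiv.Perm (Fin k), Equiv.Perm.sign σ • A (w ∘ σ) := by
    rw [← h1, smul_smul, inv_mul_cancel₀ hk, one_smul]
  rw [h2]
  simp only [key]
  have h3 : ∀ r, (elemCLM K F r (h r)) w = (k.factorial : K)⁻¹ •
      ∑ σ : Equiv.Perm (Fin k), Equiv.Perm.sign σ •
        (∏ i, (Module.finBasis K F).coord (r i) ((w ∘ σ) i)) • h r := by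
    intro r
    simp [elemCLM, elemForm, ContinuousMultilinearMap.alternatization_apply_apply]
  simp only [ContinuousAlternatingMap.sum_apply, h3, map_sum, map_smul, Units.smul_def, map_zsmul,
    Finset.smul_sum]
  rw [Finset.sum_comm]

end Coefficients

section LocalRep

theorem ContMDiffAt.alternating_apply {K : Type u} [NontriviallyNormedField K] [CompleteSpace K]
    {F : Type*} [NormedAddCommGroup F] [NormedSpace K F] [FiniteDimensional K F]
    {W : Type*} [NormedAddCommGroup W] [NormedSpace K W] {k : ℕ}
    {E : Type*} [NormedAddCommGroup E] [NormedSpace K E] {H : Type*} [TopologicalSpace H]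
    {I : ModelWithCorners K E H} {M : Type*} [TopologicalSpace M] [ChartedSpace H M]
    {θ : M → F [⋀^Fin k]→L[K] W} {a : Fin k → M → F} {x : M}
    (hθ : ContMDiffAt I 𝓘(K, F [⋀^Fin k]→L[K] W) ω θ x)
    (ha : ∀ i, ContMDiffAt I 𝓘(K, F) ω (a i) x) :
    ContMDiffAt I 𝓘(K, W) ω (fun z => θ z fun i => a i z) x := by
  have key : (fun z => θ z fun i => a i z) = fun z =>
      ∑ r : Fin k → Fin (Module.finrank K F),
        (∏ i, LinearMap.toContinuousLinearMap ((Module.finBasis K F).coord (r i)) (a i z)) •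
          ContinuousAlternatingMap.apply K F W (fun i => Module.finBasis K F (r i)) (θ z) := by
    funext z
    have hw : (fun i => a i z) =
        fun i => ∑ j, (Module.finBasis K F).coord j (a i z) • Module.finBasis K F j := by
      funext i
      exact ((Module.finBasis K F).sum_repr (a i z)).symm
    rw [hw]
    have := (θ z).toMultilinearMap.map_sum
      (fun i j => (Module.finBasis K F).coord j (a i z) • Module.finBasis K F j)
    refine this.trans (Finset.sum_congr rfl fun r _ => ?_)
    rw [MultilinearMap.map_smul_univ]
    rfl
  rw [key]
  refine ContMDiffAt.sum fun r _ => ?_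
  have h1 : ContMDiffAt I 𝓘(K, K) ω (fun z => ∏ i,
      LinearMap.toContinuousLinearMap ((Module.finBasis K F).coord (r i)) (a i z)) x := by
    refine ContMDiffAt.prod fun i _ => ?_
    exact (ContinuousLinearMap.contMDiff _).contMDiffAt.comp x (ha i)
  refine ContMDiffAt.smul h1 ?_
  exact (ContinuousLinearMap.contMDiff _).contMDiffAt.comp x hθ

variable {K : Type u} [NontriviallyNormedField K]
  {V : Type u} [AddCommGroup V] [Module K V] [TopologicalSpace V]
  {EB : Type*} [NormedAddCommGroup EB] [NormedSpace K EB] {HB : Type*} [TopologicalSpace HB]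
  {I : ModelWithCorners K EB HB} {B : Type*} [TopologicalSpace B] [ChartedSpace HB B]
  {EB' : Type*} [NormedAddCommGroup EB'] [NormedSpace K EB'] {HB' : Type*} [TopologicalSpace HB']
  {I' : ModelWithCorners K EB' HB'} {B' : Type*} [TopologicalSpace B'] [ChartedSpace HB' B']
  {F : Type*} [NormedAddCommGroup F] [NormedSpace K F]
  {Y : Type*} [TopologicalSpace Y] [ChartedSpace F Y] {k : ℕ}

theorem chartForm_apply (η : VForm K V F Y k) (y₀ : Y) (x : F) (w : Fin k → F) :
    chartForm η y₀ x w = η ((extChartAt 𝓘(K, F) y₀).symm x)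
      (fun i => mfderiv 𝓘(K, F) 𝓘(K, F) (extChartAt 𝓘(K, F) y₀).symm x (w i)) := rfl

theorem mfderiv_extChartAt_symm_eq [IsManifold 𝓘(K, F) ω Y] {y₀ : Y} {x : F}
    (hx : x ∈ (extChartAt 𝓘(K, F) y₀).target) :
    mfderiv 𝓘(K, F) 𝓘(K, F) (extChartAt 𝓘(K, F) y₀).symm x =
      tangentCoordChange 𝓘(K, F) y₀ ((extChartAt 𝓘(K, F) y₀).symm x)
        ((extChartAt 𝓘(K, F) y₀).symm x) := by
  have h : MDifferentiableAt 𝓘(K, F) 𝓘(K, F) (extChartAt 𝓘(K, F) y₀).symm x :=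
    ((contMDiffOn_extChartAt_symm (n := ω) y₀).contMDiffAt
      ((isOpen_extChartAt_target y₀).mem_nhds hx)).mdifferentiableAt (by simp)
  have h2 : mfderiv 𝓘(K, F) 𝓘(K, F) (extChartAt 𝓘(K, F) y₀).symm x =
      (fderivWithin K (writtenInExtChartAt 𝓘(K, F) 𝓘(K, F) x (extChartAt 𝓘(K, F) y₀).symm)
        (Set.range 𝓘(K, F)) (extChartAt 𝓘(K, F) x x) : F →L[K] F) := if_pos h
  refine h2.trans ?_
  rw [tangentCoordChange_def, (extChartAt 𝓘(K, F) y₀).right_inv hx]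
  rfl

theorem mfderiv_extChartAt_symm_eq_symm [IsManifold 𝓘(K, F) ω Y] {y₀ : Y} {x : F}
    (hx : x ∈ (extChartAt 𝓘(K, F) y₀).target) (v : F) :
    mfderiv 𝓘(K, F) 𝓘(K, F) (extChartAt 𝓘(K, F) y₀).symm x v =
      (trivializationAt F (TangentSpace 𝓘(K, F)) y₀).symm ((extChartAt 𝓘(K, F) y₀).symm x) v := by
  have h := TangentBundle.symmL_trivializationAt_eq_core (I := 𝓘(K, F)) (b₀ := y₀)
    (b := (extChartAt 𝓘(K, F) y₀).symm x)
    (by simpa using (extChartAt 𝓘(K, F) y₀).map_target hx)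
  rw [mfderiv_extChartAt_symm_eq hx]
  refine (congrArg (fun A : F →L[K] F => A v) h).symm.trans ?_
  refine Bundle.Trivialization.symmL_apply _ ?_ v
  rw [TangentBundle.trivializationAt_baseSet]
  simpa using (extChartAt 𝓘(K, F) y₀).map_target hx

variable (I) in
/-- `θ` represents the relative form `η` near `(b₀, y₀)` in the preferred chart at `y₀`, through a
BH-space `W`. -/
def LocalRep (η : B → VForm K V F Y k) (b₀ : B) (y₀ : Y) (W : BHSpace K V)
    (θ : B × F → F [⋀^Fin k]→L[K] W.carrier) : Prop :=
  ContMDiffAt (I.prod 𝓘(K, F)) 𝓘(K, F [⋀^Fin k]→L[K] W.carrier) ω θ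
      (b₀, extChartAt 𝓘(K, F) y₀ y₀) ∧
    ∀ᶠ q in 𝓝 (b₀, extChartAt 𝓘(K, F) y₀ y₀),
      ∀ w, chartForm (η q.1) y₀ q.2 w = W.incl (θ q w)

theorem LocalRep.comp {η : B → VForm K V F Y k} {φ : B' → B} {b₀ : B'} {y₀ : Y} {W : BHSpace K V}
    {θ : B × F → F [⋀^Fin k]→L[K] W.carrier} (h : LocalRep I η (φ b₀) y₀ W θ)
    (hφ : ContMDiffAt I' I ω φ b₀) :
    LocalRep I' (fun b => η (φ b)) b₀ y₀ W (fun q => θ (φ q.1, q.2)) := by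
  have h2 : ContMDiffAt (I'.prod 𝓘(K, F)) (I.prod 𝓘(K, F)) ω
      (fun q : B' × F => (φ q.1, q.2)) (b₀, extChartAt 𝓘(K, F) y₀ y₀) :=
    ContMDiffAt.prodMk (hφ.comp _ contMDiffAt_fst) contMDiffAt_snd
  exact ⟨ContMDiffAt.comp _ h.1 h2, h2.continuousAt.eventually h.2⟩

theorem LocalRep.congr {η η' : B → VForm K V F Y k} {b₀ : B} {y₀ : Y} {W : BHSpace K V}
    {θ : B × F → F [⋀^Fin k]→L[K] W.carrier} (h : LocalRep I η b₀ y₀ W θ)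
    (he : ∀ᶠ b in 𝓝 b₀, η' b = η b) : LocalRep I η' b₀ y₀ W θ := by
  refine ⟨h.1, ?_⟩
  filter_upwards [h.2, he.prod_inl_nhds _] with q hq hq'
  rw [hq']
  exact hq

variable [CompleteSpace K] [FiniteDimensional K F] [IsManifold I ω B] [IsManifold 𝓘(K, F) ω Y]

theorem isAnalyticForm_of_localRep {η : B → VForm K V F Y k}
    (h : ∀ b₀ y₀, ∃ W θ, LocalRep I η b₀ y₀ W θ) : IsAnalyticForm I η := by
  rintro U hU φ hφ ⟨b₀, y₀⟩ hp
  obtain ⟨W, θ, hθ, he⟩ := h b₀ y₀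
  let e := trivializationAt F (TangentSpace 𝓘(K, F)) y₀
  have ha : ∀ i, ContMDiffAt (I.prod 𝓘(K, F)) 𝓘(K, F) ω
      (fun p : B × Y => (e (⟨p.2, φ i p⟩ : TangentBundle 𝓘(K, F) Y)).2) (b₀, y₀) := fun i =>
    (Bundle.contMDiffAt_totalSpace.1 ((hφ i).contMDiffAt (hU.mem_nhds hp))).2
  have hc : ContMDiffAt (I.prod 𝓘(K, F)) (I.prod 𝓘(K, F)) ω
      (fun p : B × Y => (p.1, extChartAt 𝓘(K, F) y₀ p.2)) (b₀, y₀) :=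
    ContMDiffAt.prodMk contMDiffAt_fst
      (ContMDiffAt.comp (b₀, y₀) (contMDiffAt_extChartAt (x := y₀)) contMDiffAt_snd)
  rw [vAnalyticAt_iff]
  refine ⟨W, _, ContMDiffAt.alternating_apply (ContMDiffAt.comp (b₀, y₀) hθ hc) ha, ?_⟩
  have hs : ∀ᶠ p : B × Y in 𝓝 (b₀, y₀), p.2 ∈ (extChartAt 𝓘(K, F) y₀).source :=
    continuousAt_snd.eventually (extChartAt_source_mem_nhds y₀)
  filter_upwards [hc.continuousAt.eventually he, hs] with p hp1 hp2
  dsimp only [Function.comp_apply]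
  rw [← hp1]
  have hx := (extChartAt 𝓘(K, F) y₀).map_source hp2
  have hl := (extChartAt 𝓘(K, F) y₀).left_inv hp2
  have hb : p.2 ∈ e.baseSet := by
    rw [TangentBundle.trivializationAt_baseSet]; simpa using hp2
  have : ∀ (y : Y) (hy : y = p.2), η p.1 p.2 (fun i => φ i p) =
      η p.1 y (fun i => e.symm y (e (⟨p.2, φ i p⟩ : TangentBundle 𝓘(K, F) Y)).2) := by
    rintro y rfl
    congr 1
    funext i
    exact (e.symm_apply_apply_mk hb (φ i p)).symm
  rw [this _ hl, chartForm_apply]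
  congr 1
  funext i
  exact (mfderiv_extChartAt_symm_eq_symm hx _).symm

variable [CharZero K] [IsTopologicalAddGroup V] [T2Space V]

theorem IsAnalyticForm.exists_localRep {η : B → VForm K V F Y k} (hη : IsAnalyticForm I η)
    (b₀ : B) (y₀ : Y) : ∃ W θ, LocalRep I η b₀ y₀ W θ := by
  let e := trivializationAt F (TangentSpace 𝓘(K, F)) y₀
  let U : Set (B × Y) := {p | p.2 ∈ e.baseSet}
  have hU : IsOpen U := e.open_baseSet.preimage continuous_snd
  have hy₀ : y₀ ∈ e.baseSet := FiberBundle.mem_baseSet_trivializationAt' y₀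
  have : IsManifold 𝓘(K, F) (ω + 1) Y := ‹IsManifold 𝓘(K, F) ω Y›
  have hsec : ∀ v : F, ContMDiffOn (I.prod 𝓘(K, F)) 𝓘(K, F).tangent ω
      (fun p : B × Y => (⟨p.2, e.symm p.2 v⟩ : TangentBundle 𝓘(K, F) Y)) U := by
    intro v
    have h1 : ContMDiffOn (I.prod 𝓘(K, F)) (𝓘(K, F).prod 𝓘(K, F)) ω
        (fun p : B × Y => (p.2, v)) U := contMDiffOn_snd.prodMk contMDiffOn_const
    refine (e.contMDiffOn_symm.comp h1 ?_).congr ?_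
    · intro p hp
      exact e.mem_target.2 hp
    · intro p hp
      exact e.mk_symm hp v
  have hr : ∀ r : Fin k → Fin (Module.finrank K F), VAnalyticAt K (I.prod 𝓘(K, F))
      (fun p : B × Y => η p.1 p.2 fun i => e.symm p.2 (Module.finBasis K F (r i))) (b₀, y₀) :=
    fun r => hη U hU (fun i p => e.symm p.2 (Module.finBasis K F (r i))) (fun i => hsec _) _ hy₀
  obtain ⟨W, h, hh, he⟩ := VAnalyticAt.common hr
  have hc : ContMDiffAt (I.prod 𝓘(K, F)) (I.prod 𝓘(K, F)) ω
      (fun q : B × F => (q.1, (extChartAt 𝓘(K, F) y₀).symm q.2))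
      (b₀, extChartAt 𝓘(K, F) y₀ y₀) :=
    ContMDiffAt.prodMk contMDiffAt_fst
      (ContMDiffAt.comp (b₀, extChartAt 𝓘(K, F) y₀ y₀)
        ((contMDiffOn_extChartAt_symm (I := 𝓘(K, F)) (n := ω) y₀).contMDiffAt
          (extChartAt_target_mem_nhds (I := 𝓘(K, F)) y₀))
        contMDiffAt_snd)
  have hpt : (b₀, (extChartAt 𝓘(K, F) y₀).symm (extChartAt 𝓘(K, F) y₀ y₀)) = (b₀, y₀) := by simp
  refine ⟨W, fun q => ∑ r, elemCLM K F r (h r (q.1, (extChartAt 𝓘(K, F) y₀).symm q.2)), ?_, ?_⟩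
  · refine ContMDiffAt.sum fun r _ => ?_
    have hr : ContMDiff 𝓘(K, W.carrier) 𝓘(K, F [⋀^Fin k]→L[K] W.carrier) ω
        (elemCLM K F r : W.carrier →L[K] (F [⋀^Fin k]→L[K] W.carrier)) :=
      ContinuousLinearMap.contMDiff (F := F [⋀^Fin k]→L[K] W.carrier) _
    refine hr.contMDiffAt.comp _ ?_
    refine ContMDiffAt.comp (b₀, extChartAt 𝓘(K, F) y₀ y₀) (g := h r) ?_ hc
    rw [hpt]
    exact hh r
  · have ht : ∀ᶠ q : B × F in 𝓝 (b₀, extChartAt 𝓘(K, F) y₀ y₀),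
        q.2 ∈ (extChartAt 𝓘(K, F) y₀).target :=
      continuousAt_snd.eventually (extChartAt_target_mem_nhds (I := 𝓘(K, F)) y₀)
    have hc' := hc.continuousAt
    rw [ContinuousAt, hpt] at hc'
    filter_upwards [hc'.eventually he, ht] with q hq hq2 w
    refine alternating_eq_of_basis (chartForm (η q.1) y₀ q.2) W.incl.toLinearMap
      (fun r => h r (q.1, (extChartAt 𝓘(K, F) y₀).symm q.2)) (fun r => ?_) w
    refine Eq.trans ?_ (hq r)
    rw [chartForm_apply]
    congr 1
    funext i
    exact mfderiv_extChartAt_symm_eq_symm hq2 _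

end LocalRep

section ExteriorDerivative

variable {K : Type u} [NontriviallyNormedField K]
  {V : Type u} [AddCommGroup V] [Module K V] [TopologicalSpace V] [IsTopologicalAddGroup V]
  [ContinuousSMul K V] [T2Space V]
  {EB : Type*} [NormedAddCommGroup EB] [NormedSpace K EB] {HB : Type*} [TopologicalSpace HB]
  {I : ModelWithCorners K EB HB} {B : Type*} [TopologicalSpace B] [ChartedSpace HB B]
  {F : Type*} [NormedAddCommGroup F] [NormedSpace K F]
  {Y : Type*} [TopologicalSpace Y] [ChartedSpace F Y] {k : ℕ}

theorem isFormFDeriv_of_rep {W : BHSpace K V} {η : F → F [⋀^Fin k]→ₗ[K] V}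
    {θ : F → F [⋀^Fin k]→L[K] W.carrier} {x : F} (hθ : DifferentiableAt K θ x)
    (he : ∀ᶠ x' in 𝓝 x, ∀ w, η x' w = W.incl (θ x' w)) :
    ∃ D, IsFormFDeriv η x D ∧ ∀ v w, D v w = W.incl (fderiv K θ x v w) := by
  let D : F →ₗ[K] F [⋀^Fin k]→ₗ[K] V :=
    { toFun := fun v => W.incl.toLinearMap.compAlternatingMap (fderiv K θ x v).toAlternatingMap
      map_add' := fun v v' => by ext w; simp
      map_smul' := fun c v => by ext w; simp }
  refine ⟨D, fun w => ⟨W.incl ∘L (ContinuousAlternatingMap.apply K F W.carrier w ∘L fderiv K θ x),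
    ?_, fun v => rfl⟩, fun v w => rfl⟩
  have h1 : HasFDerivAt (fun z => ContinuousAlternatingMap.apply K F W.carrier w (θ z))
      (ContinuousAlternatingMap.apply K F W.carrier w ∘L fderiv K θ x) x :=
    (ContinuousLinearMap.hasFDerivAt (𝕜 := K) (E := F [⋀^Fin k]→L[K] W.carrier) _).comp x
      hθ.hasFDerivAt
  refine (h1.clm_comp_tvs W.incl).congr_of_eventuallyEq ?_
  filter_upwards [he] with z hz
  exact hz w

theorem vExtDeriv_of_rep {W : BHSpace K V} {η : F → F [⋀^Fin k]→ₗ[K] V}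
    {θ : F → F [⋀^Fin k]→L[K] W.carrier} {x : F} (hθ : DifferentiableAt K θ x)
    (he : ∀ᶠ x' in 𝓝 x, ∀ w, η x' w = W.incl (θ x' w)) (v : Fin (k + 1) → F) :
    vExtDeriv η x v = W.incl (extDeriv θ x v) := by
  obtain ⟨D, hD, hD'⟩ := isFormFDeriv_of_rep hθ he
  rw [vExtDeriv, hD.formFDeriv_eq, AlternatingMap.alternatizeUncurryFin_apply, extDeriv,
    ContinuousAlternatingMap.alternatizeUncurryFin_apply, map_sum]
  simp only [hD', map_zsmul]

/-- Change of charts. -/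
theorem chartForm_change [IsManifold 𝓘(K, F) ω Y] (η : VForm K V F Y k) {y y₀ : Y} {x : F}
    (hx : x ∈ (extChartAt 𝓘(K, F) y).target)
    (hx₀ : (extChartAt 𝓘(K, F) y).symm x ∈ (extChartAt 𝓘(K, F) y₀).source) (w : Fin k → F) :
    chartForm η y x w =
      chartForm η y₀ (extChartAt 𝓘(K, F) y₀ ((extChartAt 𝓘(K, F) y).symm x))
        (fun i => fderiv K (extChartAt 𝓘(K, F) y₀ ∘ (extChartAt 𝓘(K, F) y).symm) x (w i)) := by
  rw [chartForm_apply, chartForm_apply]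
  have hx' := (extChartAt 𝓘(K, F) y₀).map_source hx₀
  have key : ∀ (z : Y) (hz : z = (extChartAt 𝓘(K, F) y).symm x),
      η ((extChartAt 𝓘(K, F) y).symm x) (fun i => tangentCoordChange 𝓘(K, F) y
        ((extChartAt 𝓘(K, F) y).symm x) ((extChartAt 𝓘(K, F) y).symm x) (w i)) =
      η z (fun i => tangentCoordChange 𝓘(K, F) y₀ z z
        (fderiv K (extChartAt 𝓘(K, F) y₀ ∘ (extChartAt 𝓘(K, F) y).symm) x (w i))) := by
    rintro z rfl
    congr 1
    funext i
    have h1 : fderiv K (extChartAt 𝓘(K, F) y₀ ∘ (extChartAt 𝓘(K, F) y).symm) x =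
        tangentCoordChange 𝓘(K, F) y y₀ ((extChartAt 𝓘(K, F) y).symm x) := by
      rw [tangentCoordChange_def, (extChartAt 𝓘(K, F) y).right_inv hx]
      simp [fderivWithin_univ]
    rw [h1]
    exact (tangentCoordChange_comp ⟨⟨(extChartAt 𝓘(K, F) y).map_target hx, hx₀⟩,
      mem_extChartAt_source _⟩).symm
  rw [mfderiv_extChartAt_symm_eq hx, mfderiv_extChartAt_symm_eq hx']
  exact key _ ((extChartAt 𝓘(K, F) y₀).left_inv hx₀)

variable [IsManifold I ω B] [IsManifold 𝓘(K, F) ω Y]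

theorem contMDiffAt_extDeriv_param {W : Type*} [NormedAddCommGroup W] [NormedSpace K W]
    {θ : B × F → F [⋀^Fin k]→L[K] W} {q₀ : B × F}
    (h : ContMDiffAt (I.prod 𝓘(K, F)) 𝓘(K, F [⋀^Fin k]→L[K] W) ω θ q₀) :
    ContMDiffAt (I.prod 𝓘(K, F)) 𝓘(K, F [⋀^Fin (k + 1)]→L[K] W) ω
      (fun q => extDeriv (fun x => θ (q.1, x)) q.2) q₀ := by
  have h1 : ContMDiffAt ((I.prod 𝓘(K, F)).prod 𝓘(K, F)) 𝓘(K, F [⋀^Fin k]→L[K] W) ω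
      (Function.uncurry fun (q : B × F) (x : F) => θ (q.1, x)) (q₀, q₀.2) := by
    refine ContMDiffAt.comp (q₀, q₀.2) (g := θ) h ?_
    exact ContMDiffAt.prodMk (contMDiffAt_fst.comp _ contMDiffAt_fst) contMDiffAt_snd
  have h2 := ContMDiffAt.mfderiv (m := ω) (fun (q : B × F) (x : F) => θ (q.1, x)) (fun q => q.2) h1
    contMDiffAt_snd (by simp)
  have h3 : ContMDiffAt (I.prod 𝓘(K, F)) 𝓘(K, F →L[K] F [⋀^Fin k]→L[K] W) ω
      (fun q : B × F => fderiv K (fun x => θ (q.1, x)) q.2) q₀ := by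
    have e := inTangentCoordinates_model_space (I := 𝓘(K, F)) (I' := 𝓘(K, F [⋀^Fin k]→L[K] W))
      (fun q : B × F => q.2) (fun q => θ (q.1, q.2))
      (fun q : B × F => fderiv K (fun x => θ (q.1, x)) q.2) q₀
    rw [← e]
    simpa only [mfderiv_eq_fderiv] using h2
  exact (ContinuousLinearMap.contMDiff
    (ContinuousAlternatingMap.alternatizeUncurryFinCLM K F W)).contMDiffAt.comp q₀ h3

theorem LocalRep.formD {η : B → VForm K V F Y k} {b₀ : B} {y₀ : Y} {W : BHSpace K V}
    {θ : B × F → F [⋀^Fin k]→L[K] W.carrier} (h : LocalRep I η b₀ y₀ W θ) :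
    LocalRep I (fun b => formD (η b)) b₀ y₀ W
      (fun q => extDeriv (fun x => θ (q.1, x)) q.2) := by
  refine ⟨contMDiffAt_extDeriv_param h.1, ?_⟩
  have ht : ∀ᶠ q : B × F in 𝓝 (b₀, extChartAt 𝓘(K, F) y₀ y₀),
      q.2 ∈ (extChartAt 𝓘(K, F) y₀).target :=
    continuousAt_snd.eventually (extChartAt_target_mem_nhds (I := 𝓘(K, F)) y₀)
  have hd := (contMDiffAt_iff_contMDiffAt_nhds (by simp)).1 h.1
  filter_upwards [h.2.eventually_nhds, ht, hd] with q hq hq2 hq3 w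
  obtain ⟨b, x⟩ := q
  dsimp only at hq2 ⊢
  have hs := (extChartAt 𝓘(K, F) y₀).map_target hq2
  set y := (extChartAt 𝓘(K, F) y₀).symm x with hy
  have hyx : extChartAt 𝓘(K, F) y₀ y = x := (extChartAt 𝓘(K, F) y₀).right_inv hq2
  have hdx : ContDiffAt K ω (fun x => θ (b, x)) x := by
    rw [← contMDiffAt_iff_contDiffAt]
    exact ContMDiffAt.comp x (g := θ) hq3 (contMDiffAt_const.prodMk contMDiffAt_id)
  set x₁ := extChartAt 𝓘(K, F) y y with hx₁
  have hyx₁ : (extChartAt 𝓘(K, F) y).symm x₁ = y := extChartAt_to_inv y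
  let ψ : F → F := extChartAt 𝓘(K, F) y₀ ∘ (extChartAt 𝓘(K, F) y).symm
  have hψx : ψ x₁ = x := by simp only [ψ, Function.comp_apply, hyx₁, hyx]
  have hψ : ContDiffAt K ω ψ x₁ := by
    have := contDiffWithinAt_ext_coord_change (I := 𝓘(K, F)) (n := ω) y₀ y (y := x₁) (by
      simp only [PartialEquiv.trans_source, PartialEquiv.symm_source, Set.mem_inter_iff,
        Set.mem_preimage, hyx₁]
      exact ⟨mem_extChartAt_target y, hs⟩)
    rw [modelWithCornersSelf_coe, Set.range_id, contDiffWithinAt_univ] at this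
    exact this
  have hψd : DifferentiableAt K (fderiv K ψ) x₁ :=
    (hψ.fderiv_right (m := ω) (by simp)).differentiableAt (by simp)
  have hθd : DifferentiableAt K (fun x' => θ (b, x')) (ψ x₁) := by
    rw [hψx]; exact hdx.differentiableAt (by simp)
  have hcomp : DifferentiableAt K (fun x' =>
      (θ (b, ψ x')).compContinuousLinearMap (fderiv K ψ x')) x₁ :=
    DifferentiableAt.continuousAlternatingMapCompContinuousLinearMap
      (DifferentiableAt.comp (g := fun x' => θ (b, x')) x₁ hθd (hψ.differentiableAt (by simp))) hψd
  have he : ∀ᶠ x' in 𝓝 x₁, ∀ w, chartForm (η b) y x' w =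
      W.incl ((θ (b, ψ x')).compContinuousLinearMap (fderiv K ψ x') w) := by
    have hq' : ∀ᶠ x' in 𝓝 x₁, ∀ w, chartForm (η b) y₀ (ψ x') w = W.incl (θ (b, ψ x') w) := by
      have hc : ContinuousAt (fun x' => (b, ψ x')) x₁ :=
        continuousAt_const.prodMk hψ.continuousAt
      have := hc.eventually (p := fun q : B × F =>
        ∀ w, chartForm (η q.1) y₀ q.2 w = W.incl (θ q w)) (by dsimp only; rw [hψx]; exact hq)
      exact this
    have ht' : ∀ᶠ x' in 𝓝 x₁, x' ∈ (extChartAt 𝓘(K, F) y).target :=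
      extChartAt_target_mem_nhds (I := 𝓘(K, F)) y
    have hs' : ∀ᶠ x' in 𝓝 x₁, (extChartAt 𝓘(K, F) y).symm x' ∈ (extChartAt 𝓘(K, F) y₀).source := by
      refine (continuousAt_extChartAt_symm y).eventually
        (p := fun z => z ∈ (extChartAt 𝓘(K, F) y₀).source) ?_
      rw [extChartAt_to_inv]
      exact (isOpen_extChartAt_source y₀).mem_nhds hs
    filter_upwards [hq', ht', hs'] with x' h1 h2 h3 w
    rw [chartForm_change (η b) h2 h3]
    exact h1 _
  have key : ∀ v, (_root_.formD (η b) y : F [⋀^Fin (k + 1)]→ₗ[K] V) v =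
      W.incl (extDeriv (fun x' => θ (b, x')) x fun i => fderiv K ψ x₁ (v i)) := by
    intro v
    refine (vExtDeriv_of_rep hcomp he v).trans ?_
    rw [extDeriv_pullback hθd hψ le_top, hψx]
    rfl
  rw [chartForm_apply]
  refine (key _).trans ?_
  congr 2
  funext i
  rw [mfderiv_extChartAt_symm_eq hq2]
  have h1 : fderiv K ψ x₁ = tangentCoordChange 𝓘(K, F) y y₀ y := by
    rw [tangentCoordChange_def]
    simp [fderivWithin_univ, ψ, hx₁]
  rw [h1]
  refine (tangentCoordChange_comp ⟨⟨hs, mem_extChartAt_source _⟩, hs⟩).trans ?_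
  exact tangentCoordChange_self hs

end ExteriorDerivative

section FormOperations

variable {K : Type u} [NontriviallyNormedField K] [CompleteSpace K] [CharZero K]
  {V : Type u} [AddCommGroup V] [Module K V] [TopologicalSpace V] [IsTopologicalAddGroup V]
  [ContinuousSMul K V] [T2Space V]
  {EB : Type*} [NormedAddCommGroup EB] [NormedSpace K EB] {HB : Type*} [TopologicalSpace HB]
  {I : ModelWithCorners K EB HB} {B : Type*} [TopologicalSpace B] [ChartedSpace HB B]
  {EB' : Type*} [NormedAddCommGroup EB'] [NormedSpace K EB'] {HB' : Type*} [TopologicalSpace HB']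
  {I' : ModelWithCorners K EB' HB'} {B' : Type*} [TopologicalSpace B'] [ChartedSpace HB' B']
  {F : Type*} [NormedAddCommGroup F] [NormedSpace K F] [FiniteDimensional K F]
  {Y : Type*} [TopologicalSpace Y] [ChartedSpace F Y] {k : ℕ}
  [IsManifold I ω B] [IsManifold I' ω B'] [IsManifold 𝓘(K, F) ω Y]

theorem isAnalyticForm_zero : IsAnalyticForm I (0 : B → VForm K V F Y k) :=
  fun _ _ _ _ _ _ => vAnalyticAt_zero

theorem IsAnalyticForm.add {η θ : B → VForm K V F Y k} (hη : IsAnalyticForm I η)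
    (hθ : IsAnalyticForm I θ) : IsAnalyticForm I (η + θ) :=
  fun U hU φ hφ p hp => (hη U hU φ hφ p hp).add (hθ U hU φ hφ p hp)

theorem IsAnalyticForm.neg {η : B → VForm K V F Y k} (hη : IsAnalyticForm I η) :
    IsAnalyticForm I (-η) := fun U hU φ hφ p hp =>
  ((hη U hU φ hφ p hp).const_smul (-1)).congr (by simp)

/-- Pullback along a map which is locally analytic at each point where it matters. -/
theorem isAnalyticForm_of_local {η : B' → VForm K V F Y k}
    (h : ∀ b : B', ∃ (φ : B' → B) (η' : B → VForm K V F Y k), IsAnalyticForm I η' ∧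
      ContMDiffAt I' I ω φ b ∧ ∀ᶠ b' in 𝓝 b, η b' = η' (φ b')) : IsAnalyticForm I' η := by
  refine isAnalyticForm_of_localRep fun b y => ?_
  obtain ⟨φ, η', hη', hφ, he⟩ := h b
  obtain ⟨W, θ, hθ⟩ := hη'.exists_localRep (φ b) y
  exact ⟨W, _, (hθ.comp hφ).congr he⟩

theorem IsAnalyticForm.comp {η : B → VForm K V F Y k} (hη : IsAnalyticForm I η) {φ : B' → B}
    (hφ : ContMDiff I' I ω φ) : IsAnalyticForm I' (fun b => η (φ b)) :=
  isAnalyticForm_of_local fun b => ⟨φ, η, hη, hφ b, by simp⟩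

theorem IsAnalyticForm.formD {η : B → VForm K V F Y k} (hη : IsAnalyticForm I η) :
    IsAnalyticForm I (fun b => formD (η b)) := isAnalyticForm_of_localRep fun b y => by
  obtain ⟨W, θ, hθ⟩ := hη.exists_localRep b y
  exact ⟨W, _, hθ.formD⟩

theorem LocalRep.slice {η : B → VForm K V F Y k} {b : B} {y : Y} {W : BHSpace K V}
    {θ : B × F → F [⋀^Fin k]→L[K] W.carrier} (h : LocalRep I η b y W θ) :
    ContDiffAt K ω (fun x => θ (b, x)) (extChartAt 𝓘(K, F) y y) ∧
      ∀ᶠ x in 𝓝 (extChartAt 𝓘(K, F) y y), ∀ w, chartForm (η b) y x w = W.incl (θ (b, x) w) := by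
  have hc : ContMDiffAt 𝓘(K, F) (I.prod 𝓘(K, F)) ω (fun x : F => (b, x))
      (extChartAt 𝓘(K, F) y y) := ContMDiffAt.prodMk contMDiffAt_const contMDiffAt_id
  exact ⟨(ContMDiffAt.comp _ h.1 hc).contDiffAt, hc.continuousAt.eventually h.2⟩

theorem IsAnalyticForm.exists_isFormFDeriv {η : B → VForm K V F Y k} (hη : IsAnalyticForm I η)
    (b : B) (y : Y) :
    ∃ D, IsFormFDeriv (chartForm (η b) y) (extChartAt 𝓘(K, F) y y) D := by
  obtain ⟨W, θ, hθ⟩ := hη.exists_localRep b y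
  obtain ⟨D, hD, -⟩ := isFormFDeriv_of_rep (hθ.slice.1.differentiableAt (by simp)) hθ.slice.2
  exact ⟨D, hD⟩

theorem IsAnalyticForm.formD_formD {η : B → VForm K V F Y k} (hη : IsAnalyticForm I η) (b : B) :
    _root_.formD (_root_.formD (η b)) = 0 := by
  funext y
  obtain ⟨W, θ, hθ⟩ := hη.exists_localRep b y
  have h2 := hθ.formD.slice
  ext v
  refine (vExtDeriv_of_rep (h2.1.differentiableAt (by simp)) h2.2 v).trans ?_
  have h3 : extDeriv (extDeriv fun x => θ (b, x)) (extChartAt 𝓘(K, F) y y) = 0 :=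
    extDeriv_extDeriv_apply (r := ω) hθ.slice.1 le_top
  have h4 : (extDeriv fun x => θ (b, x)) = fun q => extDeriv (fun x => θ (b, x)) q := rfl
  rw [h4] at h3
  dsimp only
  rw [h3]
  exact map_zero W.incl

theorem IsAnalyticForm.formD_add {η θ : B → VForm K V F Y k} (hη : IsAnalyticForm I η)
    (hθ : IsAnalyticForm I θ) (b : B) :
    _root_.formD (η b + θ b) = _root_.formD (η b) + _root_.formD (θ b) := by
  funext y
  obtain ⟨D, hD⟩ := hη.exists_isFormFDeriv b y
  obtain ⟨D', hD'⟩ := hθ.exists_isFormFDeriv b y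
  have h : IsFormFDeriv (chartForm (η b + θ b) y) (extChartAt 𝓘(K, F) y y) (D + D') := hD.add hD'
  change vExtDeriv _ _ = vExtDeriv _ _ + vExtDeriv _ _
  rw [vExtDeriv, vExtDeriv, vExtDeriv, h.formFDeriv_eq, hD.formFDeriv_eq, hD'.formFDeriv_eq,
    AlternatingMap.alternatizeUncurryFin_add]

theorem IsAnalyticForm.formD_clm {η : B → VForm K V F Y k} (hη : IsAnalyticForm I η) (A : V →L[K] V)
    (b : B) :
    _root_.formD (fun y => A.toLinearMap.compAlternatingMap (η b y)) =
      fun y => A.toLinearMap.compAlternatingMap (_root_.formD (η b) y) := by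
  funext y
  obtain ⟨D, hD⟩ := hη.exists_isFormFDeriv b y
  have h := hD.clm_comp A
  change vExtDeriv _ _ = A.toLinearMap.compAlternatingMap (vExtDeriv _ _)
  rw [vExtDeriv, vExtDeriv, hD.formFDeriv_eq]
  have h' : formFDeriv (chartForm (fun y => A.toLinearMap.compAlternatingMap (η b y)) y)
      (extChartAt 𝓘(K, F) y y) = _ := h.formFDeriv_eq
  rw [h']
  ext v
  simp [AlternatingMap.alternatizeUncurryFin_apply, map_sum, map_zsmul]

end FormOperations

/-! ### Admissible functions and admissible relative forms -/

section Admissible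

variable {K : Type u} [NontriviallyNormedField K]
  {V : Type u} [AddCommGroup V] [Module K V] [TopologicalSpace V]
  {EG : Type*} [NormedAddCommGroup EG] [NormedSpace K EG] {HG : Type*} [TopologicalSpace HG]
  (IG : ModelWithCorners K EG HG)
  {G : Type*} [Group G] [TopologicalSpace G] [ChartedSpace HG G] (ρ : G →* (V ≃L[K] V))
  {EB : Type*} [NormedAddCommGroup EB] [NormedSpace K EB] {HB : Type*} [TopologicalSpace HB]
  (I : ModelWithCorners K EB HB) {B : Type*} [TopologicalSpace B] [ChartedSpace HB B]
  {F : Type*} [NormedAddCommGroup F] [NormedSpace K F]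
  {Y : Type*} [TopologicalSpace Y] [ChartedSpace F Y] {k : ℕ}

/-- A locally analytic representation of `G` on `V`: `G` acts by continuous linear automorphisms
and the orbit maps are analytic. -/
def IsLocallyAnalyticRep : Prop :=
  ∀ v : V, VAnalytic K IG fun g : G => ρ g v

/-- A function `f : B → V` is admissible if `f` is analytic and `(g, b) ↦ g • f b` is analytic on
`G × B`. -/
def IsAdmissible (f : B → V) : Prop :=
  VAnalytic K I f ∧
    VAnalytic K (IG.prod I) fun p : G × B => ρ p.1 (f p.2)

/-- The relative form `(g, b, y) ↦ g • η (b, y)` on `(G × B) × Y / G × B`. -/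
def hatForm (η : B → VForm K V F Y k) : G × B → VForm K V F Y k := fun p y =>
  ((ρ p.1 : V →L[K] V) : V →ₗ[K] V).compAlternatingMap (η p.2 y)

/-- A relative form `η` on `B × Y / B` is admissible if it is analytic and the form
`(g, b, y) ↦ g • η (b, y)` on `(G × B) × Y / G × B` is analytic. -/
def IsAdmissibleForm [IsManifold 𝓘(K, F) ω Y] (η : B → VForm K V F Y k) : Prop :=
  IsAnalyticForm I η ∧ IsAnalyticForm (IG.prod I) (hatForm ρ η)

/-- Functions on `B × Y`, in curried form, that are locally constant along `Y`: each point
`(b, y)` has a neighbourhood `B' × Y'` on which `f` factors through the projection to `B'`. -/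
def IsLocConstAlong (f : B → Y → V) : Prop :=
  ∀ b y, ∃ N ∈ 𝓝 b, ∃ N' ∈ 𝓝 y, ∀ b' ∈ N, ∀ y₁ ∈ N', ∀ y₂ ∈ N', f b' y₁ = f b' y₂

/-- A function on `Y` as a `0`-form. -/
def zeroForm (f : Y → V) : VForm K V F Y 0 := fun y =>
  AlternatingMap.constOfIsEmpty K (TangentSpace 𝓘(K, F) y) (Fin 0) (f y)

end Admissible

section AdmissibleLemmas

variable {K : Type u} [NontriviallyNormedField K] [CompleteSpace K] [CharZero K]
  {V : Type u} [AddCommGroup V] [Module K V] [TopologicalSpace V] [IsTopologicalAddGroup V]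
  [ContinuousSMul K V] [T2Space V]
  {EG : Type*} [NormedAddCommGroup EG] [NormedSpace K EG] {HG : Type*} [TopologicalSpace HG]
  {IG : ModelWithCorners K EG HG}
  {G : Type*} [Group G] [TopologicalSpace G] [ChartedSpace HG G] [IsManifold IG ω G]
  {ρ : G →* (V ≃L[K] V)}
  {EB : Type*} [NormedAddCommGroup EB] [NormedSpace K EB] {HB : Type*} [TopologicalSpace HB]
  {I : ModelWithCorners K EB HB} {B : Type*} [TopologicalSpace B] [ChartedSpace HB B]
  {EB' : Type*} [NormedAddCommGroup EB'] [NormedSpace K EB'] {HB' : Type*} [TopologicalSpace HB']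
  {I' : ModelWithCorners K EB' HB'} {B' : Type*} [TopologicalSpace B'] [ChartedSpace HB' B']
  {F : Type*} [NormedAddCommGroup F] [NormedSpace K F] [FiniteDimensional K F]
  {Y : Type*} [TopologicalSpace Y] [ChartedSpace F Y] {k : ℕ}
  [IsManifold I ω B] [IsManifold I' ω B'] [IsManifold 𝓘(K, F) ω Y]

theorem isAdmissibleForm_zero : IsAdmissibleForm IG ρ I (0 : B → VForm K V F Y k) := by
  refine ⟨isAnalyticForm_zero, ?_⟩
  have : hatForm ρ (0 : B → VForm K V F Y k) = 0 := by
    funext p y; ext v; simp [hatForm]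
  rw [this]
  exact isAnalyticForm_zero

theorem IsAdmissibleForm.add {η θ : B → VForm K V F Y k} (hη : IsAdmissibleForm IG ρ I η)
    (hθ : IsAdmissibleForm IG ρ I θ) : IsAdmissibleForm IG ρ I (η + θ) := by
  refine ⟨hη.1.add hθ.1, ?_⟩
  have : hatForm ρ (η + θ) = hatForm ρ η + hatForm ρ θ := by
    funext p y; ext v; simp [hatForm]
  rw [this]
  exact hη.2.add hθ.2

theorem IsAdmissibleForm.neg {η : B → VForm K V F Y k} (hη : IsAdmissibleForm IG ρ I η) :
    IsAdmissibleForm IG ρ I (-η) := by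
  refine ⟨hη.1.neg, ?_⟩
  have : hatForm ρ (-η) = -hatForm ρ η := by
    funext p y; ext v; simp [hatForm]
  rw [this]
  exact hη.2.neg

theorem isAdmissibleForm_of_local {η : B' → VForm K V F Y k}
    (h : ∀ b : B', ∃ (φ : B' → B) (η' : B → VForm K V F Y k), IsAdmissibleForm IG ρ I η' ∧
      ContMDiffAt I' I ω φ b ∧ ∀ᶠ b' in 𝓝 b, η b' = η' (φ b')) : IsAdmissibleForm IG ρ I' η := by
  refine ⟨isAnalyticForm_of_local (I := I) (B := B) fun b => ?_,
    isAnalyticForm_of_local (I := IG.prod I) (B := G × B) fun p => ?_⟩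
  · obtain ⟨φ, η', hη', h⟩ := h b
    exact ⟨φ, η', hη'.1, h⟩
  · obtain ⟨φ, η', hη', hφ, he⟩ := h p.2
    refine ⟨fun q => (q.1, φ q.2), hatForm ρ η', hη'.2, ?_, ?_⟩
    · exact contMDiffAt_fst.prodMk (hφ.comp p contMDiffAt_snd)
    · filter_upwards [continuousAt_snd.eventually he] with q hq
      funext y
      change _ = ((ρ q.1 : V →L[K] V) : V →ₗ[K] V).compAlternatingMap (η' (φ q.2) y)
      rw [← hq]
      rfl

theorem IsAdmissibleForm.comp {η : B → VForm K V F Y k} (hη : IsAdmissibleForm IG ρ I η) {φ : B' → B}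
    (hφ : ContMDiff I' I ω φ) : IsAdmissibleForm IG ρ I' (fun b => η (φ b)) :=
  isAdmissibleForm_of_local fun b => ⟨φ, η, hη, hφ b, by simp⟩

theorem IsAdmissibleForm.formD {η : B → VForm K V F Y k} (hη : IsAdmissibleForm IG ρ I η) :
    IsAdmissibleForm IG ρ I (fun b => formD (η b)) := by
  refine ⟨hη.1.formD, ?_⟩
  have : hatForm ρ (fun b => _root_.formD (η b)) = fun p => _root_.formD (hatForm ρ η p) := by
    funext p
    exact (hη.1.formD_clm (ρ p.1 : V →L[K] V) p.2).symm
  rw [this]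
  exact hη.2.formD

theorem isAdmissible_zero : IsAdmissible IG ρ I (fun _ : B => (0 : V)) :=
  ⟨fun _ => vAnalyticAt_zero, fun _ => by simpa using vAnalyticAt_zero⟩

theorem IsAdmissible.add {f g : B → V} (hf : IsAdmissible IG ρ I f) (hg : IsAdmissible IG ρ I g) :
    IsAdmissible IG ρ I (fun b => f b + g b) :=
  ⟨fun b => (hf.1 b).add (hg.1 b), fun p => by simpa using (hf.2 p).add (hg.2 p)⟩

theorem IsAdmissible.neg {f : B → V} (hf : IsAdmissible IG ρ I f) :
    IsAdmissible IG ρ I (fun b => -f b) :=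
  ⟨fun b => ((hf.1 b).const_smul (-1)).congr (by simp),
    fun p => ((hf.2 p).const_smul (-1)).congr (by simp)⟩

theorem isAdmissible_of_local {f : B' → V}
    (h : ∀ b : B', ∃ (φ : B' → B) (f' : B → V), IsAdmissible IG ρ I f' ∧
      ContMDiffAt I' I ω φ b ∧ ∀ᶠ b' in 𝓝 b, f b' = f' (φ b')) : IsAdmissible IG ρ I' f := by
  refine ⟨fun b => ?_, fun p => ?_⟩
  · obtain ⟨φ, f', hf', hφ, he⟩ := h b
    exact ((hf'.1 (φ b)).comp hφ).congr he
  · obtain ⟨φ, f', hf', hφ, he⟩ := h p.2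
    have h1 : ContMDiffAt (IG.prod I') (IG.prod I) ω
        (fun q : G × B' => (q.1, φ q.2)) p := contMDiffAt_fst.prodMk (hφ.comp p contMDiffAt_snd)
    refine (VAnalyticAt.comp (φ := fun q : G × B' => (q.1, φ q.2)) (hf'.2 _) h1).congr ?_
    filter_upwards [continuousAt_snd.eventually he] with q hq
    simp only [hq]

theorem isAdmissibleForm_zeroForm {f : B → Y → V}
    (hf : IsAdmissible IG ρ (I.prod 𝓘(K, F)) fun p : B × Y => f p.1 p.2) :
    IsAdmissibleForm IG ρ I fun b => (zeroForm (f b) : VForm K V F Y 0) := by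
  refine ⟨fun U hU φ hφ p hp => hf.1 p, fun U hU φ hφ p hp => ?_⟩
  have h1 : ContMDiffAt ((IG.prod I).prod 𝓘(K, F))
      (IG.prod (I.prod 𝓘(K, F))) ω
      (fun q : (G × B) × Y => (q.1.1, (q.1.2, q.2))) p :=
    (contMDiffAt_fst.comp p contMDiffAt_fst).prodMk
      ((contMDiffAt_snd.comp p contMDiffAt_fst).prodMk contMDiffAt_snd)
  exact VAnalyticAt.comp (φ := fun q : (G × B) × Y => (q.1.1, (q.1.2, q.2))) (hf.2 _) h1

theorem formD_zeroForm {f : B → Y → V} (hf : IsLocConstAlong f) (b : B) :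
    formD (zeroForm (f b) : VForm K V F Y 0) = 0 := by
  funext y
  have hD : IsFormFDeriv (chartForm (zeroForm (f b) : VForm K V F Y 0) y)
      (extChartAt 𝓘(K, F) y y) 0 := by
    intro w
    refine ⟨0, ?_, fun v => by simp⟩
    obtain ⟨N, hN, N', hN', h⟩ := hf b y
    have hc : ContinuousAt (extChartAt 𝓘(K, F) y).symm (extChartAt 𝓘(K, F) y y) :=
      continuousAt_extChartAt_symm y
    have he : (fun x' => chartForm (zeroForm (f b) : VForm K V F Y 0) y x' w) =ᶠ[
        𝓝 (extChartAt 𝓘(K, F) y y)] fun _ => f b y := by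
      rw [ContinuousAt, extChartAt_to_inv] at hc
      filter_upwards [hc hN'] with x hx
      exact h b (mem_of_mem_nhds hN) _ hx _ (mem_of_mem_nhds hN')
    exact (hasFDerivAt_const (f b y) _).congr_of_eventuallyEq he
  change vExtDeriv _ _ = 0
  rw [vExtDeriv, hD.formFDeriv_eq]
  exact map_zero (AlternatingMap.alternatizeUncurryFinLM (R := K) (M := F) (N := V) (n := 0))

end AdmissibleLemmas

/-! ### The site of locally analytic manifolds -/

/-- Finite dimensional paracompact (Hausdorff) locally `K`-analytic manifolds. -/
structure LaMan (K : Type u) [NontriviallyNormedField K] where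
  carrier : Type u
  dim : ℕ
  [topologicalSpace : TopologicalSpace carrier]
  [chartedSpace : ChartedSpace (Fin dim → K) carrier]
  [isManifold : IsManifold 𝓘(K, Fin dim → K) ω carrier]
  [t2Space : T2Space carrier]
  [paracompactSpace : ParacompactSpace carrier]

attribute [instance] LaMan.topologicalSpace LaMan.chartedSpace LaMan.isManifold LaMan.t2Space
  LaMan.paracompactSpace

namespace LaMan

variable {K : Type u} [NontriviallyNormedField K]

/-- The model with corners of a manifold. -/
abbrev I (X : LaMan K) : ModelWithCorners K (Fin X.dim → K) (Fin X.dim → K) :=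
  𝓘(K, Fin X.dim → K)

/-- The category of manifolds and analytic maps. -/
instance : Category (LaMan K) where
  Hom X Y := ContMDiffMap X.I Y.I X.carrier Y.carrier ω
  id _ := ContMDiffMap.id
  comp f g := g.comp f

theorem contMDiff_hom {X Y : LaMan K} (f : X ⟶ Y) : ContMDiff X.I Y.I ω f.1 := f.2

/-- A paracompact open subset as a manifold. -/
abbrev restrict (X : LaMan K) (U : TopologicalSpace.Opens X.carrier) [ParacompactSpace U] :
    LaMan K where
  carrier := U
  dim := X.dim

/-- The inclusion of an open subset. -/
def incl (X : LaMan K) (U : TopologicalSpace.Opens X.carrier) [ParacompactSpace U] :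
    X.restrict U ⟶ X :=
  ⟨Subtype.val, (contMDiff_subtype_val : ContMDiff X.I X.I ω (Subtype.val : U → X.carrier))⟩

open Classical in
/-- A retraction of `X` onto an open subset `U`, analytic on `U`. -/
def retract (X : LaMan K) (U : TopologicalSpace.Opens X.carrier) (u : U) (x : X.carrier) : U :=
  if h : x ∈ U then ⟨x, h⟩ else u

theorem retract_eq (X : LaMan K) (U : TopologicalSpace.Opens X.carrier) (u : U) {x : X.carrier}
    (h : x ∈ U) : X.retract U u x = ⟨x, h⟩ := dif_pos h

theorem contMDiffAt_retract (X : LaMan K) (U : TopologicalSpace.Opens X.carrier) (u : U)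
    {x : X.carrier} (h : x ∈ U) : ContMDiffAt X.I X.I ω (X.retract U u) x := by
  have : ContMDiffAt X.I X.I ω (fun z : U => X.retract U u z) ⟨x, h⟩ := by
    have e : (fun z : U => X.retract U u z) = id := by
      funext z
      exact X.retract_eq U u z.2
    rw [e]
    exact contMDiffAt_id
  exact contMDiffAt_subtype_iff.1 this

theorem exists_lift {X Z : LaMan K} (U : TopologicalSpace.Opens X.carrier) [ParacompactSpace U]
    (f : Z ⟶ X) (h : ∀ z, f.1 z ∈ U) : ∃ g : Z ⟶ X.restrict U, g ≫ X.incl U = f := by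
  refine ⟨⟨fun z => ⟨f.1 z, h z⟩, fun z => ?_⟩, rfl⟩
  have e : (fun z => (⟨f.1 z, h z⟩ : U)) = X.retract U ⟨f.1 z, h z⟩ ∘ f.1 := by
    funext z'
    exact (X.retract_eq U _ (h z')).symm
  change ContMDiffAt Z.I X.I ω (fun z => (⟨f.1 z, h z⟩ : U)) z
  rw [e]
  exact (X.contMDiffAt_retract U _ (h z)).comp z (contMDiff_hom f z)

theorem exists_small (X : LaMan K) (x : X.carrier) {N : Set X.carrier} (hN : N ∈ 𝓝 x) :
    ∃ (U : TopologicalSpace.Opens X.carrier) (_ : ParacompactSpace U), x ∈ U ∧ (U : Set _) ⊆ N := by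
  let c := chartAt (Fin X.dim → K) x
  let U : TopologicalSpace.Opens X.carrier :=
    ⟨c.source ∩ interior N, c.open_source.inter isOpen_interior⟩
  have h1 : Topology.IsEmbedding (c.source.domRestrict c) := c.isOpenEmbedding_restrict.isEmbedding
  have h2 : Topology.IsEmbedding (Set.inclusion (Set.inter_subset_left : (U : Set _) ⊆ c.source)) :=
    Topology.IsEmbedding.inclusion _
  have h3 := h1.comp h2
  have : TopologicalSpace.MetrizableSpace U := h3.metrizableSpace
  let _ := TopologicalSpace.metrizableSpaceMetric U
  exact ⟨U, inferInstance, ⟨mem_chart_source _ x, mem_interior_iff_mem_nhds.2 hN⟩,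
    fun z hz => interior_subset hz.2⟩

variable (K) in
/-- The topology generated by open coverings: a sieve on `X` is covering if it contains the
inclusions of the members of some open covering of `X`. -/
def openTopology : GrothendieckTopology (LaMan K) where
  sieves X := {S | ∀ x : X.carrier, ∃ (U : TopologicalSpace.Opens X.carrier)
    (_ : ParacompactSpace U), x ∈ U ∧ S.arrows (X.incl U)}
  top_mem' X x := by
    obtain ⟨U, hU, hx, -⟩ := X.exists_small x Filter.univ_mem
    exact ⟨U, hU, hx, trivial⟩
  pullback_stable' X Z S f hS z := by
    obtain ⟨U, hU, hx, hSU⟩ := hS (f.1 z)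
    obtain ⟨U', hU', hz, hsub⟩ := Z.exists_small z
      ((contMDiff_hom f).continuous.continuousAt.preimage_mem_nhds (U.2.mem_nhds hx))
    refine ⟨U', hU', hz, ?_⟩
    obtain ⟨g, hg⟩ := exists_lift U (Z.incl U' ≫ f) (fun w => hsub w.2)
    change S.arrows (Z.incl U' ≫ f)
    rw [← hg]
    exact S.downward_closed hSU g
  transitive' X S hS R hR x := by
    obtain ⟨U, hU, hx, hSU⟩ := hS x
    obtain ⟨U₂, hU₂, hx₂, hRU⟩ := hR hSU ⟨x, hx⟩
    have hopen : IsOpen (Subtype.val '' (U₂ : Set U) : Set X.carrier) :=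
      U.2.isOpenEmbedding_subtypeVal.isOpenMap _ U₂.2
    obtain ⟨U₃, hU₃, hx₃, hsub⟩ := X.exists_small x (hopen.mem_nhds ⟨⟨x, hx⟩, hx₂, rfl⟩)
    refine ⟨U₃, hU₃, hx₃, ?_⟩
    obtain ⟨g, hg⟩ := exists_lift U (X.incl U₃) (fun w => by
      obtain ⟨a, -, ha⟩ := hsub w.2
      change (w : X.carrier) ∈ U
      rw [← ha]
      exact a.2)
    obtain ⟨g', hg'⟩ := exists_lift (X := X.restrict U) U₂ g (fun w => by
      obtain ⟨a, ha', ha⟩ := hsub w.2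
      have : g.1 w = a := by
        apply Subtype.ext
        rw [ha]
        exact congrArg (fun h : X.restrict U₃ ⟶ X => h.1 w) hg
      rw [this]
      exact ha')
    rw [← hg, ← hg', Category.assoc]
    exact R.downward_closed hRU g'

/-! Sheaves of abelian groups of functions `X → T` satisfying a local condition. -/

section FunSheaf

variable {T : Type u} [AddCommGroup T] (S : ∀ X : LaMan K, AddSubgroup (X.carrier → T))
  (hpull : ∀ {X Z : LaMan K} (f : Z ⟶ X) (s : X.carrier → T), s ∈ S X → s ∘ f.1 ∈ S Z)

/-- The presheaf `X ↦ S X`, with composition as restriction maps. The values are lifted to the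
universe in which the site is small. -/
def funPresheaf : (LaMan K)ᵒᵖ ⥤ AddCommGrpCat.{u + 1} where
  obj X := AddCommGrpCat.of (ULift.{u + 1} (S X.unop))
  map f := AddCommGrpCat.ofHom
    { toFun := fun s => ⟨⟨s.down.1 ∘ f.unop.1, hpull f.unop _ s.down.2⟩⟩
      map_zero' := rfl
      map_add' := fun _ _ => rfl }
  map_id _ := rfl
  map_comp _ _ := rfl

theorem funPresheaf_isSheaf
    (hloc : ∀ (X : LaMan K) (s : X.carrier → T),
      (∀ x, ∃ (U : TopologicalSpace.Opens X.carrier) (_ : ParacompactSpace U), x ∈ U ∧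
        s ∘ (X.incl U).1 ∈ S (X.restrict U)) → s ∈ S X) :
    Presheaf.IsSheaf (openTopology K) (funPresheaf S hpull) := by
  rw [Presheaf.isSheaf_iff_isSheaf_forget _ _ (forget AddCommGrpCat.{u + 1}),
    isSheaf_iff_isSheaf_of_type]
  intro X R hR x hx
  choose U hU hxU hRU using hR
  let val : ∀ ⦃Z : LaMan K⦄ (f : Z ⟶ X) (hf : R.arrows f), Z.carrier → T :=
    fun Z f hf => (x f hf : ULift.{u + 1} (S Z)).down.1
  have hval : ∀ ⦃Z Z' : LaMan K⦄ (g : Z' ⟶ Z) (f : Z ⟶ X) (hf : R.arrows f)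
      (hgf : R.arrows (g ≫ f)), val (g ≫ f) hgf = val f hf ∘ g.1 := by
    intro Z Z' g f hf hgf
    have h1 := hx (𝟙 Z') g hgf hf (by simp)
    have h2 := congrArg (fun a : ULift.{u + 1} (S Z') => a.down.1) h1
    exact h2
  have hcongr : ∀ ⦃Z : LaMan K⦄ (f f' : Z ⟶ X) (hf : R.arrows f) (hf' : R.arrows f'), f = f' →
      val f hf = val f' hf' := by
    rintro Z f _ hf hf' rfl
    rfl
  let s : X.carrier → T := fun z => val (X.incl (U z)) (hRU z) ⟨z, hxU z⟩
  have hs : ∀ ⦃Z : LaMan K⦄ (f : Z ⟶ X) (hf : R.arrows f), s ∘ f.1 = val f hf := by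
    intro Z f hf
    funext z
    obtain ⟨N, hN, hzN, hsub⟩ := Z.exists_small z
      ((contMDiff_hom f).continuous.continuousAt.preimage_mem_nhds
        ((U (f.1 z)).2.mem_nhds (hxU (f.1 z))))
    obtain ⟨g, hg⟩ := exists_lift (U (f.1 z)) (Z.incl N ≫ f) (fun w => hsub w.2)
    have h1 := hval g (X.incl (U (f.1 z))) (hRU _) (R.downward_closed (hRU _) g)
    have h2 := hval (Z.incl N) f hf (R.downward_closed hf _)
    have h3 := hcongr _ _ (R.downward_closed (hRU (f.1 z)) g)
      (R.downward_closed hf (Z.incl N)) hg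
    have h4 : g.1 ⟨z, hzN⟩ = ⟨f.1 z, hxU (f.1 z)⟩ := by
      apply Subtype.ext
      exact congrArg (fun h : Z.restrict N ⟶ X => h.1 ⟨z, hzN⟩) hg
    have h5 := congrFun (h1.symm.trans (h3.trans h2)) ⟨z, hzN⟩
    simp only [Function.comp_apply, h4] at h5
    exact h5
  have hsS : s ∈ S X := by
    refine hloc X s fun z => ⟨U z, hU z, hxU z, ?_⟩
    rw [hs (X.incl (U z)) (hRU z)]
    exact (x (X.incl (U z)) (hRU z) : ULift.{u + 1} (S (X.restrict (U z)))).down.2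
  refine ⟨(⟨⟨s, hsS⟩⟩ : ULift.{u + 1} (S X)), ?_, ?_⟩
  · intro Z f hf
    apply ULift.ext
    apply Subtype.ext
    exact hs f hf
  · intro t ht
    apply ULift.ext
    apply Subtype.ext
    funext z
    have := congrArg (fun a : ULift.{u + 1} (S (X.restrict (U z))) => a.down.1 ⟨z, hxU z⟩)
      (ht (X.incl (U z)) (hRU z))
    exact this

/-- The sheaf `X ↦ S X`. -/
def funSheaf
    (hloc : ∀ (X : LaMan K) (s : X.carrier → T),
      (∀ x, ∃ (U : TopologicalSpace.Opens X.carrier) (_ : ParacompactSpace U), x ∈ U ∧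
        s ∘ (X.incl U).1 ∈ S (X.restrict U)) → s ∈ S X) :
    Sheaf (openTopology K) AddCommGrpCat.{u + 1} :=
  ⟨funPresheaf S hpull, funPresheaf_isSheaf S hpull hloc⟩

end FunSheaf

end LaMan

/-! ### The relative de Rham complex -/

section DeRham

variable {K : Type u} [NontriviallyNormedField K] [CompleteSpace K] [CharZero K]
  {V : Type u} [AddCommGroup V] [Module K V] [TopologicalSpace V] [IsTopologicalAddGroup V]
  [ContinuousSMul K V] [T2Space V]
  {EG : Type*} [NormedAddCommGroup EG] [NormedSpace K EG] {HG : Type*} [TopologicalSpace HG]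
  (IG : ModelWithCorners K EG HG)
  {G : Type*} [Group G] [TopologicalSpace G] [ChartedSpace HG G] [IsManifold IG ω G]
  (ρ : G →* (V ≃L[K] V)) (Y : LaMan K)

/-- The group `Ω^k_ad(X × Y / X, V)` of admissible relative forms. -/
def admissibleForms (k : ℕ) (X : LaMan K) :
    AddSubgroup (X.carrier → VForm K V (Fin Y.dim → K) Y.carrier k) where
  carrier := {η | IsAdmissibleForm IG ρ X.I η}
  zero_mem' := isAdmissibleForm_zero
  add_mem' := fun h h' => h.add h'
  neg_mem' := fun h => h.neg

/-- The group of admissible functions on `X × Y` that are locally constant along `Y`. -/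
def admissibleLocConst (X : LaMan K) : AddSubgroup (X.carrier → Y.carrier → V) where
  carrier := {f | IsAdmissible IG ρ (X.I.prod Y.I) (fun p : X.carrier × Y.carrier => f p.1 p.2) ∧
    IsLocConstAlong f}
  zero_mem' := ⟨isAdmissible_zero, fun _ _ => ⟨Set.univ, Filter.univ_mem, Set.univ,
    Filter.univ_mem, fun _ _ _ _ _ _ => rfl⟩⟩
  add_mem' := by
    rintro f f' ⟨hf, hf2⟩ ⟨hf', hf2'⟩
    refine ⟨hf.add hf', fun b y => ?_⟩
    obtain ⟨N, hN, N', hN', h⟩ := hf2 b y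
    obtain ⟨M, hM, M', hM', h'⟩ := hf2' b y
    refine ⟨N ∩ M, Filter.inter_mem hN hM, N' ∩ M', Filter.inter_mem hN' hM',
      fun b' hb y₁ h₁ y₂ h₂ => ?_⟩
    simp only [Pi.add_apply]
    rw [h b' hb.1 y₁ h₁.1 y₂ h₂.1, h' b' hb.2 y₁ h₁.2 y₂ h₂.2]
  neg_mem' := by
    rintro f ⟨hf, hf2⟩
    refine ⟨hf.neg, fun b y => ?_⟩
    obtain ⟨N, hN, N', hN', h⟩ := hf2 b y
    refine ⟨N, hN, N', hN', fun b' hb y₁ h₁ y₂ h₂ => ?_⟩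
    simp only [Pi.neg_apply]
    rw [h b' hb y₁ h₁ y₂ h₂]

theorem admissibleForms_pull {k : ℕ} {X Z : LaMan K} (f : Z ⟶ X)
    (s : X.carrier → VForm K V (Fin Y.dim → K) Y.carrier k)
    (hs : s ∈ admissibleForms IG ρ Y k X) : s ∘ f.1 ∈ admissibleForms IG ρ Y k Z :=
  IsAdmissibleForm.comp hs (LaMan.contMDiff_hom f)

theorem LaMan.exists_local {T : Type u} {X : LaMan K} {s : X.carrier → T}
    {P : ∀ Z : LaMan K, (Z.carrier → T) → Prop} {x : X.carrier}
    (h : ∃ (U : TopologicalSpace.Opens X.carrier) (_ : ParacompactSpace U), x ∈ U ∧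
      P (X.restrict U) (s ∘ (X.incl U).1)) :
    ∃ (Z : LaMan K) (φ : X.carrier → Z.carrier) (t : Z.carrier → T), P Z t ∧
      ContMDiffAt X.I Z.I ω φ x ∧ ∀ᶠ z in 𝓝 x, s z = t (φ z) := by
  obtain ⟨U, hU, hx, hs⟩ := h
  refine ⟨X.restrict U, X.retract U ⟨x, hx⟩, _, hs, X.contMDiffAt_retract U ⟨x, hx⟩ hx, ?_⟩
  filter_upwards [U.2.mem_nhds hx] with z hz
  change s z = s (X.retract U ⟨x, hx⟩ z)
  rw [X.retract_eq U _ hz]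

theorem admissibleForms_local {k : ℕ} (X : LaMan K)
    (s : X.carrier → VForm K V (Fin Y.dim → K) Y.carrier k)
    (h : ∀ x, ∃ (U : TopologicalSpace.Opens X.carrier) (_ : ParacompactSpace U), x ∈ U ∧
      s ∘ (X.incl U).1 ∈ admissibleForms IG ρ Y k (X.restrict U)) :
    s ∈ admissibleForms IG ρ Y k X := by
  have h' := fun x => LaMan.exists_local (P := fun Z t => t ∈ admissibleForms IG ρ Y k Z) (h x)
  refine ⟨isAnalyticForm_of_localRep fun x y => ?_, isAnalyticForm_of_localRep fun p y => ?_⟩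
  · obtain ⟨Z, φ, t, ht, hφ, he⟩ := h' x
    obtain ⟨W, θ, hθ⟩ := ht.1.exists_localRep (φ x) y
    exact ⟨W, _, (hθ.comp hφ).congr he⟩
  · obtain ⟨Z, φ, t, ht, hφ, he⟩ := h' p.2
    have hψ : ContMDiffAt (IG.prod X.I) (IG.prod Z.I) ω
        (fun q : G × X.carrier => (q.1, φ q.2)) p :=
      contMDiffAt_fst.prodMk (hφ.comp p contMDiffAt_snd)
    obtain ⟨W, θ, hθ⟩ := ht.2.exists_localRep (p.1, φ p.2) y
    refine ⟨W, _, (hθ.comp (φ := fun q : G × X.carrier => (q.1, φ q.2)) hψ).congr ?_⟩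
    filter_upwards [continuousAt_snd.eventually he] with q hq
    funext y
    change _ = ((ρ q.1 : V →L[K] V) : V →ₗ[K] V).compAlternatingMap (t (φ q.2) y)
    rw [← hq]
    rfl

theorem admissibleLocConst_pull {X Z : LaMan K} (f : Z ⟶ X) (s : X.carrier → Y.carrier → V)
    (hs : s ∈ admissibleLocConst IG ρ Y X) : s ∘ f.1 ∈ admissibleLocConst IG ρ Y Z := by
  refine ⟨isAdmissible_of_local fun p => ⟨fun q => (f.1 q.1, q.2), _, hs.1, ?_, by simp⟩,
    fun z y => ?_⟩
  · exact (ContMDiffAt.comp p (LaMan.contMDiff_hom f p.1) contMDiffAt_fst).prodMk contMDiffAt_snd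
  · obtain ⟨N, hN, N', hN', h⟩ := hs.2 (f.1 z) y
    exact ⟨f.1 ⁻¹' N, (LaMan.contMDiff_hom f).continuous.continuousAt.preimage_mem_nhds hN, N', hN',
      fun b hb => h _ hb⟩

theorem admissibleLocConst_local (X : LaMan K) (s : X.carrier → Y.carrier → V)
    (h : ∀ x, ∃ (U : TopologicalSpace.Opens X.carrier) (_ : ParacompactSpace U), x ∈ U ∧
      s ∘ (X.incl U).1 ∈ admissibleLocConst IG ρ Y (X.restrict U)) :
    s ∈ admissibleLocConst IG ρ Y X := by
  have h' := fun x => LaMan.exists_local (P := fun Z t => t ∈ admissibleLocConst IG ρ Y Z) (h x)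
  refine ⟨⟨fun p => ?_, fun p => ?_⟩, fun x y => ?_⟩
  · obtain ⟨Z, φ, t, ht, hφ, he⟩ := h' p.1
    have hψ : ContMDiffAt (X.I.prod Y.I) (Z.I.prod Y.I) ω
        (fun q : X.carrier × Y.carrier => (φ q.1, q.2)) p :=
      (ContMDiffAt.comp p hφ contMDiffAt_fst).prodMk contMDiffAt_snd
    refine (VAnalyticAt.comp (φ := fun q : X.carrier × Y.carrier => (φ q.1, q.2))
      (ht.1.1 _) hψ).congr ?_
    filter_upwards [continuousAt_fst.eventually he] with q hq
    simp only [hq]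
  · obtain ⟨Z, φ, t, ht, hφ, he⟩ := h' p.2.1
    have hψ : ContMDiffAt (IG.prod (X.I.prod Y.I)) (IG.prod (Z.I.prod Y.I)) ω
        (fun q : G × (X.carrier × Y.carrier) => (q.1, (φ q.2.1, q.2.2))) p :=
      contMDiffAt_fst.prodMk ((ContMDiffAt.comp p hφ
        (contMDiffAt_fst.comp p contMDiffAt_snd)).prodMk (contMDiffAt_snd.comp p contMDiffAt_snd))
    refine (VAnalyticAt.comp (φ := fun q : G × (X.carrier × Y.carrier) =>
      (q.1, (φ q.2.1, q.2.2))) (ht.1.2 _) hψ).congr ?_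
    have hc : ContinuousAt (fun q : G × (X.carrier × Y.carrier) => q.2.1) p :=
      (continuous_fst.comp continuous_snd).continuousAt
    filter_upwards [hc.eventually he] with q hq
    simp only [hq]
  · obtain ⟨Z, φ, t, ht, hφ, he⟩ := h' x
    obtain ⟨N, hN, N', hN', hc⟩ := ht.2 (φ x) y
    refine ⟨_, Filter.inter_mem he (hφ.continuousAt.preimage_mem_nhds hN), N', hN',
      fun b hb y₁ h₁ y₂ h₂ => ?_⟩
    have hb1 : s b = t (φ b) := hb.1
    rw [hb1]
    exact hc _ hb.2 y₁ h₁ y₂ h₂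

/-- The sheaf `X ↦ Ω^k_ad(X × Y / X, V)` of admissible relative forms. -/
def formSheaf (k : ℕ) : Sheaf (LaMan.openTopology K) AddCommGrpCat.{u + 1} :=
  LaMan.funSheaf (admissibleForms IG ρ Y k) (admissibleForms_pull IG ρ Y)
    (admissibleForms_local IG ρ Y)

/-- The sheaf sending `X` to the group of admissible functions on `X × Y` that are locally constant
along `Y`. -/
def locConstSheaf : Sheaf (LaMan.openTopology K) AddCommGrpCat.{u + 1} :=
  LaMan.funSheaf (admissibleLocConst IG ρ Y) (admissibleLocConst_pull IG ρ Y)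
    (admissibleLocConst_local IG ρ Y)

/-- The exterior derivative along `Y` as a morphism of sheaves. -/
def formSheafD (k : ℕ) : formSheaf IG ρ Y k ⟶ formSheaf IG ρ Y (k + 1) where
  hom :=
    { app := fun X => AddCommGrpCat.ofHom
        (X := ULift.{u + 1} (admissibleForms IG ρ Y k X.unop))
        (Y := ULift.{u + 1} (admissibleForms IG ρ Y (k + 1) X.unop)) <|
        AddMonoidHom.mk' (fun s => ⟨⟨fun x => formD (s.down.1 x), IsAdmissibleForm.formD s.down.2⟩⟩)
          fun s t => ULift.ext _ _ <| Subtype.ext <| funext fun x =>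
            s.down.2.1.formD_add t.down.2.1 x
      naturality := fun _ _ _ => rfl }

theorem formSheafD_comp (k : ℕ) : formSheafD IG ρ Y k ≫ formSheafD IG ρ Y (k + 1) = 0 := by
  apply Sheaf.hom_ext
  apply NatTrans.ext
  funext X
  apply AddCommGrpCat.hom_ext
  refine AddMonoidHom.ext
    fun (s : ULift.{u + 1} (admissibleForms IG ρ Y k X.unop)) => ?_
  exact ULift.ext _ _ <| Subtype.ext <| funext fun x => s.down.2.1.formD_formD x

/-- The relative de Rham complex `Ω^*_ad(Y, V)` of admissible forms, a complex of abelian sheaves on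
the site of manifolds. -/
def deRhamComplex : CochainComplex (Sheaf (LaMan.openTopology K) AddCommGrpCat.{u + 1}) ℕ :=
  CochainComplex.of (formSheaf IG ρ Y) (formSheafD IG ρ Y) (formSheafD_comp IG ρ Y)

/-- The inclusion of the functions locally constant along `Y` into the `0`-forms. -/
def locConstInclusion : locConstSheaf IG ρ Y ⟶ formSheaf IG ρ Y 0 where
  hom :=
    { app := fun X => AddCommGrpCat.ofHom
        (X := ULift.{u + 1} (admissibleLocConst IG ρ Y X.unop))
        (Y := ULift.{u + 1} (admissibleForms IG ρ Y 0 X.unop)) <|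
        AddMonoidHom.mk'
          (fun s => ⟨⟨fun x => zeroForm (s.down.1 x), isAdmissibleForm_zeroForm s.down.2.1⟩⟩)
          fun _ _ => rfl
      naturality := fun _ _ _ => rfl }

theorem locConstInclusion_comp : locConstInclusion IG ρ Y ≫ formSheafD IG ρ Y 0 = 0 := by
  apply Sheaf.hom_ext
  apply NatTrans.ext
  funext X
  apply AddCommGrpCat.hom_ext
  refine AddMonoidHom.ext
    fun (s : ULift.{u + 1} (admissibleLocConst IG ρ Y X.unop)) => ?_
  exact ULift.ext _ _ <| Subtype.ext <| funext fun x => formD_zeroForm s.down.2.2 x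

/-- The inclusion of the sheaf of functions locally constant along `Y`, as a complex concentrated
in degree `0`, into the relative de Rham complex. -/
def deRhamInclusion :
    (CochainComplex.single₀ _).obj (locConstSheaf IG ρ Y) ⟶ deRhamComplex IG ρ Y :=
  (CochainComplex.fromSingle₀Equiv _ _).symm ⟨locConstInclusion IG ρ Y, by
    have h : (deRhamComplex IG ρ Y).d 0 1 = formSheafD IG ρ Y 0 :=
      CochainComplex.of_d (formSheaf IG ρ Y) (formSheafD IG ρ Y) 0
    rw [h]
    exact locConstInclusion_comp IG ρ Y⟩

end DeRham

end

/-!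
A complex of sheaves on the site is exact as soon as it is exact on sections, and it is: `X × Y`
is strongly zero-dimensional, so primitives which exist locally on `X × Y` can be chosen along a
partition into open sets, and no compatibility between them is needed.

Locally a closed relative form `θ` of degree `k + 1` has the primitive `ι_R f`, where `R` is the
radial vector field along `Y` and `f` solves the Euler equation `D_R f + (k + 1) f = θ`. The
solution divides the part of the power series of `θ` that is homogeneous of degree `m` along `Y`
by `m + k + 1`, which leaves the radius of convergence positive because `‖1 / n‖` grows at most
exponentially in `n`. Then `d f` satisfies a homogeneous Euler equation, hence vanishes, and
Cartan's formula gives `d (ι_R f) = θ`.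

For admissibility, solve the equation for the form `(g, x, y) ↦ g ω_{(x, y)}` near `g = 1`.
Solutions of the Euler equation are unique on a ball that does not depend on the parameter, so
`g f_{(1, x, y)} = f_{(g, x, y)}` for `g` near `1`: the primitive of `ω` is admissible there, and
translation by the group carries this to every `g`.
-/

noncomputable section

/-! ### The Euler equation -/

section NormNatCast

variable (K : Type*) [NontriviallyNormedField K] [IsUltrametricDist K]

theorem exists_norm_natCast_lt_one_iff_dvd :
    ∃ p : ℕ, p ≠ 1 ∧ ∀ n : ℕ, ‖(n : K)‖ < 1 ↔ p ∣ n := by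
  let I : Ideal ℤ :=
    { carrier := {z | ‖(z : K)‖ < 1}
      add_mem' := fun {x y} hx hy => by
        simpa using (IsUltrametricDist.norm_add_le_max (x : K) y).trans_lt (max_lt hx hy)
      zero_mem' := by simp
      smul_mem' := fun x y hy => by
        simpa using mul_lt_one_of_nonneg_of_lt_one_right
          (IsUltrametricDist.norm_intCast_le_one K x) (norm_nonneg _) hy }
  obtain ⟨z, hz⟩ := (IsPrincipalIdealRing.principal I).principal
  have hdvd (n : ℕ) : ‖(n : K)‖ < 1 ↔ z.natAbs ∣ n := by
    have hmem : (n : ℤ) ∈ I ↔ z ∣ n := by rw [hz]; exact Ideal.mem_span_singleton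
    rw [← Int.dvd_natCast, ← hmem]
    simp [I]
  refine ⟨z.natAbs, fun h => ?_, hdvd⟩
  simpa [h] using hdvd 1

theorem exists_norm_inv_natCast_le_pow :
    ∃ a : ℝ, 1 ≤ a ∧ ∀ n : ℕ, n ≠ 0 → ‖(n : K)⁻¹‖ ≤ a ^ n := by
  obtain ⟨p, hp1, hp⟩ := exists_norm_natCast_lt_one_iff_dvd K
  refine ⟨max 1 ‖(p : K)⁻¹‖, le_max_left _ _, fun n => ?_⟩
  induction n using Nat.strong_induction_on with
  | _ n ih =>
    intro hn
    by_cases hdvd : p ∣ n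
    · obtain ⟨m, rfl⟩ := hdvd
      obtain ⟨hp0, hm0⟩ := mul_ne_zero_iff.1 hn
      have hlt : m < p * m := lt_mul_of_one_lt_left (by omega) (by omega)
      rw [Nat.cast_mul, mul_inv, norm_mul]
      calc ‖(p : K)⁻¹‖ * ‖(m : K)⁻¹‖
          ≤ max 1 ‖(p : K)⁻¹‖ * max 1 ‖(p : K)⁻¹‖ ^ m := by
            gcongr
            exacts [le_max_right _ _, ih m hlt hm0]
        _ = max 1 ‖(p : K)⁻¹‖ ^ (m + 1) := (pow_succ' _ _).symm
        _ ≤ max 1 ‖(p : K)⁻¹‖ ^ (p * m) := pow_le_pow_right₀ (le_max_left _ _) hlt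
    · rw [norm_inv]
      exact (inv_le_one_of_one_le₀ (not_lt.1 (mt (hp n).1 hdvd))).trans
        (one_le_pow₀ (le_max_left _ _))

end NormNatCast

section Euler

variable {K : Type*} [NontriviallyNormedField K]
  {E : Type*} [NormedAddCommGroup E] [NormedSpace K E]
  {W : Type*} [NormedAddCommGroup W] [NormedSpace K W]

theorem derivSeries_apply_eq_linearDeriv (p : FormalMultilinearSeries K E W) (n : ℕ) (x v : E) :
    p.derivSeries n (fun _ => x) v = (p (n + 1)).linearDeriv (fun _ => x) fun _ => v := by
  have sum_piecewise : ∀ m, 1 + n = m →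
      ∑ s : {s : Finset (Fin (1 + n)) // s.card = n},
        p (1 + n) ((s : Finset _).piecewise (fun _ => x) fun _ => v) =
      ∑ i : Fin m, p m (Function.update (fun _ => x) i v) := by
    rintro m rfl
    refine (Fintype.sum_bijective
      (fun i : Fin (1 + n) => (⟨{i}ᶜ, by simp [Finset.card_compl]⟩ :
        {s : Finset (Fin (1 + n)) // s.card = n})) ⟨fun i j h => ?_, ?_⟩ _ _ fun i => ?_).symm
    · simpa using h
    · rintro ⟨s, hs⟩
      obtain ⟨a, ha⟩ : ∃ a, sᶜ = {a} := Finset.card_eq_one.1 (by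
        rw [Finset.card_compl, hs, Fintype.card_fin, Nat.add_sub_cancel])
      exact ⟨a, Subtype.ext (compl_eq_comm.mp ha)⟩
    · rw [Finset.piecewise_compl, Finset.piecewise_singleton]
  rw [ContinuousMultilinearMap.linearDeriv_apply, ← sum_piecewise (n + 1) (add_comm 1 n)]
  simp only [FormalMultilinearSeries.derivSeries,
    ContinuousLinearMap.compFormalMultilinearSeries_apply,
    FormalMultilinearSeries.changeOriginSeries,
    ContinuousLinearMap.compContinuousMultilinearMap_coe, Function.comp_apply, sum_apply, map_sum]
  refine Finset.sum_congr rfl fun s _ => ?_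
  rw [← p.changeOriginSeriesTerm_apply 1 n s s.2]
  exact continuousMultilinearCurryFin1_apply (p.changeOriginSeriesTerm 1 n s s.2 fun _ => x) v

theorem hasSum_fderiv_apply [CompleteSpace W] {f : E → W} {p : FormalMultilinearSeries K E W}
    {x₀ : E} {r : ENNReal} (hf : HasFPowerSeriesOnBall f p x₀ r) {x : E}
    (hx : x ∈ Metric.eball x₀ r) (v : E) :
    HasSum (fun n => (p n).linearDeriv (fun _ => x - x₀) fun _ => v) (fderiv K f x v) := by
  have h := (ContinuousLinearMap.apply K W v).hasSum (hf.fderiv.hasSum_sub hx)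
  simp only [ContinuousLinearMap.apply_apply, derivSeries_apply_eq_linearDeriv] at h
  refine (hasSum_nat_add_iff' 1).1 ?_
  simpa [ContinuousMultilinearMap.linearDeriv_apply] using h

/-- The Euler operator `f ↦ c f + D_R f`, where `D_R` is the derivative along the radial vector
field `R x = π (x - x₀)` of the image of a projection `π`. -/
def eulerOp (π : E →L[K] E) (c : ℕ) (x₀ : E) (f : E → W) (x : E) : W :=
  (c : K) • f x + fderiv K f x (π (x - x₀))

theorem sum_compContinuousLinearMap_piecewise {n : ℕ} (f : E [×n]→L[K] W) (π : E →L[K] E) :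
    ∑ S : Finset (Fin n),
      f.compContinuousLinearMap (S.piecewise (fun _ => π) fun _ => 1 - π) = f := by
  ext m
  have hm : m = (fun i => π (m i)) + fun i => (1 - π) (m i) := by
    funext; simp
  conv_rhs => rw [hm, f.map_add_univ]
  rw [sum_apply]
  refine Finset.sum_congr rfl fun S _ => congrArg f (funext fun i => ?_)
  by_cases hi : i ∈ S <;> simp [hi]

theorem linearDeriv_compContinuousLinearMap_piecewise {n : ℕ} (f : E [×n]→L[K] W)
    {π : E →L[K] E} (hπ : IsIdempotentElem π) (S : Finset (Fin n)) (x : E) :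
    (f.compContinuousLinearMap (S.piecewise (fun _ => π) fun _ => 1 - π)).linearDeriv
      (fun _ => x) (fun _ => π x) =
    S.card • f.compContinuousLinearMap (S.piecewise (fun _ => π) fun _ => 1 - π) fun _ => x := by
  have hππ : π (π x) = π x := DFunLike.congr_fun hπ x
  have apply_update (i : Fin n) :
      f (fun j => S.piecewise (fun _ => π) (fun _ => 1 - π) j
        (Function.update (fun _ => x) i (π x) j)) =
      if i ∈ S then f fun j => S.piecewise (fun _ => π) (fun _ => 1 - π) j x else 0 := by
    split_ifs with hi
    · refine congrArg f (funext fun j => ?_)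
      obtain rfl | hj := eq_or_ne j i
      · simp [hi, hππ]
      · simp [hj]
    · exact f.map_coord_zero i (by simp [hi, hππ])
  simp only [ContinuousMultilinearMap.linearDeriv_apply,
    ContinuousMultilinearMap.compContinuousLinearMap_apply, apply_update]
  rw [Finset.sum_ite_mem, Finset.univ_inter, Finset.sum_const]

/-- The formal solution `q` of the Euler equation `eulerOp π c x₀ q = p`: the part of `p` which is
homogeneous of degree `m` on the image of the projection `π` is divided by `m + c`. The sum is over
the set `S` of the slots which receive the component in the image of `π`. -/
def eulerSeries (π : E →L[K] E) (c : ℕ) (p : FormalMultilinearSeries K E W) :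
    FormalMultilinearSeries K E W := fun n =>
  ∑ S : Finset (Fin n), ((S.card + c : ℕ) : K)⁻¹ •
    (p n).compContinuousLinearMap (S.piecewise (fun _ => π) fun _ => 1 - π)

theorem eulerSeries_apply_add_linearDeriv [CharZero K] {π : E →L[K] E} (hπ : IsIdempotentElem π)
    {c : ℕ} (hc : c ≠ 0) (p : FormalMultilinearSeries K E W) (n : ℕ) (x : E) :
    (c : K) • eulerSeries π c p n (fun _ => x) +
      (eulerSeries π c p n).linearDeriv (fun _ => x) (fun _ => π x) = p n fun _ => x := by
  let part (S : Finset (Fin n)) : E [×n]→L[K] W :=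
    (p n).compContinuousLinearMap (S.piecewise (fun _ => π) fun _ => 1 - π)
  have inv_smul_add (S : Finset (Fin n)) :
      (c : K) • ((S.card + c : ℕ) : K)⁻¹ • part S (fun _ => x) +
        ((S.card + c : ℕ) : K)⁻¹ • S.card • part S (fun _ => x) = part S fun _ => x := by
    have : ((S.card + c : ℕ) : K) ≠ 0 := Nat.cast_ne_zero.2 (by omega)
    rw [smul_comm, ← smul_add, ← Nat.cast_smul_eq_nsmul K, ← add_smul, ← Nat.cast_add, add_comm c,
      inv_smul_smul₀ this]
  have linearDeriv_part (S : Finset (Fin n)) :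
      ∑ i, part S (Function.update (fun _ => x) i (π x)) = S.card • part S fun _ => x := by
    rw [← linearDeriv_compContinuousLinearMap_piecewise (p n) hπ,
      ContinuousMultilinearMap.linearDeriv_apply]
  conv_rhs => rw [← sum_compContinuousLinearMap_piecewise (p n) π]
  simp only [eulerSeries, ContinuousMultilinearMap.linearDeriv_apply, sum_apply, smul_apply]
  rw [Finset.sum_comm, Finset.smul_sum, ← Finset.sum_add_distrib]
  refine Finset.sum_congr rfl fun S _ => ?_
  rw [← Finset.smul_sum, linearDeriv_part, inv_smul_add]

theorem exists_norm_eulerSeries_le [IsUltrametricDist K] [CharZero K] (π : E →L[K] E) {c : ℕ}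
    (hc : c ≠ 0) {p : FormalMultilinearSeries K E W} (hp : 0 < p.radius) :
    ∃ C r : ℝ, 0 < r ∧ ∀ n, ‖eulerSeries π c p n‖ ≤ C * r ^ n := by
  obtain ⟨a, ha, hinv⟩ := exists_norm_inv_natCast_le_pow K
  obtain ⟨C, r, hC, hr, hCr⟩ := p.le_mul_pow_of_radius_pos hp
  let M := max 1 (max ‖π‖ ‖1 - π‖)
  refine ⟨C * a ^ c, 2 * (a * (r * M)), by positivity, fun n => ?_⟩
  have norm_term (S : Finset (Fin n)) : ‖((S.card + c : ℕ) : K)⁻¹ •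
      (p n).compContinuousLinearMap (S.piecewise (fun _ => π) fun _ => 1 - π)‖ ≤
      a ^ (n + c) * (C * r ^ n * M ^ n) := by
    have norm_proj (i : Fin n) : ‖S.piecewise (fun _ => π) (fun _ => 1 - π) i‖ ≤ M := by
      by_cases hi : i ∈ S <;> simp [hi, M]
    have prod_norm : ∏ i, ‖S.piecewise (fun _ => π) (fun _ => 1 - π) i‖ ≤ M ^ n := by
      simpa using
        Finset.prod_le_prod (s := Finset.univ) (fun i _ => norm_nonneg _) fun i _ => norm_proj i
    have card_le : S.card ≤ n := by simpa using S.card_le_univ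
    rw [norm_smul]
    gcongr
    · exact (hinv _ (by omega)).trans (pow_le_pow_right₀ ha (by omega))
    · exact (ContinuousMultilinearMap.norm_compContinuousLinearMap_le _ _).trans
        (mul_le_mul (hCr n) prod_norm (by positivity) (by positivity))
  refine (norm_sum_le_of_le _ fun S _ => norm_term S).trans_eq ?_
  rw [Finset.sum_const, Finset.card_univ, Fintype.card_finset, Fintype.card_fin, nsmul_eq_mul]
  push_cast
  ring

theorem eulerSeries_radius_pos [IsUltrametricDist K] [CharZero K] (π : E →L[K] E) {c : ℕ}
    (hc : c ≠ 0) {p : FormalMultilinearSeries K E W} (hp : 0 < p.radius) :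
    0 < (eulerSeries π c p).radius := by
  obtain ⟨C, r, hr, hCr⟩ := exists_norm_eulerSeries_le π hc hp
  lift r to NNReal using hr.le
  have hr : 0 < r := hr
  refine (ENNReal.coe_pos.2 (inv_pos.2 hr)).trans_le
    (FormalMultilinearSeries.le_radius_of_bound _ C fun n => ?_)
  calc ‖eulerSeries π c p n‖ * (r⁻¹ : NNReal) ^ n ≤ C * r ^ n * (r⁻¹ : NNReal) ^ n := by
        gcongr
        exact hCr n
    _ = C := by
        rw [mul_assoc, ← mul_pow, ← NNReal.coe_mul, mul_inv_cancel₀ hr.ne']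
        simp

theorem exists_eventually_eulerOp_eq [IsUltrametricDist K] [CharZero K] [CompleteSpace W]
    {π : E →L[K] E} (hπ : IsIdempotentElem π) {c : ℕ} (hc : c ≠ 0) {θ : E → W} {x₀ : E}
    (hθ : AnalyticAt K θ x₀) :
    ∃ f : E → W, AnalyticAt K f x₀ ∧ ∀ᶠ x in 𝓝 x₀, eulerOp π c x₀ f x = θ x := by
  obtain ⟨p, r, hp⟩ := hθ
  have hpos : 0 < (eulerSeries π c p).radius :=
    eulerSeries_radius_pos π hc (hp.r_pos.trans_le hp.r_le)
  have hf : HasFPowerSeriesOnBall (fun x => (eulerSeries π c p).sum (x - x₀)) (eulerSeries π c p)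
      x₀ (eulerSeries π c p).radius := by
    simpa using ((eulerSeries π c p).hasFPowerSeriesOnBall hpos).comp_sub x₀
  refine ⟨_, hf.analyticAt, ?_⟩
  filter_upwards [Metric.eball_mem_nhds x₀ hp.r_pos, Metric.eball_mem_nhds x₀ hpos] with x hxp hxf
  refine (((hf.hasSum_sub hxf).const_smul (c : K)).add
    (hasSum_fderiv_apply hf hxf (π (x - x₀)))).unique ?_
  simpa only [eulerSeries_apply_add_linearDeriv hπ hc] using hp.hasSum_sub hxp

theorem hasFPowerSeriesOnBall_eulerOp [IsUltrametricDist K] [CompleteSpace W] {f : E → W}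
    {p : FormalMultilinearSeries K E W} {x₀ : E} {r : ENNReal}
    (hf : HasFPowerSeriesOnBall f p x₀ r) (c : ℕ) :
    HasFPowerSeriesOnBall (eulerOp (.id K E) c x₀ f) (fun n => ((c + n : ℕ) : K) • p n) x₀ r where
  r_le := hf.r_le.trans (FormalMultilinearSeries.radius_le_of_le fun n => by
    rw [norm_smul]
    exact mul_le_of_le_one_left (norm_nonneg _) (IsUltrametricDist.norm_natCast_le_one K _))
  r_pos := hf.r_pos
  hasSum {v} hv := by
    have hx : x₀ + v ∈ Metric.eball x₀ r := by simpa [edist_eq_enorm_sub] using hv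
    convert ((hf.hasSum_sub hx).const_smul (c : K)).add (hasSum_fderiv_apply hf hx v) using 2
    · simp [ContinuousMultilinearMap.linearDeriv_apply, add_smul, Nat.cast_smul_eq_nsmul]
    · simp [eulerOp]

theorem eq_zero_of_eventually_eulerOp_eq_zero [IsUltrametricDist K] [CharZero K] [CompleteSpace W]
    {f : E → W} {p : FormalMultilinearSeries K E W} {x₀ : E} {r : ENNReal}
    (hf : HasFPowerSeriesOnBall f p x₀ r) {c : ℕ} (h0 : c = 0 → f x₀ = 0)
    (he : ∀ᶠ x in 𝓝 x₀, eulerOp (.id K E) c x₀ f x = 0) {x : E} (hx : x ∈ Metric.eball x₀ r) :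
    f x = 0 := by
  have hzero : HasFPowerSeriesAt (0 : E → W) (fun n => ((c + n : ℕ) : K) • p n) x₀ :=
    (hasFPowerSeriesOnBall_eulerOp hf c).hasFPowerSeriesAt.congr he
  have p_apply (n : ℕ) (v : E) : (p n fun _ => v) = 0 := by
    have h : ((c + n : ℕ) : K) • (p n fun _ => v) = 0 := hzero.apply_eq_zero n v
    obtain hcn | hcn := eq_or_ne (c + n) 0
    · obtain ⟨rfl, rfl⟩ := Nat.add_eq_zero_iff.1 hcn
      rw [hf.coeff_zero, h0 rfl]
    · exact (smul_eq_zero.1 h).resolve_left (Nat.cast_ne_zero.2 hcn)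
  exact (hf.hasSum_sub hx).unique (by simpa only [p_apply] using hasSum_zero)

end Euler

section EulerUniqueness

variable {K : Type*} [NontriviallyNormedField K]
  {E : Type*} [NormedAddCommGroup E] [NormedSpace K E]
  {W : Type*} [NormedAddCommGroup W] [NormedSpace K W]
  {W' : Type*} [NormedAddCommGroup W'] [NormedSpace K W']

theorem eulerOp_sub (π : E →L[K] E) (c : ℕ) (x₀ : E) {f g : E → W} {x : E}
    (hf : DifferentiableAt K f x) (hg : DifferentiableAt K g x) :
    eulerOp π c x₀ (f - g) x = eulerOp π c x₀ f x - eulerOp π c x₀ g x := by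
  simp only [eulerOp, fderiv_sub hf hg, Pi.sub_apply, sub_apply, smul_sub]
  abel

theorem eulerOp_clm_comp (π : E →L[K] E) (c : ℕ) (x₀ : E) (L : W →L[K] W') {f : E → W} {x : E}
    (hf : DifferentiableAt K f x) :
    eulerOp π c x₀ (L ∘ f) x = L (eulerOp π c x₀ f x) := by
  rw [eulerOp, (L.hasFDerivAt.comp x hf.hasFDerivAt).fderiv, eulerOp, map_add, map_smul]
  rfl

theorem eqOn_of_eventually_eulerOp_eq [IsUltrametricDist K] [CharZero K] [CompleteSpace W]
    {f g : E → W} {p q : FormalMultilinearSeries K E W} {x₀ : E} {r : ENNReal}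
    (hf : HasFPowerSeriesOnBall f p x₀ r) (hg : HasFPowerSeriesOnBall g q x₀ r)
    {c : ℕ} (hc : c ≠ 0)
    (he : ∀ᶠ x in 𝓝 x₀, eulerOp (.id K E) c x₀ f x = eulerOp (.id K E) c x₀ g x) :
    Set.EqOn f g (Metric.eball x₀ r) := by
  intro x hx
  refine sub_eq_zero.1 (eq_zero_of_eventually_eulerOp_eq_zero (hf.sub hg) (fun h => absurd h hc)
    ?_ hx)
  filter_upwards [he, hf.analyticAt.eventually_analyticAt, hg.analyticAt.eventually_analyticAt]
    with z hz hfz hgz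
  rw [eulerOp_sub _ _ _ hfz.differentiableAt hgz.differentiableAt, hz, sub_self]

end EulerUniqueness

section Slices

variable {K : Type*} [NontriviallyNormedField K]
  {E : Type*} [NormedAddCommGroup E] [NormedSpace K E]
  {F : Type*} [NormedAddCommGroup F] [NormedSpace K F]
  {W : Type*} [NormedAddCommGroup W] [NormedSpace K W]

theorem fderiv_slice {f : E × F → W} {z : E × F} (hf : DifferentiableAt K f z) :
    fderiv K (fun y => f (z.1, y)) z.2 = fderiv K f z ∘L .inr K E F :=
  (HasFDerivAt.comp z.2 (f := fun y => (z.1, y)) (g := f) hf.hasFDerivAt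
    (hasFDerivAt_prodMk_right z.1 z.2)).fderiv

theorem analyticAt_slice {f : E × F → W} {z : E × F} (hf : AnalyticAt K f z) :
    AnalyticAt K (fun y => f (z.1, y)) z.2 :=
  hf.comp (f := fun y => (z.1, y)) (analyticAt_const.prod analyticAt_id)

theorem exists_eventually_eulerOp_slice_eq [IsUltrametricDist K] [CharZero K] [CompleteSpace W]
    {c : ℕ} (hc : c ≠ 0) {θ : E × F → W} {b₀ : E} {y₀ : F} (hθ : AnalyticAt K θ (b₀, y₀)) :
    ∃ f : E × F → W, AnalyticAt K f (b₀, y₀) ∧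
      ∀ᶠ z in 𝓝 (b₀, y₀), eulerOp (.id K F) c y₀ (fun y => f (z.1, y)) z.2 = θ z := by
  have hπ : IsIdempotentElem (.inr K E F ∘L .snd K E F) := by ext <;> simp
  obtain ⟨f, hf, he⟩ := exists_eventually_eulerOp_eq hπ hc hθ
  refine ⟨f, hf, ?_⟩
  filter_upwards [he, hf.eventually_analyticAt] with z hz hfz
  simpa [eulerOp, fderiv_slice hfz.differentiableAt] using hz

theorem exists_eventually_hasFPowerSeriesOnBall_slice [CompleteSpace W] {f : E × F → W} {b₀ : E}
    {y₀ : F} (hf : AnalyticAt K f (b₀, y₀)) :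
    ∃ r : ENNReal, 0 < r ∧ ∀ᶠ b in 𝓝 b₀, ∃ p : FormalMultilinearSeries K F W,
      HasFPowerSeriesOnBall (fun y => f (b, y)) p y₀ r := by
  obtain ⟨p, R, hp⟩ := hf
  obtain ⟨r, hr0, hrR⟩ := ENNReal.lt_iff_exists_nnreal_btwn.1 (ENNReal.half_pos hp.r_pos.ne')
  refine ⟨r, hr0, ?_⟩
  filter_upwards [Metric.eball_mem_nhds b₀ hr0] with b hb
  have hb_lt : ‖(b - b₀, (0 : F))‖ₑ < r := by
    rw [Metric.mem_eball, edist_eq_enorm_sub, enorm_eq_nnnorm] at hb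
    simpa [enorm_eq_nnnorm, Prod.nnnorm_def] using hb
  have hrR' : (r : ENNReal) + ‖(b - b₀, (0 : F))‖ₑ ≤ R :=
    (add_le_add hrR.le (hb_lt.le.trans hrR.le)).trans_eq (ENNReal.add_halves R)
  have h_shift : HasFPowerSeriesOnBall f (p.changeOrigin (b - b₀, 0)) (b, y₀) r := by
    have hlt : (‖(b - b₀, (0 : F))‖₊ : ENNReal) < R :=
      hb_lt.trans (hrR.trans_le ENNReal.half_le_self)
    have h := hp.changeOrigin hlt
    rw [Prod.mk_add_mk, add_sub_cancel, add_zero] at h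
    exact h.mono hr0 (ENNReal.le_sub_of_add_le_right ENNReal.coe_ne_top hrR')
  have h_centered : HasFPowerSeriesOnBall (fun z => f (z + (b, 0)))
      (p.changeOrigin (b - b₀, 0)) (ContinuousLinearMap.inr K E F y₀) r := by
    have h := h_shift.comp_sub (-(b, (0 : F)))
    have center_eq : (b, y₀) + -(b, (0 : F)) = ContinuousLinearMap.inr K E F y₀ := by simp
    simpa only [sub_neg_eq_add, center_eq] using h
  have norm_inr_le : ‖ContinuousLinearMap.inr K E F‖ₑ ≤ 1 := by
    rw [enorm_eq_nnnorm]
    exact_mod_cast ContinuousLinearMap.norm_inr_le_one K E F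
  refine ⟨_, (h_centered.compContinuousLinearMap.mono hr0 ?_).congr fun y _ => by simp⟩
  simpa using ENNReal.div_le_div_left norm_inr_le (r : ENNReal)

variable [IsUltrametricDist K] [CharZero K] [CompleteSpace W]

theorem eventually_eq_zero_of_eulerOp_slice_eq_zero {f : E × F → W} {b₀ : E} {y₀ : F}
    (hf : AnalyticAt K f (b₀, y₀)) {c : ℕ} (h0 : c = 0 → ∀ b, f (b, y₀) = 0)
    (he : ∀ᶠ z in 𝓝 (b₀, y₀), eulerOp (.id K F) c y₀ (fun y => f (z.1, y)) z.2 = 0) :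
    ∀ᶠ z in 𝓝 (b₀, y₀), f z = 0 := by
  obtain ⟨r, hr, hp⟩ := exists_eventually_hasFPowerSeriesOnBall_slice hf
  rw [nhds_prod_eq]
  filter_upwards [(hp.and he.curry_nhds).prod_mk (Metric.eball_mem_nhds y₀ hr)]
    with z ⟨⟨⟨p, hp⟩, he⟩, hz⟩
  exact eq_zero_of_eventually_eulerOp_eq_zero hp (fun hc => h0 hc z.1) he hz

theorem eventually_eq_of_fderiv_slice_eq_zero {f : E × F → W} {b₀ : E} {y₀ : F}
    (hf : AnalyticAt K f (b₀, y₀))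
    (hd : ∀ᶠ z in 𝓝 (b₀, y₀), fderiv K (fun y => f (z.1, y)) z.2 = 0) :
    ∀ᶠ z in 𝓝 (b₀, y₀), f z = f (z.1, y₀) := by
  have hg : AnalyticAt K (fun z : E × F => f z - f (z.1, y₀)) (b₀, y₀) :=
    hf.sub (hf.comp (f := fun z : E × F => (z.1, y₀)) (analyticAt_fst.prod analyticAt_const))
  have hg0 := eventually_eq_zero_of_eulerOp_slice_eq_zero hg (c := 0) (fun _ b => sub_self _) (by
    filter_upwards [hd] with z hz
    simp [eulerOp, fderiv_sub_const, hz])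
  exact hg0.mono fun z hz => sub_eq_zero.1 hz

end Slices

section Poincare

variable {K : Type*} [NontriviallyNormedField K]
  {E : Type*} [NormedAddCommGroup E] [NormedSpace K E]
  {F : Type*} [NormedAddCommGroup F] [NormedSpace K F]
  {W : Type*} [NormedAddCommGroup W] [NormedSpace K W] {k : ℕ}

theorem hasFDerivAt_clm_comp {A : Type*} [NormedAddCommGroup A] [NormedSpace K A]
    {f : F → A} {f' : F →L[K] A} {y : F} (L : A →L[K] W) (hf : HasFDerivAt f f' y) :
    HasFDerivAt (fun y => L (f y)) (L ∘L f') y :=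
  L.hasFDerivAt.comp y hf

theorem extDeriv_eulerOp {f : F → F [⋀^Fin k]→L[K] W} {y : F} (hf : ContDiffAt K ω f y)
    (c : ℕ) (y₀ : F) :
    extDeriv (eulerOp (.id K F) c y₀ f) y = eulerOp (.id K F) (c + 1) y₀ (extDeriv f) y := by
  have hf' : DifferentiableAt K f y := hf.differentiableAt (by simp)
  have hf'' : DifferentiableAt K (fderiv K f) y :=
    (hf.fderiv_right (m := ω) (by simp)).differentiableAt (by simp)
  have fderiv_eulerOp : fderiv K (eulerOp (.id K F) c y₀ f) y =
      (c : K) • fderiv K f y + (fderiv K f y + (fderiv K (fderiv K f) y).flip (y - y₀)) := by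
    refine HasFDerivAt.fderiv ((hf'.hasFDerivAt.const_smul (c : K)).add ?_)
    simpa using hf''.hasFDerivAt.clm_apply ((hasFDerivAt_id y).sub_const y₀)
  have flip_eq : (fderiv K (fderiv K f) y).flip (y - y₀) = fderiv K (fderiv K f) y (y - y₀) := by
    ext1 v
    exact hf.isSymmSndFDerivAt le_top v (y - y₀)
  have fderiv_extDeriv : fderiv K (extDeriv f) y = ContinuousLinearMap.comp
      (ContinuousAlternatingMap.alternatizeUncurryFinCLM K F W) (fderiv K (fderiv K f) y) :=
    (hasFDerivAt_clm_comp (K := K) (A := F →L[K] F [⋀^Fin k]→L[K] W)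
      (W := F [⋀^Fin (k + 1)]→L[K] W) (f := fderiv K f)
      (ContinuousAlternatingMap.alternatizeUncurryFinCLM K F W) hf''.hasFDerivAt).fderiv
  rw [extDeriv, fderiv_eulerOp, flip_eq, eulerOp, fderiv_extDeriv]
  simp [extDeriv, ContinuousAlternatingMap.alternatizeUncurryFin_add,
    ContinuousAlternatingMap.alternatizeUncurryFin_smul, add_smul, add_assoc]

/-- The contraction of a differential form with the radial vector field `y ↦ y - y₀`. -/
def radialContraction (y₀ : F) (f : F → F [⋀^Fin (k + 1)]→L[K] W) (y : F) : F [⋀^Fin k]→L[K] W :=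
  (f y).curryLeft (y - y₀)

theorem alternatizeUncurryFin_flip_curryLeftLI_comp (A : F →L[K] F [⋀^Fin (k + 1)]→L[K] W)
    (u : F) :
    ContinuousAlternatingMap.alternatizeUncurryFin
        ((ContinuousAlternatingMap.curryLeftLI.toContinuousLinearMap ∘L A).flip u) =
      A u - (ContinuousAlternatingMap.alternatizeUncurryFin A).curryLeft u := by
  ext v
  rw [ContinuousAlternatingMap.sub_apply, ContinuousAlternatingMap.curryLeft_apply_apply,
    ContinuousAlternatingMap.alternatizeUncurryFin_apply,
    ContinuousAlternatingMap.alternatizeUncurryFin_apply, Fin.sum_univ_succ (n := k + 1)]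
  simp only [Matrix.vecCons, Fin.val_zero, pow_zero, one_smul, Fin.cons_zero, Fin.removeNth_zero,
    Fin.tail_cons, Fin.cons_succ, Fin.val_succ, pow_succ, mul_neg, mul_one, neg_smul,
    Finset.sum_neg_distrib, sub_add_cancel_left, neg_neg]
  refine Finset.sum_congr rfl fun i _ => ?_
  congr 1
  change A (v i) (Matrix.vecCons u (i.removeNth v)) = _
  congr 1
  funext j
  refine Fin.cases rfl (fun j => ?_) j
  simp [Fin.removeNth, Fin.succ_succAbove_succ]

/-- Cartan's formula `d ι_R f = L_R f - ι_R d f` for the radial vector field `R`, whose Lie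
derivative multiplies the coordinates of a form of degree `k + 1` by `k + 1` in addition to
differentiating them along `R`. -/
theorem extDeriv_radialContraction {f : F → F [⋀^Fin (k + 1)]→L[K] W} {y : F}
    (hf : DifferentiableAt K f y) (y₀ : F) :
    extDeriv (radialContraction y₀ f) y =
      eulerOp (.id K F) (k + 1) y₀ f y - radialContraction y₀ (extDeriv f) y := by
  have hf' : HasFDerivAt (radialContraction y₀ f) ((f y).curryLeft +
      (ContinuousAlternatingMap.curryLeftLI.toContinuousLinearMap ∘L fderiv K f y).flip (y - y₀))
      y := by
    have hcurry : HasFDerivAt (fun y => (f y).curryLeft)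
        (ContinuousAlternatingMap.curryLeftLI.toContinuousLinearMap ∘L fderiv K f y) y :=
      hasFDerivAt_clm_comp (A := F [⋀^Fin (k + 1)]→L[K] W) (W := F →L[K] F [⋀^Fin k]→L[K] W)
        ContinuousAlternatingMap.curryLeftLI.toContinuousLinearMap hf.hasFDerivAt
    have := HasFDerivAt.clm_apply (G := F) (H := F [⋀^Fin k]→L[K] W) hcurry
      ((hasFDerivAt_id y).sub_const y₀)
    rw [ContinuousLinearMap.comp_id] at this
    exact this
  rw [extDeriv, hf'.fderiv, ContinuousAlternatingMap.alternatizeUncurryFin_add,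
    ContinuousAlternatingMap.alternatizeUncurryFin_curryLeft, ← Nat.cast_smul_eq_nsmul K,
    alternatizeUncurryFin_flip_curryLeftLI_comp, eulerOp, add_sub_assoc, radialContraction,
    extDeriv, ContinuousLinearMap.id_apply]

theorem analyticAt_extDeriv_slice [CompleteSpace W] {f : E × F → F [⋀^Fin k]→L[K] W} {z₀ : E × F}
    (hf : AnalyticAt K f z₀) :
    AnalyticAt K (fun z : E × F => extDeriv (fun y => f (z.1, y)) z.2) z₀ := by
  let precompInr : (E × F →L[K] F [⋀^Fin k]→L[K] W) →L[K] F →L[K] F [⋀^Fin k]→L[K] W :=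
    (ContinuousLinearMap.inr K E F).precomp _
  have h := ((ContinuousAlternatingMap.alternatizeUncurryFinCLM K F W ∘L precompInr).analyticAt
    _).comp hf.fderiv
  refine h.congr ?_
  filter_upwards [hf.eventually_analyticAt] with z hz
  rw [extDeriv, fderiv_slice hz.differentiableAt]
  rfl

variable [IsUltrametricDist K] [CharZero K] [CompleteSpace W]

theorem eventually_extDeriv_slice_eq_zero_of_eulerOp {f θ : E × F → F [⋀^Fin k]→L[K] W} {b₀ : E}
    {y₀ : F} (hf : AnalyticAt K f (b₀, y₀)) {c : ℕ}
    (he : ∀ᶠ z in 𝓝 (b₀, y₀), eulerOp (.id K F) c y₀ (fun y => f (z.1, y)) z.2 = θ z)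
    (hd : ∀ᶠ z in 𝓝 (b₀, y₀), extDeriv (fun y => θ (z.1, y)) z.2 = 0) :
    ∀ᶠ z in 𝓝 (b₀, y₀), extDeriv (fun y => f (z.1, y)) z.2 = 0 := by
  refine eventually_eq_zero_of_eulerOp_slice_eq_zero (analyticAt_extDeriv_slice hf) (c := c + 1)
    (by simp) ?_
  filter_upwards [he.eventually_nhds, hf.eventually_analyticAt, hd] with z hz hfz hdz
  have hslice : Filter.Tendsto (fun y => (z.1, y)) (𝓝 z.2) (𝓝 z) :=
    (by fun_prop : Continuous fun y : F => (z.1, y)).tendsto z.2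
  rw [← extDeriv_eulerOp (analyticAt_slice hfz).contDiffAt, ← hdz]
  exact Filter.EventuallyEq.extDeriv_eq (hslice.eventually hz)

theorem exists_eventually_extDeriv_radialContraction_eq
    {θ : E × F → F [⋀^Fin (k + 1)]→L[K] W} {b₀ : E} {y₀ : F} (hθ : AnalyticAt K θ (b₀, y₀))
    (hd : ∀ᶠ z in 𝓝 (b₀, y₀), extDeriv (fun y => θ (z.1, y)) z.2 = 0) :
    ∃ f : E × F → F [⋀^Fin (k + 1)]→L[K] W, AnalyticAt K f (b₀, y₀) ∧
      (∀ᶠ z in 𝓝 (b₀, y₀), eulerOp (.id K F) (k + 1) y₀ (fun y => f (z.1, y)) z.2 = θ z) ∧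
      ∀ᶠ z in 𝓝 (b₀, y₀), extDeriv (radialContraction y₀ fun y => f (z.1, y)) z.2 = θ z := by
  obtain ⟨f, hf, he⟩ := exists_eventually_eulerOp_slice_eq k.succ_ne_zero hθ
  refine ⟨f, hf, he, ?_⟩
  filter_upwards [he, eventually_extDeriv_slice_eq_zero_of_eulerOp hf he hd,
    hf.eventually_analyticAt] with z hz hdz hfz
  rw [extDeriv_radialContraction (analyticAt_slice hfz).differentiableAt, hz, radialContraction,
    hdz, ContinuousAlternatingMap.curryLeft_zero, zero_apply, sub_zero]

end Poincare

/-! ### Open partitions -/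

section OpenPartitions

/-- Strong zero-dimensionality: every open covering of `T`, given here by a neighbourhood `N t` of
each point `t`, is refined by a partition of `T` into open sets. The partition is encoded as the
family of fibres of a locally constant selection `s` of members of the covering. -/
def HasOpenPartitions (T : Type*) [TopologicalSpace T] : Prop :=
  ∀ N : T → Set T, (∀ t, N t ∈ 𝓝 t) → ∃ s : T → T, IsLocallyConstant s ∧ ∀ t, t ∈ N (s t)

/-- The partition consists of the balls `ball t (2⁻¹ ^ n t)`, with `n t` minimal such that the ball
is contained in a member of the covering: two such balls are disjoint or equal. -/
theorem hasOpenPartitions_of_isUltrametricDist (T : Type*) [PseudoMetricSpace T]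
    [IsUltrametricDist T] : HasOpenPartitions T := by
  classical
  intro N hN
  have exists_ball_subset : ∀ t, ∃ n : ℕ, ∃ c, Metric.ball t (2⁻¹ ^ n) ⊆ N c := fun t => by
    obtain ⟨ε, hε, h⟩ := Metric.mem_nhds_iff.1 (hN t)
    obtain ⟨n, hn⟩ := exists_pow_lt_of_lt_one hε (by norm_num : (2⁻¹ : ℝ) < 1)
    exact ⟨n, t, (Metric.ball_subset_ball hn.le).trans h⟩
  let n : T → ℕ := fun t => Nat.find (exists_ball_subset t)
  let B : T → Set T := fun t => Metric.ball t (2⁻¹ ^ n t)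
  have hB : ∀ t, ∃ c, B t ⊆ N c := fun t => Nat.find_spec (exists_ball_subset t)
  have mem_B : ∀ t, t ∈ B t := fun t => Metric.mem_ball_self (by positivity)
  have n_le : ∀ t, ∀ t' ∈ B t, n t' ≤ n t := fun t t' h => by
    obtain ⟨c, hc⟩ := hB t
    exact Nat.find_min' _ ⟨c, (IsUltrametricDist.ball_eq_of_mem h).symm.subset.trans hc⟩
  have B_eq : ∀ t, ∀ t' ∈ B t, B t' = B t := fun t t' h => by
    have hle := n_le t t' h
    have h' : t ∈ B t' := Metric.mem_ball_comm.1
      (Metric.ball_subset_ball (pow_le_pow_of_le_one (by norm_num) (by norm_num) hle) h)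
    have hn : n t' = n t := le_antisymm hle (n_le t' t h')
    simpa only [B, hn] using (IsUltrametricDist.ball_eq_of_mem h).symm
  have exists_subset_N : ∀ S : Set.range B, ∃ c, (S : Set T) ⊆ N c := by
    rintro ⟨_, t, rfl⟩
    exact hB t
  choose s hs using exists_subset_N
  refine ⟨fun t => s ⟨B t, t, rfl⟩, ?_, fun t => hs _ (mem_B t)⟩
  rw [IsLocallyConstant.iff_eventually_eq]
  exact fun t => Filter.mem_of_superset (Metric.ball_mem_nhds t (by positivity))
    fun t' ht' => congrArg s (Subtype.ext (B_eq t t' ht'))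

variable {T : Type*} [TopologicalSpace T]

theorem HasOpenPartitions.of_isInducing {M : Type*} [PseudoMetricSpace M] [IsUltrametricDist M]
    {f : T → M} (hf : Topology.IsInducing f) : HasOpenPartitions T := by
  let _ : PseudoMetricSpace T := hf.comapPseudoMetricSpace
  have : IsUltrametricDist T := ⟨fun x y z => dist_triangle_max (f x) (f y) (f z)⟩
  exact hasOpenPartitions_of_isUltrametricDist T

theorem hasOpenPartitions_source {M : Type*} [PseudoMetricSpace M] [IsUltrametricDist M]
    (e : OpenPartialHomeomorph T M) : HasOpenPartitions e.source :=
  .of_isInducing e.isOpenEmbedding_restrict.isInducing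

theorem HasOpenPartitions.of_isLocallyConstant {ι : Type*} {s : T → ι} (hs : IsLocallyConstant s)
    (C : ι → Set T) (hmem : ∀ t, t ∈ C (s t)) (hC : ∀ i, HasOpenPartitions (C i)) :
    HasOpenPartitions T := by
  intro N hN
  choose σ hσ hσN using fun i => hC i (fun t => Subtype.val ⁻¹' N t) fun t =>
    continuous_subtype_val.continuousAt.preimage_mem_nhds (hN t)
  refine ⟨fun t => σ (s t) ⟨t, hmem t⟩, ?_, fun t => hσN (s t) ⟨t, hmem t⟩⟩
  rw [IsLocallyConstant.iff_eventually_eq]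
  intro t
  have hσt := (hσ (s t)).eventually_eq ⟨t, hmem t⟩
  rw [nhds_induced, Filter.eventually_comap] at hσt
  filter_upwards [hσt, hs.eventually_eq t] with t' hσt' hst'
  have σ_eq : ∀ i (_ : i = s t) (hi : t' ∈ C i), (σ i ⟨t', hi⟩ : T) = σ (s t) ⟨t, hmem t⟩ := by
    rintro i rfl hi
    rw [hσt' ⟨t', hi⟩ rfl]
  exact σ_eq _ hst' _

theorem HasOpenPartitions.exists_isClopen_between (hT : HasOpenPartitions T) {Z W : Set T}
    (hZ : IsClosed Z) (hW : IsOpen W) (hZW : Z ⊆ W) : ∃ Q, IsClopen Q ∧ Z ⊆ Q ∧ Q ⊆ W := by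
  classical
  obtain ⟨s, hs, hsN⟩ := hT (fun t => if t ∈ Z then W else Zᶜ) fun t => by
    split_ifs with ht
    exacts [hW.mem_nhds (hZW ht), hZ.isOpen_compl.mem_nhds ht]
  refine ⟨s ⁻¹' Z, ⟨⟨hs Zᶜ⟩, hs Z⟩, fun t ht => ?_, fun t ht => ?_⟩
  · by_contra hst
    exact (if_neg hst ▸ hsN t :) ht
  · exact (if_pos ht ▸ hsN t :)

theorem isClopen_image_val_of_closure_subset {U : Set T} (hU : IsOpen U) {Q : Set U}
    (hQ : IsClopen Q) (hQU : closure (Subtype.val '' Q) ⊆ U) : IsClopen (Subtype.val '' Q) := by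
  refine ⟨isClosed_of_closure_subset fun t ht => ?_, hU.isOpenMap_subtype_val _ hQ.isOpen⟩
  have ht' : (⟨t, hQU ht⟩ : U) ∈ closure Q := closure_subtype.2 ht
  exact ⟨_, hQ.isClosed.closure_subset ht', rfl⟩

theorem exists_isClopen_between_of_hasOpenPartitions {U Z W : Set T} (hU : IsOpen U)
    (hUp : HasOpenPartitions U) (hZ : IsClosed Z) (hW : IsOpen W) (hZW : Z ⊆ W)
    (hWU : closure W ⊆ U) : ∃ Q, IsClopen Q ∧ Z ⊆ Q ∧ Q ⊆ W := by
  obtain ⟨Q, hQ, hZQ, hQW⟩ := hUp.exists_isClopen_between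
    (hZ.preimage continuous_subtype_val) (hW.preimage continuous_subtype_val)
    (Set.preimage_mono hZW)
  have hQW' : Subtype.val '' Q ⊆ W := Set.image_subset_iff.2 hQW
  exact ⟨_, isClopen_image_val_of_closure_subset hU hQ ((closure_mono hQW').trans hWU),
    fun t ht => ⟨⟨t, hWU (subset_closure (hZW ht))⟩, hZQ ht, rfl⟩, hQW'⟩

theorem exists_isLocallyConstant_of_locallyFinite_isClopen {ι : Type*} {Q : ι → Set T}
    (hQ : ∀ i, IsClopen (Q i)) (hQf : LocallyFinite Q) (hcov : ⋃ i, Q i = Set.univ) :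
    ∃ s : T → ι, IsLocallyConstant s ∧ ∀ t, t ∈ Q (s t) := by
  have hmem : ∀ t, {i | t ∈ Q i}.Nonempty := Set.iUnion_eq_univ_iff.1 hcov
  have hconst : IsLocallyConstant fun t => {i | t ∈ Q i} := by
    rw [IsLocallyConstant.iff_eventually_eq]
    intro t
    have hsup : ∀ᶠ t' in 𝓝 t, ∀ i ∈ {i | t ∈ Q i}, t' ∈ Q i :=
      (hQf.point_finite t).eventually_all.2 fun i hi => (hQ i).isOpen.mem_nhds hi
    filter_upwards [hQf.eventually_subset (fun i => (hQ i).isClosed) t, hsup] with t' h h'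
    exact h.antisymm h'
  have hne : ∀ A : Set.range fun t => {i | t ∈ Q i}, (A : Set ι).Nonempty := by
    rintro ⟨_, t, rfl⟩
    exact hmem t
  choose s hs using hne
  refine ⟨fun t => s ⟨_, t, rfl⟩, ?_, fun t => hs ⟨_, t, rfl⟩⟩
  rw [IsLocallyConstant.iff_eventually_eq]
  exact fun t => (hconst.eventually_eq t).mono fun t' ht' => congrArg s (Subtype.ext ht')

theorem exists_isLocallyConstant_of_hasOpenPartitions [T2Space T] [ParacompactSpace T] {ι : Type*}
    {U : ι → Set T} (hU : ∀ i, IsOpen (U i)) (hcov : ⋃ i, U i = Set.univ)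
    (hUp : ∀ i, HasOpenPartitions (U i)) :
    ∃ s : T → ι, IsLocallyConstant s ∧ ∀ t, t ∈ U (s t) := by
  obtain ⟨v, hvo, hvc, hvf, hvU⟩ := precise_refinement U hU hcov
  obtain ⟨w, hwc, hwo, hwv⟩ := exists_iUnion_eq_closure_subset hvo hvf.point_finite hvc
  have hwv' : ∀ i, w i ⊆ v i := fun i => subset_closure.trans (hwv i)
  obtain ⟨z, hzc, -, hzw⟩ := exists_iUnion_eq_closure_subset hwo
    (fun t => (hvf.point_finite t).subset fun i hi => hwv' i hi) hwc
  choose Q hQ hzQ hQw using fun i => exists_isClopen_between_of_hasOpenPartitions (hU i) (hUp i)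
    isClosed_closure (hwo i) (hzw i) ((hwv i).trans (hvU i))
  have hQf : LocallyFinite Q := hvf.subset fun i => (hQw i).trans (hwv' i)
  have hQc : ⋃ i, Q i = Set.univ := Set.eq_univ_of_univ_subset <|
    hzc.symm.subset.trans (Set.iUnion_mono fun i => subset_closure.trans (hzQ i))
  obtain ⟨s, hs, hsQ⟩ := exists_isLocallyConstant_of_locallyFinite_isClopen hQ hQf hQc
  exact ⟨s, hs, fun t => hvU _ (hwv' _ (hQw _ (hsQ t)))⟩

theorem exists_isLocallyConstant_mem_chartAt_source (M X : Type*) [PseudoMetricSpace M]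
    [IsUltrametricDist M] [TopologicalSpace X] [T2Space X] [ParacompactSpace X]
    [ChartedSpace M X] : ∃ s : X → X, IsLocallyConstant s ∧ ∀ x, x ∈ (chartAt M (s x)).source :=
  exists_isLocallyConstant_of_hasOpenPartitions (fun x => (chartAt M x).open_source)
    (Set.iUnion_eq_univ_iff.2 fun x => ⟨x, mem_chart_source M x⟩)
    fun _ => hasOpenPartitions_source _

theorem isUltrametricDist_prod (M M' : Type*) [PseudoMetricSpace M] [IsUltrametricDist M]
    [PseudoMetricSpace M'] [IsUltrametricDist M'] : IsUltrametricDist (M × M') :=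
  ⟨fun x y z => max_le
    ((dist_triangle_max x.1 y.1 z.1).trans (max_le_max (le_max_left _ _) (le_max_left _ _)))
    ((dist_triangle_max x.2 y.2 z.2).trans (max_le_max (le_max_right _ _) (le_max_right _ _)))⟩

theorem hasOpenPartitions_prod {M M' X Y : Type*} [PseudoMetricSpace M] [IsUltrametricDist M]
    [PseudoMetricSpace M'] [IsUltrametricDist M'] [TopologicalSpace X] [T2Space X]
    [ParacompactSpace X] [TopologicalSpace Y] [T2Space Y] [ParacompactSpace Y]
    [ChartedSpace M X] [ChartedSpace M' Y] : HasOpenPartitions (X × Y) := by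
  have := isUltrametricDist_prod M M'
  obtain ⟨s, hs, hsX⟩ := exists_isLocallyConstant_mem_chartAt_source M X
  obtain ⟨s', hs', hsY⟩ := exists_isLocallyConstant_mem_chartAt_source M' Y
  refine .of_isLocallyConstant (s := fun p : X × Y => (s p.1, s' p.2))
    ((hs.comp_continuous continuous_fst).prodMk (hs'.comp_continuous continuous_snd))
    (fun i => ((chartAt M i.1).prod (chartAt M' i.2)).source)
    (fun p => ⟨hsX p.1, hsY p.2⟩) fun i => hasOpenPartitions_source _

end OpenPartitions

/-! ### Exactness on sections -/

section SheafExactness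

theorem exact_of_forall_exact_map_evaluation {T A : Type*} [Category* T] [Category* A] [Abelian A]
    (S : ShortComplex (T ⥤ A)) (h : ∀ t, (S.map ((evaluation T A).obj t)).Exact) : S.Exact := by
  rw [S.exact_iff_isZero_homology, Functor.isZero_iff]
  intro t
  exact ((ShortComplex.exact_iff_isZero_homology _).1 (h t)).of_iso
    (S.mapHomologyIso ((evaluation T A).obj t)).symm

variable {C : Type*} [Category* C] {J : GrothendieckTopology C}

theorem sheaf_exact_of_forall_sections [HasSheafify J AddCommGrpCat.{u}]
    (S : ShortComplex (Sheaf J AddCommGrpCat.{u}))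
    (h : ∀ (X : Cᵒᵖ) (x : S.X₂.obj.obj X), S.g.hom.app X x = 0 →
      ∃ y : S.X₁.obj.obj X, S.f.hom.app X y = x) : S.Exact := by
  have presheaf_exact : (S.map (sheafToPresheaf J AddCommGrpCat.{u})).Exact :=
    exact_of_forall_exact_map_evaluation _ fun X => (ShortComplex.ab_exact_iff _).2 (h X)
  refine ShortComplex.exact_of_iso ?_
    (presheaf_exact.map_of_preservesLeftHomologyOf (presheafToSheaf J AddCommGrpCat.{u}))
  exact S.mapNatIso (asIso (sheafificationAdjunction J AddCommGrpCat.{u}).counit)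

theorem sheaf_mono_of_forall_injective {F F' : Sheaf J AddCommGrpCat.{u}} (f : F ⟶ F')
    (h : ∀ X : Cᵒᵖ, Function.Injective (f.hom.app X)) : Mono f := by
  refine (sheafToPresheaf J AddCommGrpCat.{u}).mono_of_mono_map ?_
  rw [NatTrans.mono_iff_mono_app]
  exact fun X => (AddCommGrpCat.mono_iff_injective _).2 (h X)

end SheafExactness

section SingleComplex

variable {C : Type*} [Category* C] [Abelian C] {A : C} {L : CochainComplex C ℕ}

theorem quasiIsoAt_zero_fromSingle₀Equiv_symm (f : A ⟶ L.X 0) (hf : f ≫ L.d 0 1 = 0)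
    (hmono : Mono f) (hexact : (ShortComplex.mk f (L.d 0 1) hf).Exact) :
    QuasiIsoAt ((CochainComplex.fromSingle₀Equiv L A).symm ⟨f, hf⟩) 0 := by
  rw [CochainComplex.quasiIsoAt₀_iff]
  refine (ShortComplex.quasiIso_iff_of_zeros _ rfl rfl (L.shape _ _ (by simp))).2 ?_
  refine (ShortComplex.exact_and_mono_f_iff_of_iso ?_).2 ⟨hexact, hmono⟩
  refine ShortComplex.isoMk (Iso.refl _) (Iso.refl _) (Iso.refl _) ?_ ?_
  · have hf₀ : ((CochainComplex.fromSingle₀Equiv L A).symm ⟨f, hf⟩).f 0 = f := by simp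
    exact (Category.id_comp f).trans (hf₀.symm.trans (Category.comp_id _).symm)
  · exact (Category.id_comp _).trans (Category.comp_id _).symm

theorem quasiIso_fromSingle₀Equiv_symm (f : A ⟶ L.X 0) (hf : f ≫ L.d 0 1 = 0) (hmono : Mono f)
    (hexact : (ShortComplex.mk f (L.d 0 1) hf).Exact) (hL : ∀ n, L.ExactAt (n + 1)) :
    QuasiIso ((CochainComplex.fromSingle₀Equiv L A).symm ⟨f, hf⟩) where
  quasiIsoAt
    | 0 => quasiIsoAt_zero_fromSingle₀Equiv_symm f hf hmono hexact
    | n + 1 => (quasiIsoAt_iff_exactAt _ _ (CochainComplex.exactAt_succ_single_obj _ _)).2 (hL n)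

end SingleComplex

section DeRham

variable {K : Type u} [NontriviallyNormedField K] [CompleteSpace K] [CharZero K]
  {V : Type u} [AddCommGroup V] [Module K V] [TopologicalSpace V] [IsTopologicalAddGroup V]
  [ContinuousSMul K V] [T2Space V]
  {EG : Type*} [NormedAddCommGroup EG] [NormedSpace K EG] {HG : Type*} [TopologicalSpace HG]
  (IG : ModelWithCorners K EG HG)
  {G : Type*} [Group G] [TopologicalSpace G] [ChartedSpace HG G] [IsManifold IG ω G]
  (ρ : G →* (V ≃L[K] V)) (Y : LaMan K)

theorem deRhamComplex_d (k : ℕ) : (deRhamComplex IG ρ Y).d k (k + 1) = formSheafD IG ρ Y k :=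
  CochainComplex.of_d (formSheaf IG ρ Y) (formSheafD IG ρ Y) k

theorem mono_locConstInclusion : Mono (locConstInclusion IG ρ Y) := by
  refine sheaf_mono_of_forall_injective _ fun X
    (s t : ULift.{u + 1} (admissibleLocConst IG ρ Y X.unop)) hst => ?_
  have zeroForm_eq : (fun x => (zeroForm (s.down.1 x) : VForm K V (Fin Y.dim → K) Y.carrier 0)) =
      fun x => zeroForm (t.down.1 x) :=
    congrArg (fun a : ULift.{u + 1} (admissibleForms IG ρ Y 0 X.unop) => a.down.1) hst
  refine ULift.ext _ _ (Subtype.ext (funext₂ fun x y => ?_))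
  exact congrArg (fun A : VForm K V (Fin Y.dim → K) Y.carrier 0 => A y 0) (congrFun zeroForm_eq x)

variable {IG ρ Y}

theorem exact_locConstInclusion
    (h : ∀ (X : LaMan K), ∀ s ∈ admissibleForms IG ρ Y 0 X, (∀ x, formD (s x) = 0) →
      ∃ f ∈ admissibleLocConst IG ρ Y X, ∀ x, zeroForm (f x) = s x) :
    (ShortComplex.mk (locConstInclusion IG ρ Y) (formSheafD IG ρ Y 0)
      (locConstInclusion_comp IG ρ Y)).Exact := by
  refine sheaf_exact_of_forall_sections _ fun X
    (s : ULift.{u + 1} (admissibleForms IG ρ Y 0 X.unop)) hs => ?_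
  have closed : (fun x => formD (s.down.1 x)) = 0 :=
    congrArg (fun a : ULift.{u + 1} (admissibleForms IG ρ Y 1 X.unop) => a.down.1) hs
  obtain ⟨f, hf, hfs⟩ := h X.unop s.down.1 s.down.2 (congrFun closed)
  exact ⟨(⟨⟨f, hf⟩⟩ : ULift.{u + 1} (admissibleLocConst IG ρ Y X.unop)),
    ULift.ext _ _ (Subtype.ext (funext hfs))⟩

theorem exactAt_deRhamComplex {k : ℕ}
    (h : ∀ (X : LaMan K), ∀ s ∈ admissibleForms IG ρ Y (k + 1) X, (∀ x, formD (s x) = 0) →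
      ∃ t ∈ admissibleForms IG ρ Y k X, ∀ x, formD (t x) = s x) :
    (deRhamComplex IG ρ Y).ExactAt (k + 1) := by
  rw [HomologicalComplex.exactAt_iff' _ k (k + 1) (k + 2) (by simp) (by simp)]
  have formSheafD_exact : (ShortComplex.mk (formSheafD IG ρ Y k) (formSheafD IG ρ Y (k + 1))
      (formSheafD_comp IG ρ Y k)).Exact := by
    refine sheaf_exact_of_forall_sections _ fun X
      (s : ULift.{u + 1} (admissibleForms IG ρ Y (k + 1) X.unop)) hs => ?_
    have closed : (fun x => formD (s.down.1 x)) = 0 :=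
      congrArg (fun a : ULift.{u + 1} (admissibleForms IG ρ Y (k + 2) X.unop) => a.down.1) hs
    obtain ⟨t, ht, hts⟩ := h X.unop s.down.1 s.down.2 (congrFun closed)
    exact ⟨(⟨⟨t, ht⟩⟩ : ULift.{u + 1} (admissibleForms IG ρ Y k X.unop)),
      ULift.ext _ _ (Subtype.ext (funext hts))⟩
  refine ShortComplex.exact_of_iso (ShortComplex.isoMk (Iso.refl (formSheaf IG ρ Y k))
    (Iso.refl (formSheaf IG ρ Y (k + 1))) (Iso.refl (formSheaf IG ρ Y (k + 2))) ?_ ?_)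
    formSheafD_exact
  · exact (Category.id_comp _).trans ((deRhamComplex_d IG ρ Y k).trans (Category.comp_id _).symm)
  · exact (Category.id_comp _).trans
      ((deRhamComplex_d IG ρ Y (k + 1)).trans (Category.comp_id _).symm)

theorem quasiIso_deRhamInclusion
    (h0 : ∀ (X : LaMan K), ∀ s ∈ admissibleForms IG ρ Y 0 X, (∀ x, formD (s x) = 0) →
      ∃ f ∈ admissibleLocConst IG ρ Y X, ∀ x, zeroForm (f x) = s x)
    (hsucc : ∀ (k : ℕ) (X : LaMan K), ∀ s ∈ admissibleForms IG ρ Y (k + 1) X,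
      (∀ x, formD (s x) = 0) → ∃ t ∈ admissibleForms IG ρ Y k X, ∀ x, formD (t x) = s x) :
    QuasiIso (deRhamInclusion IG ρ Y) := by
  exact quasiIso_fromSingle₀Equiv_symm (L := deRhamComplex IG ρ Y) (locConstInclusion IG ρ Y) _
    (mono_locConstInclusion IG ρ Y) (exact_locConstInclusion h0)
    fun k => exactAt_deRhamComplex (hsucc k)

end DeRham

/-! ### Parameters in a manifold -/

section ManifoldParameters

variable {K : Type*} [NontriviallyNormedField K]
  {EB : Type*} [NormedAddCommGroup EB] [NormedSpace K EB] {HB : Type*} [TopologicalSpace HB]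
  {I : ModelWithCorners K EB HB} {B : Type*} [TopologicalSpace B] [ChartedSpace HB B]

theorem eventually_comp_extChartAt {X : Type*} [TopologicalSpace X] {P : EB × X → Prop} {b₀ : B}
    {x₀ : X} (h : ∀ᶠ z in 𝓝 (extChartAt I b₀ b₀, x₀), P z) :
    ∀ᶠ q : B × X in 𝓝 (b₀, x₀), P (extChartAt I b₀ q.1, q.2) ∧
      (extChartAt I b₀).symm (extChartAt I b₀ q.1) = q.1 := by
  have hc : ContinuousAt (Prod.map (extChartAt I b₀) id) (b₀, x₀) :=
    (continuousAt_extChartAt b₀).prodMap continuousAt_id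
  have hs : ∀ᶠ q : B × X in 𝓝 (b₀, x₀), q.1 ∈ (extChartAt I b₀).source :=
    continuousAt_fst.eventually (extChartAt_source_mem_nhds b₀)
  filter_upwards [hc.eventually h, hs] with q hq hqs
  exact ⟨hq, (extChartAt I b₀).left_inv hqs⟩

theorem eventually_comp_extChartAt_symm {X : Type*} [TopologicalSpace X] {P : B × X → Prop}
    {b₀ : B} {x₀ : X} (h : ∀ᶠ q in 𝓝 (b₀, x₀), P q) :
    ∀ᶠ z : EB × X in 𝓝 (extChartAt I b₀ b₀, x₀), P ((extChartAt I b₀).symm z.1, z.2) := by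
  have hc : ContinuousAt (Prod.map (extChartAt I b₀).symm id) (extChartAt I b₀ b₀, x₀) :=
    (continuousAt_extChartAt_symm b₀).prodMap continuousAt_id
  rw [ContinuousAt, Prod.map_apply, extChartAt_to_inv] at hc
  exact hc.eventually h

variable {F : Type*} [NormedAddCommGroup F] [NormedSpace K F]
  {A : Type*} [NormedAddCommGroup A] [NormedSpace K A]

theorem contMDiffAt_comp_extChartAt [CompleteSpace A] {f : EB × F → A} {b₀ : B} {x₀ : F}
    (hf : AnalyticAt K f (extChartAt I b₀ b₀, x₀)) :
    ContMDiffAt (I.prod 𝓘(K, F)) 𝓘(K, A) ω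
      (fun q : B × F => f (extChartAt I b₀ q.1, q.2)) (b₀, x₀) := by
  have hf' : ContMDiffAt (𝓘(K, EB).prod 𝓘(K, F)) 𝓘(K, A) ω f (extChartAt I b₀ b₀, x₀) := by
    rw [← modelWithCornersSelf_prod, chartedSpaceSelf_prod]
    exact hf.contDiffAt.contMDiffAt
  have hchart : ContMDiffAt (I.prod 𝓘(K, F)) (𝓘(K, EB).prod 𝓘(K, F)) ω
      (Prod.map (extChartAt I b₀) id) (b₀, x₀) :=
    ContMDiffAt.prodMap' (contMDiffAt_extChartAt (x := b₀)) contMDiffAt_id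
  exact ContMDiffAt.comp (b₀, x₀) (g := f) hf' hchart

variable [IsManifold I ω B] [I.Boundaryless]

theorem analyticAt_comp_extChartAt_symm {θ : B × F → A} {b₀ : B} {x₀ : F}
    (hθ : ContMDiffAt (I.prod 𝓘(K, F)) 𝓘(K, A) ω θ (b₀, x₀)) :
    AnalyticAt K (fun z : EB × F => θ ((extChartAt I b₀).symm z.1, z.2))
      (extChartAt I b₀ b₀, x₀) := by
  have hchart : ContMDiffAt (𝓘(K, EB).prod 𝓘(K, F)) (I.prod 𝓘(K, F)) ω
      (Prod.map (extChartAt I b₀).symm id) (extChartAt I b₀ b₀, x₀) :=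
    ((contMDiffOn_extChartAt_symm b₀).contMDiffAt
      (extChartAt_target_mem_nhds (I := I) b₀)).prodMap' contMDiffAt_id
  have hcomp : ContMDiffAt (𝓘(K, EB).prod 𝓘(K, F)) 𝓘(K, A) ω
      (θ ∘ Prod.map (extChartAt I b₀).symm id) (extChartAt I b₀ b₀, x₀) := by
    refine ContMDiffAt.comp _ ?_ hchart
    rwa [Prod.map_apply, extChartAt_to_inv]
  rw [← modelWithCornersSelf_prod, chartedSpaceSelf_prod] at hcomp
  exact hcomp.contDiffAt.analyticAt

variable [IsUltrametricDist K] [CharZero K] [CompleteSpace A]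

theorem exists_contMDiffAt_extDeriv_radialContraction_eq {k : ℕ}
    {θ : B × F → F [⋀^Fin (k + 1)]→L[K] A} {b₀ : B} {x₀ : F}
    (hθ : ContMDiffAt (I.prod 𝓘(K, F)) 𝓘(K, F [⋀^Fin (k + 1)]→L[K] A) ω θ (b₀, x₀))
    (hd : ∀ᶠ q in 𝓝 (b₀, x₀), extDeriv (fun x => θ (q.1, x)) q.2 = 0) :
    ∃ f : B × F → F [⋀^Fin (k + 1)]→L[K] A,
      ContMDiffAt (I.prod 𝓘(K, F)) 𝓘(K, F [⋀^Fin (k + 1)]→L[K] A) ω f (b₀, x₀) ∧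
      (∀ᶠ q in 𝓝 (b₀, x₀), eulerOp (.id K F) (k + 1) x₀ (fun x => f (q.1, x)) q.2 = θ q) ∧
      (∀ᶠ q in 𝓝 (b₀, x₀), extDeriv (radialContraction x₀ fun x => f (q.1, x)) q.2 = θ q) ∧
      ∃ r : ENNReal, 0 < r ∧ ∀ᶠ b in 𝓝 b₀,
        ∃ p : FormalMultilinearSeries K F (F [⋀^Fin (k + 1)]→L[K] A),
          HasFPowerSeriesOnBall (fun x => f (b, x)) p x₀ r := by
  obtain ⟨f, hf, heuler, hderiv⟩ := exists_eventually_extDeriv_radialContraction_eq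
    (analyticAt_comp_extChartAt_symm hθ) (eventually_comp_extChartAt_symm hd)
  obtain ⟨r, hr, hp⟩ := exists_eventually_hasFPowerSeriesOnBall_slice hf
  refine ⟨fun q => f (extChartAt I b₀ q.1, q.2), contMDiffAt_comp_extChartAt hf, ?_, ?_, r, hr,
    (continuousAt_extChartAt b₀).eventually hp⟩
  · filter_upwards [eventually_comp_extChartAt heuler] with q ⟨hq, hsymm⟩
    rwa [hsymm] at hq
  · filter_upwards [eventually_comp_extChartAt hderiv] with q ⟨hq, hsymm⟩
    rwa [hsymm] at hq

theorem eventually_eq_of_fderiv_slice_eq_zero_of_contMDiffAt {θ : B × F → A} {b₀ : B} {x₀ : F}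
    (hθ : ContMDiffAt (I.prod 𝓘(K, F)) 𝓘(K, A) ω θ (b₀, x₀))
    (hd : ∀ᶠ q in 𝓝 (b₀, x₀), fderiv K (fun x => θ (q.1, x)) q.2 = 0) :
    ∀ᶠ q in 𝓝 (b₀, x₀), θ q = θ (q.1, x₀) := by
  have hconst := eventually_eq_of_fderiv_slice_eq_zero (analyticAt_comp_extChartAt_symm hθ)
    (eventually_comp_extChartAt_symm hd)
  filter_upwards [eventually_comp_extChartAt hconst] with q ⟨hq, hsymm⟩
  rwa [hsymm] at hq

end ManifoldParameters

/-! ### Germs of relative forms -/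

section ProductCharts

variable {K : Type*} [NontriviallyNormedField K]
  {F : Type*} [NormedAddCommGroup F] [NormedSpace K F]
  {B : Type*} [TopologicalSpace B] {Y : Type*} [TopologicalSpace Y] [ChartedSpace F Y]

theorem eventually_extChartAt_snd {P : B × F → Prop} {b₀ : B} {y₀ : Y}
    (h : ∀ᶠ q in 𝓝 (b₀, extChartAt 𝓘(K, F) y₀ y₀), P q) :
    ∀ᶠ p : B × Y in 𝓝 (b₀, y₀), P (p.1, extChartAt 𝓘(K, F) y₀ p.2) ∧
      p.2 ∈ (extChartAt 𝓘(K, F) y₀).source := by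
  have hc : ContinuousAt (Prod.map id (extChartAt 𝓘(K, F) y₀)) (b₀, y₀) :=
    continuousAt_id.prodMap (continuousAt_extChartAt y₀)
  exact (hc.eventually h).and (continuousAt_snd.eventually (extChartAt_source_mem_nhds y₀))

theorem eventually_extChartAt_symm_snd {P : B × Y → Prop} {b₀ : B} {y₀ : Y}
    (h : ∀ᶠ p in 𝓝 (b₀, y₀), P p) :
    ∀ᶠ q : B × F in 𝓝 (b₀, extChartAt 𝓘(K, F) y₀ y₀),
      P (q.1, (extChartAt 𝓘(K, F) y₀).symm q.2) ∧ q.2 ∈ (extChartAt 𝓘(K, F) y₀).target := by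
  have hc : ContinuousAt (Prod.map id (extChartAt 𝓘(K, F) y₀).symm)
      (b₀, extChartAt 𝓘(K, F) y₀ y₀) :=
    continuousAt_id.prodMap (continuousAt_extChartAt_symm y₀)
  rw [ContinuousAt, Prod.map_apply, extChartAt_to_inv] at hc
  exact (hc.eventually h).and (continuousAt_snd.eventually
    (extChartAt_target_mem_nhds (I := 𝓘(K, F)) y₀))

theorem contDiffAt_extChartAt_comp_symm [IsManifold 𝓘(K, F) ω Y] {y y₀ : Y}
    (hy : y ∈ (extChartAt 𝓘(K, F) y₀).source) :
    ContDiffAt K ω (extChartAt 𝓘(K, F) y₀ ∘ (extChartAt 𝓘(K, F) y).symm)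
      (extChartAt 𝓘(K, F) y y) := by
  have h := contDiffWithinAt_ext_coord_change (I := 𝓘(K, F)) (n := ω) y₀ y
    (y := extChartAt 𝓘(K, F) y y) (by
      rw [PartialEquiv.trans_source, PartialEquiv.symm_source]
      refine ⟨mem_extChartAt_target y, ?_⟩
      rwa [Set.mem_preimage, extChartAt_to_inv])
  rwa [modelWithCornersSelf_coe, Set.range_id, contDiffWithinAt_univ] at h

end ProductCharts

section AlternatingBasis

variable {K : Type u} [NontriviallyNormedField K] [CompleteSpace K] [CharZero K]
  {F : Type*} [NormedAddCommGroup F] [NormedSpace K F] [FiniteDimensional K F]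
  {W : Type*} [NormedAddCommGroup W] [NormedSpace K W] {k : ℕ}
  {E : Type*} [NormedAddCommGroup E] [NormedSpace K E] {H : Type*} [TopologicalSpace H]
  {I : ModelWithCorners K E H} {M : Type*} [TopologicalSpace M] [ChartedSpace H M]

theorem contMDiffAt_alternating_of_basis {θ : M → F [⋀^Fin k]→L[K] W} {x : M}
    (hθ : ∀ r : Fin k → Fin (Module.finrank K F),
      ContMDiffAt I 𝓘(K, W) ω (fun z => θ z fun i => Module.finBasis K F (r i)) x) :
    ContMDiffAt I 𝓘(K, F [⋀^Fin k]→L[K] W) ω θ x := by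
  have expand : θ = fun z => ∑ r, elemCLM K F r (θ z fun i => Module.finBasis K F (r i)) := by
    funext z
    ext w
    exact alternating_eq_of_basis (θ z).toAlternatingMap .id _ (fun _ => rfl) w
  rw [expand]
  refine ContMDiffAt.sum fun r _ => ?_
  exact (ContinuousLinearMap.contMDiff (elemCLM K F r :
    W →L[K] F [⋀^Fin k]→L[K] W)).contMDiffAt.comp x (hθ r)

theorem contMDiffAt_compContinuousLinearMap {F' : Type*} [NormedAddCommGroup F'] [NormedSpace K F']
    [FiniteDimensional K F'] {θ : M → F [⋀^Fin k]→L[K] W} {A : M → F' →L[K] F} {x : M}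
    (hθ : ContMDiffAt I 𝓘(K, F [⋀^Fin k]→L[K] W) ω θ x)
    (hA : ContMDiffAt I 𝓘(K, F' →L[K] F) ω A x) :
    ContMDiffAt I 𝓘(K, F' [⋀^Fin k]→L[K] W) ω
      (fun z => (θ z).compContinuousLinearMap (A z)) x :=
  contMDiffAt_alternating_of_basis fun r =>
    ContMDiffAt.alternating_apply (a := fun i z => A z (Module.finBasis K F' (r i))) hθ fun _ =>
      hA.clm_apply contMDiffAt_const

end AlternatingBasis

section FormGerms

variable {K : Type u} [NontriviallyNormedField K]
  {V : Type u} [AddCommGroup V] [Module K V]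
  {EB : Type*} [NormedAddCommGroup EB] [NormedSpace K EB] {HB : Type*} [TopologicalSpace HB]
  {I : ModelWithCorners K EB HB} {B : Type*} [TopologicalSpace B] [ChartedSpace HB B]
  {F : Type*} [NormedAddCommGroup F] [NormedSpace K F]
  {Y : Type*} [TopologicalSpace Y] [ChartedSpace F Y] {k : ℕ}

theorem chartForm_congr {η η' : VForm K V F Y k} {y₀ : Y} {x : F}
    (h : η ((extChartAt 𝓘(K, F) y₀).symm x) = η' ((extChartAt 𝓘(K, F) y₀).symm x)) :
    chartForm η y₀ x = chartForm η' y₀ x := by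
  rw [chartForm, chartForm, h]

variable [TopologicalSpace V]

theorem formFDeriv_congr {η η' : F → F [⋀^Fin k]→ₗ[K] V} {x : F} (h : η =ᶠ[𝓝 x] η') :
    formFDeriv η x = formFDeriv η' x := by
  have hiff : IsFormFDeriv η x = IsFormFDeriv η' x := by
    funext D
    refine propext (forall_congr' fun w => exists_congr fun A => and_congr_left fun _ => ?_)
    exact (h.fun_comp fun a => a w).hasFDerivAt_iff
  unfold formFDeriv
  congr!

theorem formD_congr {η η' : VForm K V F Y k} {y : Y} (h : ∀ᶠ z in 𝓝 y, η z = η' z) :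
    formD η y = formD η' y := by
  have hc := continuousAt_extChartAt_symm (I := 𝓘(K, F)) y
  rw [ContinuousAt, extChartAt_to_inv] at hc
  have hchart : chartForm η y =ᶠ[𝓝 (extChartAt 𝓘(K, F) y y)] chartForm η' y :=
    (hc.eventually h).mono fun x hx => chartForm_congr hx
  change vExtDeriv _ _ = vExtDeriv _ _
  rw [vExtDeriv, vExtDeriv, formFDeriv_congr hchart]

theorem LocalRep.congr_nhds {η η' : B → VForm K V F Y k} {b₀ : B} {y₀ : Y} {W : BHSpace K V}
    {θ : B × F → F [⋀^Fin k]→L[K] W.carrier} (h : LocalRep I η b₀ y₀ W θ)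
    (he : ∀ᶠ p : B × Y in 𝓝 (b₀, y₀), η' p.1 p.2 = η p.1 p.2) : LocalRep I η' b₀ y₀ W θ := by
  refine ⟨h.1, ?_⟩
  filter_upwards [h.2, eventually_extChartAt_symm_snd he] with q hq hη w
  rw [chartForm_congr hη.1, hq w]

variable [IsManifold 𝓘(K, F) ω Y]

/-- The form on `Y` which reads `α` in the preferred chart at `y₀`. Outside the domain of that
chart its values are junk. -/
def formOfChart (y₀ : Y) (α : F → F [⋀^Fin k]→ₗ[K] V) : VForm K V F Y k := fun y =>
  (α (extChartAt 𝓘(K, F) y₀ y)).compLinearMap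
    (tangentCoordChange 𝓘(K, F) y y₀ y : F →L[K] F).toLinearMap

theorem chartForm_formOfChart (y₀ : Y) (α : F → F [⋀^Fin k]→ₗ[K] V) {x : F}
    (hx : x ∈ (extChartAt 𝓘(K, F) y₀).target) : chartForm (formOfChart y₀ α) y₀ x = α x := by
  ext w
  have hs := (extChartAt 𝓘(K, F) y₀).map_target hx
  rw [chartForm_apply, mfderiv_extChartAt_symm_eq hx]
  change α (extChartAt 𝓘(K, F) y₀ ((extChartAt 𝓘(K, F) y₀).symm x)) _ = _
  rw [(extChartAt 𝓘(K, F) y₀).right_inv hx]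
  congr 1
  funext i
  refine (tangentCoordChange_comp ⟨⟨hs, mem_extChartAt_source _⟩, hs⟩).trans ?_
  exact tangentCoordChange_self hs

theorem VForm.apply_eq_chartForm (η : VForm K V F Y k) {y₀ y : Y}
    (hy : y ∈ (extChartAt 𝓘(K, F) y₀).source) (v : Fin k → F) :
    (η y : F [⋀^Fin k]→ₗ[K] V) v = chartForm η y₀ (extChartAt 𝓘(K, F) y₀ y)
      fun i => tangentCoordChange 𝓘(K, F) y y₀ y (v i) := by
  rw [chartForm_apply, mfderiv_extChartAt_symm_eq ((extChartAt 𝓘(K, F) y₀).map_source hy)]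
  -- `η z` has a type depending on `z`, so the inverse chart is eliminated through a variable.
  suffices h : ∀ z, z = y → (η y : F [⋀^Fin k]→ₗ[K] V) v =
      (η z : F [⋀^Fin k]→ₗ[K] V) fun i =>
        tangentCoordChange 𝓘(K, F) y₀ z z (tangentCoordChange 𝓘(K, F) y y₀ y (v i)) from
    h _ ((extChartAt 𝓘(K, F) y₀).left_inv hy)
  rintro z rfl
  congr 1
  funext i
  refine ((tangentCoordChange_comp ⟨⟨mem_extChartAt_source _, hy⟩,
    mem_extChartAt_source _⟩).trans ?_).symm
  exact tangentCoordChange_self (mem_extChartAt_source _)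

theorem VForm.eq_of_chartForm_eq {η η' : VForm K V F Y k} {y₀ y : Y}
    (hy : y ∈ (extChartAt 𝓘(K, F) y₀).source)
    (h : chartForm η y₀ (extChartAt 𝓘(K, F) y₀ y) = chartForm η' y₀ (extChartAt 𝓘(K, F) y₀ y)) :
    η y = η' y := by
  ext v
  exact (η.apply_eq_chartForm hy v).trans (h ▸ (η'.apply_eq_chartForm hy v).symm)

variable [CompleteSpace K] [FiniteDimensional K F] [CharZero K]
  [IsTopologicalAddGroup V] [ContinuousSMul K V] [T2Space V]

theorem LocalRep.of_mem_chart_source {η : B → VForm K V F Y k} {b : B} {y₀ y : Y}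
    {W : BHSpace K V} {θ : B × F → F [⋀^Fin k]→L[K] W.carrier}
    (hy : y ∈ (extChartAt 𝓘(K, F) y₀).source)
    (hθ : ContMDiffAt (I.prod 𝓘(K, F)) 𝓘(K, F [⋀^Fin k]→L[K] W.carrier) ω θ
      (b, extChartAt 𝓘(K, F) y₀ y))
    (hη : ∀ᶠ q in 𝓝 (b, extChartAt 𝓘(K, F) y₀ y), ∀ w,
      chartForm (η q.1) y₀ q.2 w = W.incl (θ q w)) :
    let ψ := extChartAt 𝓘(K, F) y₀ ∘ (extChartAt 𝓘(K, F) y).symm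
    LocalRep I η b y W fun q =>
      (θ (q.1, ψ q.2)).compContinuousLinearMap (fderiv K ψ q.2) := by
  intro ψ
  have hψ : ContDiffAt K ω ψ (extChartAt 𝓘(K, F) y y) := contDiffAt_extChartAt_comp_symm hy
  have hψy : ψ (extChartAt 𝓘(K, F) y y) = extChartAt 𝓘(K, F) y₀ y :=
    congrArg (extChartAt 𝓘(K, F) y₀) (extChartAt_to_inv y)
  have hψ_snd : ContMDiffAt (I.prod 𝓘(K, F)) (I.prod 𝓘(K, F)) ω (Prod.map id ψ)
      (b, extChartAt 𝓘(K, F) y y) := contMDiffAt_id.prodMap' hψ.contMDiffAt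
  rw [← hψy] at hθ hη
  refine ⟨contMDiffAt_compContinuousLinearMap
    (ContMDiffAt.comp (b, extChartAt 𝓘(K, F) y y) (g := θ) hθ hψ_snd) ?_, ?_⟩
  · exact ContMDiffAt.comp (b, extChartAt 𝓘(K, F) y y) (g := fderiv K ψ)
      (hψ.fderiv_right (m := ω) (by simp)).contMDiffAt contMDiffAt_snd
  · have hsource : ∀ᶠ p : B × Y in 𝓝 (b, y), p.2 ∈ (extChartAt 𝓘(K, F) y₀).source :=
      continuousAt_snd.eventually ((isOpen_extChartAt_source y₀).mem_nhds hy)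
    filter_upwards [hψ_snd.continuousAt.eventually hη, eventually_extChartAt_symm_snd hsource]
      with q hq ⟨hqs, hqt⟩ w
    rw [chartForm_change (η q.1) hqt hqs]
    exact hq _

theorem LocalRep.eventually_exists [IsManifold I ω B] {η : B → VForm K V F Y k} {b₀ : B} {y₀ : Y}
    {W : BHSpace K V} {θ : B × F → F [⋀^Fin k]→L[K] W.carrier} (h : LocalRep I η b₀ y₀ W θ) :
    ∀ᶠ p : B × Y in 𝓝 (b₀, y₀), ∃ θ', LocalRep I η p.1 p.2 W θ' := by
  have hθ := (contMDiffAt_iff_contMDiffAt_nhds (by simp)).1 h.1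
  filter_upwards [eventually_extChartAt_snd (hθ.and h.2.eventually_nhds)]
    with p ⟨⟨hpθ, hpη⟩, hp⟩
  exact ⟨_, LocalRep.of_mem_chart_source hp hpθ hpη⟩

end FormGerms

/-! ### Translation by the group -/

section Translation

variable {K : Type u} [NontriviallyNormedField K]
  {V : Type u} [AddCommGroup V] [Module K V] [TopologicalSpace V]

/-- The image of a BH-space under a continuous linear automorphism of `V`. It has the same
underlying Banach space; only the inclusion changes. -/
def BHSpace.map (A : V ≃L[K] V) (W : BHSpace K V) : BHSpace K V where
  carrier := W.carrier
  incl := (A : V →L[K] V) ∘L W.incl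
  injective := A.injective.comp W.injective

variable
  {EG : Type*} [NormedAddCommGroup EG] [NormedSpace K EG] {HG : Type*} [TopologicalSpace HG]
  {IG : ModelWithCorners K EG HG}
  {G : Type*} [Group G] [TopologicalSpace G] [ChartedSpace HG G]
  {ρ : G →* (V ≃L[K] V)}
  {EB : Type*} [NormedAddCommGroup EB] [NormedSpace K EB] {HB : Type*} [TopologicalSpace HB]
  {I : ModelWithCorners K EB HB} {B : Type*} [TopologicalSpace B] [ChartedSpace HB B]
  {F : Type*} [NormedAddCommGroup F] [NormedSpace K F]
  {Y : Type*} [TopologicalSpace Y] [ChartedSpace F Y] {k : ℕ}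

theorem LocalRep.of_hatForm {η : B → VForm K V F Y k} {b₀ : B} {y₀ : Y} {W : BHSpace K V}
    {θ : (G × B) × F → F [⋀^Fin k]→L[K] W.carrier}
    (h : LocalRep (IG.prod I) (hatForm ρ η) (1, b₀) y₀ W θ) :
    LocalRep I η b₀ y₀ W fun q => θ ((1, q.1), q.2) := by
  have hatForm_one : (fun b => hatForm ρ η (1, b)) = η := by
    funext b y
    ext v
    simp [hatForm]
  have hslice := LocalRep.comp (φ := fun b : B => ((1 : G), b)) h
    (contMDiffAt_const.prodMk contMDiffAt_id)
  rwa [hatForm_one] at hslice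

variable [LieGroup IG ω G]

theorem LocalRep.translate {η : B → VForm K V F Y k} {b₀ : B} {y₀ : Y} {W : BHSpace K V}
    {θ : (G × B) × F → F [⋀^Fin k]→L[K] W.carrier}
    (h : LocalRep (IG.prod I) (hatForm ρ η) (1, b₀) y₀ W θ) (g : G) :
    LocalRep (IG.prod I) (hatForm ρ η) (g, b₀) y₀ (W.map (ρ g))
      fun q => θ ((g⁻¹ * q.1.1, q.1.2), q.2) := by
  have hφ : ContMDiffAt (IG.prod I) (IG.prod I) ω (Prod.map (g⁻¹ * ·) id) (g, b₀) :=
    (contMDiff_mul_left (a := g⁻¹)).contMDiffAt.prodMap' contMDiffAt_id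
  have hcomp : LocalRep (IG.prod I) (fun p : G × B => hatForm ρ η (g⁻¹ * p.1, p.2)) (g, b₀) y₀ W
      fun q => θ ((g⁻¹ * q.1.1, q.1.2), q.2) := by
    refine LocalRep.comp (φ := Prod.map (g⁻¹ * ·) id) ?_ hφ
    rwa [Prod.map_apply, inv_mul_cancel]
  refine ⟨hcomp.1, ?_⟩
  filter_upwards [hcomp.2] with q hq w
  have hρ : ρ q.1.1 = ρ g * ρ (g⁻¹ * q.1.1) := by rw [← map_mul, mul_inv_cancel_left]
  refine Eq.trans ?_ (congrArg (ρ g) (hq w))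
  change ρ q.1.1 _ = ρ g (ρ (g⁻¹ * q.1.1) _)
  rw [hρ]
  rfl

theorem isAdmissibleForm_of_localRep_one [CompleteSpace K] [FiniteDimensional K F]
    [IsManifold I ω B] [IsManifold 𝓘(K, F) ω Y] {η : B → VForm K V F Y k}
    (h : ∀ b y, ∃ W θ, LocalRep (IG.prod I) (hatForm ρ η) ((1 : G), b) y W θ) :
    IsAdmissibleForm IG ρ I η := by
  refine ⟨isAnalyticForm_of_localRep fun b y => ?_, isAnalyticForm_of_localRep fun p y => ?_⟩
  · obtain ⟨W, θ, hθ⟩ := h b y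
    exact ⟨W, _, hθ.of_hatForm⟩
  · obtain ⟨W, θ, hθ⟩ := h p.2 y
    exact ⟨_, _, hθ.translate p.1⟩

end Translation

/-! ### Admissible primitives -/

section EulerEquivariance

variable {K : Type u} [NontriviallyNormedField K] [IsUltrametricDist K] [CharZero K]
  {V : Type u} [AddCommGroup V] [Module K V] [TopologicalSpace V] [IsTopologicalAddGroup V]
  [T2Space V]
  {F : Type*} [NormedAddCommGroup F] [NormedSpace K F]

theorem BHSpace.incl_eq_of_eventually_eulerOp {W₁ W₂ : BHSpace K V}
    {f₁ : F → W₁.carrier} {f₂ : F → W₂.carrier}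
    {p₁ : FormalMultilinearSeries K F W₁.carrier} {p₂ : FormalMultilinearSeries K F W₂.carrier}
    {x₀ : F} {r : ENNReal}
    (h₁ : HasFPowerSeriesOnBall f₁ p₁ x₀ r) (h₂ : HasFPowerSeriesOnBall f₂ p₂ x₀ r)
    {c : ℕ} (hc : c ≠ 0)
    (he : ∀ᶠ x in 𝓝 x₀, W₁.incl (eulerOp (.id K F) c x₀ f₁ x) =
      W₂.incl (eulerOp (.id K F) c x₀ f₂ x))
    {x : F} (hx : x ∈ Metric.eball x₀ r) : W₁.incl (f₁ x) = W₂.incl (f₂ x) := by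
  obtain ⟨W, j, hj⟩ := exists_bhSpace_sum fun b : Bool => cond b W₁ W₂
  let j₁ : W₁.carrier →L[K] W.carrier := j true
  let j₂ : W₂.carrier →L[K] W.carrier := j false
  have hj₁ : ∀ w, W.incl (j₁ w) = W₁.incl w := hj true
  have hj₂ : ∀ w, W.incl (j₂ w) = W₂.incl w := hj false
  have heq := eqOn_of_eventually_eulerOp_eq (j₁.comp_hasFPowerSeriesOnBall h₁)
    (j₂.comp_hasFPowerSeriesOnBall h₂) hc (by
      filter_upwards [he, h₁.analyticAt.eventually_analyticAt,
        h₂.analyticAt.eventually_analyticAt] with z hz hz₁ hz₂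
      rw [eulerOp_clm_comp _ _ _ _ hz₁.differentiableAt,
        eulerOp_clm_comp _ _ _ _ hz₂.differentiableAt]
      apply W.injective
      rw [hj₁, hj₂, hz]) hx
  rw [← hj₁, ← hj₂]
  exact congrArg W.incl heq

theorem BHSpace.eventually_equivariant_of_eulerOp {T : Type*} [TopologicalSpace T] {a₀ : T}
    {π : T → T} (hπ : Filter.Tendsto π (𝓝 a₀) (𝓝 a₀)) (A : T → V ≃L[K] V) (W : BHSpace K V) {k : ℕ}
    {f : T × F → F [⋀^Fin k]→L[K] W.carrier} {x₀ : F} {r : ENNReal} (hr : 0 < r)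
    (hf : ∀ᶠ a in 𝓝 a₀, ∃ p : FormalMultilinearSeries K F (F [⋀^Fin k]→L[K] W.carrier),
      HasFPowerSeriesOnBall (fun x => f (a, x)) p x₀ r)
    {c : ℕ} (hc : c ≠ 0)
    (he : ∀ᶠ q in 𝓝 (a₀, x₀), ∀ w,
      A q.1 (W.incl (eulerOp (.id K F) c x₀ (fun x => f (π q.1, x)) q.2 w)) =
        W.incl (eulerOp (.id K F) c x₀ (fun x => f (q.1, x)) q.2 w)) :
    ∀ᶠ q in 𝓝 (a₀, x₀), ∀ w, A q.1 (W.incl (f (π q.1, q.2) w)) = W.incl (f q w) := by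
  have on_ball : ∀ᶠ a in 𝓝 a₀, ∀ x ∈ Metric.eball x₀ r, ∀ w,
      A a (W.incl (f (π a, x) w)) = W.incl (f (a, x) w) := by
    rw [nhds_prod_eq] at he
    filter_upwards [he.curry, hf, hπ.eventually hf] with a hea ⟨p, hp⟩ ⟨p', hp'⟩ x hx w
    let ev : (F [⋀^Fin k]→L[K] W.carrier) →L[K] W.carrier :=
      ContinuousAlternatingMap.apply K F W.carrier w
    refine BHSpace.incl_eq_of_eventually_eulerOp (W₁ := W.map (A a)) (W₂ := W)
      (ev.comp_hasFPowerSeriesOnBall hp') (ev.comp_hasFPowerSeriesOnBall hp) hc ?_ hx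
    filter_upwards [hea, hp.analyticAt.eventually_analyticAt,
      hp'.analyticAt.eventually_analyticAt] with z hz hpz hpz'
    refine (congrArg (W.map (A a)).incl
      (eulerOp_clm_comp _ _ _ ev hpz'.differentiableAt)).trans ((hz w).trans ?_)
    exact congrArg W.incl (eulerOp_clm_comp _ _ _ ev hpz.differentiableAt).symm
  rw [nhds_prod_eq]
  filter_upwards [on_ball.prod_mk (Metric.eball_mem_nhds x₀ hr)] with q ⟨hq, hqr⟩
  exact hq q.2 hqr

end EulerEquivariance

section HatForm

variable {K : Type u} [NontriviallyNormedField K]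
  {V : Type u} [AddCommGroup V] [Module K V] [TopologicalSpace V]
  {G : Type*} [Group G] {ρ : G →* (V ≃L[K] V)} {B : Type*}
  {F : Type*} [NormedAddCommGroup F] [NormedSpace K F]
  {Y : Type*} [TopologicalSpace Y] [ChartedSpace F Y] {k : ℕ}

theorem chartForm_hatForm (η : B → VForm K V F Y k) (a : G × B) (y₀ : Y) (x : F) (w : Fin k → F) :
    chartForm (hatForm ρ η a) y₀ x w = ρ a.1 (chartForm (η a.2) y₀ x w) :=
  rfl

variable
  {EB : Type*} [NormedAddCommGroup EB] [NormedSpace K EB] {HB : Type*} [TopologicalSpace HB]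
  {I : ModelWithCorners K EB HB} [TopologicalSpace B] [ChartedSpace HB B]
  [IsTopologicalAddGroup V] [ContinuousSMul K V] [T2Space V] [CompleteSpace K] [CharZero K]
  [FiniteDimensional K F] [IsManifold I ω B] [IsManifold 𝓘(K, F) ω Y]

theorem IsAnalyticForm.formD_hatForm_eq_zero {η : B → VForm K V F Y k} (hη : IsAnalyticForm I η)
    (hd : ∀ b, _root_.formD (η b) = 0) (a : G × B) : _root_.formD (hatForm ρ η a) = 0 := by
  refine (hη.formD_clm (ρ a.1 : V →L[K] V) a.2).trans ?_
  rw [hd]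
  funext y
  ext
  exact map_zero (ρ a.1)

end HatForm

section AdmissiblePrimitives

variable {K : Type u} [NontriviallyNormedField K]
  {V : Type u} [AddCommGroup V] [Module K V] [TopologicalSpace V]
  {G : Type*} [Group G] [TopologicalSpace G] {ρ : G →* (V ≃L[K] V)} {B : Type*}
  {F : Type*} [NormedAddCommGroup F] [NormedSpace K F]
  {Y : Type*} [TopologicalSpace Y] [ChartedSpace F Y] {k : ℕ}
  {EB : Type*} [NormedAddCommGroup EB] [NormedSpace K EB] {HB : Type*} [TopologicalSpace HB]
  {I : ModelWithCorners K EB HB} [TopologicalSpace B] [ChartedSpace HB B]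

theorem LocalRep.eventually_eq [IsManifold 𝓘(K, F) ω Y] {η η' : B → VForm K V F Y k} {b₀ : B}
    {y₀ : Y} {W : BHSpace K V} {θ θ' : B × F → F [⋀^Fin k]→L[K] W.carrier}
    (h : LocalRep I η b₀ y₀ W θ) (h' : LocalRep I η' b₀ y₀ W θ')
    (hθ : ∀ᶠ q in 𝓝 (b₀, extChartAt 𝓘(K, F) y₀ y₀), θ q = θ' q) :
    ∀ᶠ p : B × Y in 𝓝 (b₀, y₀), η p.1 p.2 = η' p.1 p.2 := by
  filter_upwards [eventually_extChartAt_snd (h.2.and (h'.2.and hθ))] with p ⟨⟨hp, hp', hpθ⟩, hpy⟩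
  refine VForm.eq_of_chartForm_eq hpy ?_
  ext w
  rw [hp w, hp' w, hpθ]

theorem tendsto_one_snd_prodMk (b₀ : B) (x₀ : F) :
    Filter.Tendsto (fun q : (G × B) × F => (((1 : G), q.1.2), q.2)) (𝓝 ((1, b₀), x₀))
      (𝓝 ((1, b₀), x₀)) :=
  Continuous.tendsto' (by fun_prop) _ _ rfl

variable
  {EG : Type*} [NormedAddCommGroup EG] [NormedSpace K EG] {HG : Type*} [TopologicalSpace HG]
  {IG : ModelWithCorners K EG HG} [ChartedSpace HG G]

theorem LocalRep.eventually_equivariant {η : B → VForm K V F Y k} {b₀ : B} {y₀ : Y}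
    {W : BHSpace K V} {θ : (G × B) × F → F [⋀^Fin k]→L[K] W.carrier}
    (h : LocalRep (IG.prod I) (hatForm ρ η) (1, b₀) y₀ W θ) :
    ∀ᶠ q in 𝓝 (((1 : G), b₀), extChartAt 𝓘(K, F) y₀ y₀), ∀ w,
      ρ q.1.1 (W.incl (θ ((1, q.1.2), q.2) w)) = W.incl (θ q w) := by
  filter_upwards [h.2, (tendsto_one_snd_prodMk b₀ _).eventually h.2] with q hq hq1 w
  rw [← hq, ← hq1, chartForm_hatForm, chartForm_hatForm, map_one]
  rfl

theorem localRep_hatForm_formOfChart [IsManifold 𝓘(K, F) ω Y] {b₀ : B} {y₀ : Y}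
    {W : BHSpace K V} {α : (G × B) × F → F [⋀^Fin k]→L[K] W.carrier}
    (hα : ContMDiffAt ((IG.prod I).prod 𝓘(K, F)) 𝓘(K, F [⋀^Fin k]→L[K] W.carrier) ω α
      ((1, b₀), extChartAt 𝓘(K, F) y₀ y₀))
    (hequiv : ∀ᶠ q in 𝓝 (((1 : G), b₀), extChartAt 𝓘(K, F) y₀ y₀), ∀ w,
      ρ q.1.1 (W.incl (α ((1, q.1.2), q.2) w)) = W.incl (α q w)) :
    LocalRep (IG.prod I) (hatForm ρ fun b => formOfChart y₀ fun x =>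
      W.incl.toLinearMap.compAlternatingMap (α ((1, b), x)).toAlternatingMap) (1, b₀) y₀ W α := by
  refine ⟨hα, ?_⟩
  filter_upwards [hequiv,
    continuousAt_snd.eventually (extChartAt_target_mem_nhds (I := 𝓘(K, F)) y₀)] with q hq hqt w
  rw [chartForm_hatForm, chartForm_formOfChart y₀ _ hqt]
  exact hq w

theorem contMDiffAt_radialContraction {W : Type*} [NormedAddCommGroup W] [NormedSpace K W]
    {f : B × F → F [⋀^Fin (k + 1)]→L[K] W} {b₀ : B} {x₀ : F}
    (hf : ContMDiffAt (I.prod 𝓘(K, F)) 𝓘(K, F [⋀^Fin (k + 1)]→L[K] W) ω f (b₀, x₀)) :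
    ContMDiffAt (I.prod 𝓘(K, F)) 𝓘(K, F [⋀^Fin k]→L[K] W) ω
      (fun q => radialContraction x₀ (fun x => f (q.1, x)) q.2) (b₀, x₀) := by
  let C : (F [⋀^Fin (k + 1)]→L[K] W) →L[K] (F →L[K] F [⋀^Fin k]→L[K] W) :=
    (ContinuousAlternatingMap.curryLeftLI (𝕜 := K) (E := F) (F := W)
      (n := k)).toContinuousLinearMap
  have hC : ContMDiffAt (I.prod 𝓘(K, F)) 𝓘(K, F →L[K] F [⋀^Fin k]→L[K] W) ω
      (fun q => C (f q)) (b₀, x₀) := contMDiffAt_const.clm_apply hf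
  exact hC.clm_apply (contMDiffAt_snd.sub contMDiffAt_const)

variable [IsTopologicalAddGroup V] [ContinuousSMul K V] [T2Space V]
  [IsManifold I ω B]
  [IsManifold 𝓘(K, F) ω Y]

theorem LocalRep.eventually_extDeriv_eq_zero {η : B → VForm K V F Y k} {b₀ : B} {y₀ : Y}
    {W : BHSpace K V} {θ : B × F → F [⋀^Fin k]→L[K] W.carrier} (h : LocalRep I η b₀ y₀ W θ)
    (hd : ∀ b, _root_.formD (η b) = 0) :
    ∀ᶠ q in 𝓝 (b₀, extChartAt 𝓘(K, F) y₀ y₀), extDeriv (fun x => θ (q.1, x)) q.2 = 0 := by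
  filter_upwards [h.formD.2] with q hq
  ext w
  apply W.injective
  rw [← hq w, hd]
  exact (map_zero W.incl).symm

variable [CompleteSpace K] [CharZero K] [FiniteDimensional K F] [IsUltrametricDist K]
  [IG.Boundaryless] [I.Boundaryless] [LieGroup IG ω G]

theorem IsAdmissibleForm.exists_local_primitive {η : B → VForm K V F Y (k + 1)}
    (hη : IsAdmissibleForm IG ρ I η) (hd : ∀ b, _root_.formD (η b) = 0) (b₀ : B) (y₀ : Y) :
    ∃ ζ : B → VForm K V F Y k, ∀ᶠ p : B × Y in 𝓝 (b₀, y₀),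
      (∃ W θ, LocalRep (IG.prod I) (hatForm ρ ζ) ((1 : G), p.1) p.2 W θ) ∧
        _root_.formD (ζ p.1) p.2 = η p.1 p.2 := by
  obtain ⟨W, θ, hθ⟩ := hη.2.exists_localRep ((1 : G), b₀) y₀
  set x₀ := extChartAt 𝓘(K, F) y₀ y₀
  obtain ⟨f, hf, heuler, hderiv, r, hr, hp⟩ :=
    exists_contMDiffAt_extDeriv_radialContraction_eq hθ.1
      (hθ.eventually_extDeriv_eq_zero (hη.1.formD_hatForm_eq_zero hd))
  have f_equivariant : ∀ᶠ q : (G × B) × F in 𝓝 (((1 : G), b₀), x₀), ∀ w,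
      ρ q.1.1 (W.incl (f ((1, q.1.2), q.2) w)) = W.incl (f q w) := by
    refine W.eventually_equivariant_of_eulerOp (π := fun a : G × B => (1, a.2))
      (Continuous.tendsto' (by fun_prop) _ _ rfl) (fun a => ρ a.1) hr hp (Nat.succ_ne_zero k) ?_
    filter_upwards [hθ.eventually_equivariant, heuler,
      (tendsto_one_snd_prodMk b₀ x₀).eventually heuler] with q hq hfq hfq1 w
    rw [hfq, hfq1, hq]
  have hζ := localRep_hatForm_formOfChart (contMDiffAt_radialContraction hf)
    (f_equivariant.mono fun q hq w => hq _)
  have one_nhds : Filter.Tendsto (fun q : B × F => (((1 : G), q.1), q.2)) (𝓝 (b₀, x₀))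
      (𝓝 ((1, b₀), x₀)) := Continuous.tendsto' (by fun_prop) _ _ rfl
  have one_nhds' : Filter.Tendsto (fun p : B × Y => (((1 : G), p.1), p.2)) (𝓝 (b₀, y₀))
      (𝓝 ((1, b₀), y₀)) := Continuous.tendsto' (by fun_prop) _ _ rfl
  have formD_ζ := hζ.of_hatForm.formD.eventually_eq hθ.of_hatForm (one_nhds.eventually hderiv)
  refine ⟨fun b => formOfChart y₀ fun x => W.incl.toLinearMap.compAlternatingMap
    (radialContraction x₀ (fun z => f ((1, b), z)) x).toAlternatingMap, ?_⟩
  filter_upwards [one_nhds'.eventually hζ.eventually_exists, formD_ζ] with p hp hpd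
  exact ⟨⟨W, hp⟩, hpd⟩

theorem IsAdmissibleForm.exists_primitive (hT : HasOpenPartitions (B × Y))
    {η : B → VForm K V F Y (k + 1)} (hη : IsAdmissibleForm IG ρ I η)
    (hd : ∀ b, _root_.formD (η b) = 0) :
    ∃ ζ : B → VForm K V F Y k, IsAdmissibleForm IG ρ I ζ ∧ ∀ b, _root_.formD (ζ b) = η b := by
  choose ζ hζ using fun p : B × Y => hη.exists_local_primitive hd p.1 p.2
  obtain ⟨s, hs, hN⟩ := hT _ hζ
  refine ⟨fun b y => ζ (s (b, y)) b y, isAdmissibleForm_of_localRep_one fun b y => ?_,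
    fun b => funext fun y => ?_⟩
  · obtain ⟨W, θ, h⟩ := (hN (b, y)).1
    refine ⟨W, θ, h.congr_nhds ?_⟩
    have hc : ContinuousAt (fun p : (G × B) × Y => (p.1.2, p.2)) (((1 : G), b), y) := by fun_prop
    filter_upwards [hc.eventually (hs.eventually_eq (b, y))] with p hp
    simp only [hatForm, hp]
  · refine (formD_congr (η' := ζ (s (b, y)) b) ?_).trans (hN (b, y)).2
    have hc : ContinuousAt (fun z : Y => (b, z)) y := by fun_prop
    filter_upwards [hc.eventually (hs.eventually_eq (b, y))] with z hz
    rw [hz]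

end AdmissiblePrimitives

section DegreeZero

theorem fderiv_eq_zero_of_extDeriv_eq_zero {K E W : Type*} [NontriviallyNormedField K]
    [NormedAddCommGroup E] [NormedSpace K E] [NormedAddCommGroup W] [NormedSpace K W]
    {f : E → E [⋀^Fin 0]→L[K] W} {x : E} (h : extDeriv f x = 0) : fderiv K f x = 0 := by
  ext v w
  have hv := congrArg (fun a => a fun _ => v) h
  simp only [extDeriv, ContinuousAlternatingMap.alternatizeUncurryFin_apply] at hv
  rw [Subsingleton.elim w (Fin.removeNth 0 fun _ => v)]
  simpa using hv

variable {K : Type u} [NontriviallyNormedField K]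
  {V : Type u} [AddCommGroup V] [Module K V] [TopologicalSpace V]
  {EB : Type*} [NormedAddCommGroup EB] [NormedSpace K EB] {HB : Type*} [TopologicalSpace HB]
  {I : ModelWithCorners K EB HB} {B : Type*} [TopologicalSpace B] [ChartedSpace HB B]
  {F : Type*} [NormedAddCommGroup F] [NormedSpace K F]
  {Y : Type*} [TopologicalSpace Y] [ChartedSpace F Y]
  [IsManifold I ω B] [IsManifold 𝓘(K, F) ω Y]

theorem IsAdmissibleForm.isAdmissible_apply_zero
    {EG : Type*} [NormedAddCommGroup EG] [NormedSpace K EG] {HG : Type*} [TopologicalSpace HG]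
    {IG : ModelWithCorners K EG HG} {G : Type*} [Group G] [TopologicalSpace G] [ChartedSpace HG G]
    [IsManifold IG ω G] {ρ : G →* (V ≃L[K] V)} {η : B → VForm K V F Y 0}
    (hη : IsAdmissibleForm IG ρ I η) :
    IsAdmissible IG ρ (I.prod 𝓘(K, F)) fun p : B × Y => η p.1 p.2 0 := by
  refine ⟨fun p => ?_, fun p => ?_⟩
  · refine (hη.1 Set.univ isOpen_univ (fun i => i.elim0) (fun i => i.elim0) p trivial).congr ?_
    exact Filter.Eventually.of_forall fun q => congrArg _ (Subsingleton.elim _ _)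
  · have reassoc : ContMDiffAt (IG.prod (I.prod 𝓘(K, F))) ((IG.prod I).prod 𝓘(K, F)) ω
        (fun q : G × (B × Y) => ((q.1, q.2.1), q.2.2)) p :=
      (contMDiffAt_fst.prodMk (contMDiffAt_fst.comp p contMDiffAt_snd)).prodMk
        (contMDiffAt_snd.comp p contMDiffAt_snd)
    have hat_analytic := hη.2 Set.univ isOpen_univ (fun i => i.elim0) (fun i => i.elim0)
      ((p.1, p.2.1), p.2.2) trivial
    refine (VAnalyticAt.comp (φ := fun q : G × (B × Y) => ((q.1, q.2.1), q.2.2))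
      hat_analytic reassoc).congr ?_
    exact Filter.Eventually.of_forall fun q =>
      congrArg (fun v => ρ q.1 (η q.2.1 q.2.2 v)) (Subsingleton.elim _ _)

variable [IsUltrametricDist K] [CompleteSpace K] [CharZero K] [FiniteDimensional K F]
  [IsTopologicalAddGroup V] [ContinuousSMul K V] [T2Space V] [I.Boundaryless]

theorem IsAnalyticForm.isLocConstAlong {η : B → VForm K V F Y 0} (hη : IsAnalyticForm I η)
    (hd : ∀ b, _root_.formD (η b) = 0) : IsLocConstAlong fun b y => η b y 0 := by
  intro b₀ y₀
  obtain ⟨W, θ, hθ⟩ := hη.exists_localRep b₀ y₀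
  have θ_const := eventually_eq_of_fderiv_slice_eq_zero_of_contMDiffAt hθ.1
    ((hθ.eventually_extDeriv_eq_zero hd).mono fun _ => fderiv_eq_zero_of_extDeriv_eq_zero)
  have η_const : ∀ᶠ p : B × Y in 𝓝 (b₀, y₀),
      η p.1 p.2 0 = W.incl (θ (p.1, extChartAt 𝓘(K, F) y₀ y₀) 0) := by
    filter_upwards [eventually_extChartAt_snd (hθ.2.and θ_const)] with p ⟨⟨hp, hpθ⟩, hpy⟩
    rw [← hpθ, ← hp]
    exact ((η p.1).apply_eq_chartForm hpy 0).trans (congrArg _ (Subsingleton.elim _ _))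
  rw [nhds_prod_eq] at η_const
  obtain ⟨N, hN, N', hN', h⟩ := Filter.mem_prod_iff.1 η_const
  refine ⟨N, hN, N', hN', fun b hb y₁ h₁ y₂ h₂ => ?_⟩
  exact (h (Set.mk_mem_prod hb h₁)).trans (h (Set.mk_mem_prod hb h₂)).symm

end DegreeZero

end

theorem mainTheorem6_general
    {K : Type u} [NontriviallyNormedField K] [IsUltrametricDist K] [CompleteSpace K] [CharZero K]
    {V : Type u} [AddCommGroup V] [Module K V] [TopologicalSpace V] [IsTopologicalAddGroup V]
    [ContinuousSMul K V] [T2Space V]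
    {EG : Type*} [NormedAddCommGroup EG] [NormedSpace K EG] {HG : Type*} [TopologicalSpace HG]
    (IG : ModelWithCorners K EG HG) [IG.Boundaryless]
    {G : Type*} [Group G] [TopologicalSpace G] [ChartedSpace HG G] [LieGroup IG ω G]
    (ρ : G →* (V ≃L[K] V)) (Y : LaMan K) :
    QuasiIso (deRhamInclusion IG ρ Y) := by
  refine quasiIso_deRhamInclusion (fun X s hs hd => ?_) fun k X s hs hd => ?_
  · refine ⟨fun x y => s x y 0, ⟨IsAdmissibleForm.isAdmissible_apply_zero hs,
      IsAnalyticForm.isLocConstAlong hs.1 hd⟩, fun x => ?_⟩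
    funext y
    ext v
    exact congrArg (s x y) (Subsingleton.elim 0 v)
  · exact IsAdmissibleForm.exists_primitive
      (hasOpenPartitions_prod (M := Fin X.dim → K) (M' := Fin Y.dim → K)) hs hd

theorem mainTheorem6
    {K : Type u} [NontriviallyNormedField K] [IsUltrametricDist K] [CompleteSpace K] [CharZero K]
    {V : Type u} [AddCommGroup V] [Module K V] [TopologicalSpace V] [IsTopologicalAddGroup V]
    [ContinuousSMul K V] [T2Space V]
    [IsLinearTopology (NormedField.valuation (K := K)).integer V]
    {dG : ℕ} {G : Type u} [Group G] [TopologicalSpace G] [ChartedSpace (Fin dG → K) G]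
    [LieGroup 𝓘(K, Fin dG → K) ω G] [T2Space G]
    (ρ : G →* (V ≃L[K] V)) (hρ : IsLocallyAnalyticRep 𝓘(K, Fin dG → K) ρ)
    (Y : LaMan K) :
    QuasiIso (deRhamInclusion 𝓘(K, Fin dG → K) ρ Y) :=
  mainTheorem6_general _ ρ Y
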